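/- **Setting.** Let $d\in\mathbb N^*$, $T>0$, $n\in\mathbb N^*$, and put $\delta_n^l=T/n^l$, $\pi^{\delta}=\{k\delta:k\in\mathbb N\}$. $\mathcal M_b$ is the set of bounded measurable $f:\mathbb R^d\to\mathbb R$; $\|f\|_{r,\infty}$ and $\|f\|_{r,1}$ are the largest sup norm, resp. $L^1$ norm, of a derivative $\partial^\gamma f$, $|\gamma|\le r$; $\mathcal C_b^r$ (resp. $\mathcal C_1^r$) is the set of $C^r$ functions for which $\|f\|_{r,\infty}$ (resp. $\|f\|_{r,1}$) is finite, $\mathcal C_b^\infty=\bigcap_r\mathcal C_b^r$. For an operator $A$, $A^*$ is its dual for the scalar product of $L^2(\mathbb R^d)$. Let $(P_{s,t})_{0\le s\le t\le T}$ be the semigroup of an inhomogeneous Markov process on $\mathbb R^d$ (Markov kernels with $P_{s,s}=\mathrm{Id}$, $P_{s,u}P_{u,t}=P_{s,t}$), $P_T=P_{0,T}$, and for each $l\ge1$ let $(Q^{\delta_n^l}_{s,t})_{s\le t\le T;\ s,t\in\pi^{\delta_n^l}}$ be a discrete-time Markov semigroup. All times below lie in $[0,T]$. Let $\alpha>0$,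 $\beta\in\mathbb N$, $\nu>0$, $\eta\ge0$. Put $m(l,\nu)=\lceil \nu/((1+\alpha)l+\alpha)\rceil$, $q_i(l,\nu)=\nu+\lceil i-(1+\alpha)(l+1)(i-1)\rceil$, and recursively $$\kappa(l,\nu)=\max\{\beta m(l,\nu),\ \max_{1\le i\le m(l,\nu)-1} i\,\kappa(l+1,q_i(l,\nu))\},\qquad q_\nu=\max_{1\le i\le m(0,\nu)} i\max(\beta,\kappa(1,q_i(0,\nu))),$$ $$\hat Q^{\nu,\delta_n^l}_{t,t+\delta_n^l}=Q^{\delta_n^{l+1}}_{t,t+\delta_n^l}+\sum_{i=1}^{m(l,\nu)-1}\ \sum_{t=t_0<t_1<\dots<t_i\le t+\delta_n^l,\ t_j\in\pi^{\delta_n^{l+1}}}\Big(\prod_{j=1}^{i}Q^{\delta_n^{l+1}}_{t_{j-1},t_j-\delta_n^{l+1}}\big(\hat Q^{q_i(l,\nu),\delta_n^{l+1}}_{t_j-\delta_n^{l+1},t_j}-Q^{\delta_n^{l+1}}_{t_j-\delta_n^{l+1},t_j}\big)\Big)Q^{\delta_n^{l+1}}_{t_i,t+\delta_n^l},$$ which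 is a terminating recursion, and $T(\nu)=\inf\{t\in\pi^{\delta_n^1}: t\ge T\frac{n-m(0,\nu)}{n(m(0,\nu)+1)}\}$. **Hypotheses**, with constants $K_r\ge0$ ($r\in\mathbb N$) and $L\ge0$: 1. For all $r$ and $s\le t$: $P_{s,t}$ maps $\mathcal C_b^r$ to $\mathcal C_b^r$ with $\|P_{s,t}f\|_{r,\infty}\le K_r\|f\|_{r,\infty}$, and $P_{s,t}^*$ maps $\mathcal C_1^r$ to $\mathcal C_1^r$ with $\|P^*_{s,t}f\|_{r,1}\le K_r\|f\|_{r,1}$. 2. ($\overline R_{n,\nu,\eta}(Q)$) For every $k\ge1$: the two properties in 1 hold for $Q^{\delta_n^k}_{s,t}$, $s\le t$ in $\pi^{\delta_n^k}$; and there is a family of linear operators $\overline Q^{\delta_n^k}_{s,t}:\mathcal M_b\to\mathcal M_b$, $s<t$ in $\pi^{\delta_n^k}$ (not necessarily a semigroup), such that $\overline Q^{\delta_n^k}_{s,t}\partial^\gamma f\in\mathcal C_b^r$ and $\|\overline Q^{\delta_n^k}_{s,t}\partial^\gamma f\|_{r,\infty}\le L(t-s)^{-\eta}\|f\|_\infty$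 whenever $|\gamma|+r\le q_\nu$ and $f\in\mathcal C_b^\infty$, and such that $\|Q^{\delta_n^k}_{s,t}f-\overline Q^{\delta_n^k}_{s,t}f\|_\infty\le L(t-s)^{-\eta}\|f\|_\infty/n^{\nu+m(0,\nu)}$ for all $s<t$ in $\pi^{\delta_n^1}$ and $f\in\mathcal M_b$. 3. For every $k\ge1$, $r\in\mathbb N$, $t\in\pi^{\delta_n^k}$ with $t+\delta_n^k\le T$: $\|P_{t,t+\delta_n^k}f-Q^{\delta_n^k}_{t,t+\delta_n^k}f\|_{r,\infty}\le K_r\|f\|_{\beta+r,\infty}(\delta_n^k)^{\alpha+1}$ for $f\in\mathcal C_b^{\beta+r}$, and $\|P^*_{t,t+\delta_n^k}f-Q^{\delta_n^k,*}_{t,t+\delta_n^k}f\|_{r,1}\le K_r\|f\|_{\beta+r,1}(\delta_n^k)^{\alpha+1}$ for $f\in\mathcal C_1^{\beta+r}$. **Conclusion.** There is $p\ge0$ depending only on $\nu$ and $\alpha$ and, for every $T_0>0$, a constant $C>0$ depending only on $d,\alpha,\beta,\nu,\eta,(K_r)_r,L$ and $T_0$ (not on $n$, $f$, $P$, $Q$,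 nor on $T\ge T_0$) such that, whenever $T\ge T_0$ and the hypotheses hold, for every $f\in\mathcal M_b(\mathbb R^d)$, $$\|P_Tf-\hat Q^{\nu,\delta_n^0}_{0,T}f\|_\infty\le\frac1{n^\nu}\,\|f\|_\infty\,\frac{C(1+T^p)}{T(\nu)^\eta},$$ where the right-hand side is read as $+\infty$ if $T(\nu)^\eta=0$ and $f\ne0$ (which can happen only if $n\le m(0,\nu)$). -/

import Mathlib

open MeasureTheory ProbabilityTheory
open scoped ENNReal NNReal

noncomputable section

namespace TVApprox

/-! ### Function spaces and norms -/

/-- The state space `ℝ^d`. -/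
abbrev St (d : ℕ) : Type := EuclideanSpace ℝ (Fin d)

/-- Functional operators on real functions on `ℝ^d`. -/
abbrev Op (d : ℕ) : Type := (St d → ℝ) → (St d → ℝ)

/-- Bounded measurable functions. -/
def MemMb {d : ℕ} (f : St d → ℝ) : Prop :=
  Measurable f ∧ ∃ M : ℝ, ∀ x, |f x| ≤ M

/-- The partial derivative in the `i`-th coordinate direction. -/
def pderiv {d : ℕ} (i : Fin d) (f : St d → ℝ) : St d → ℝ :=
  fun x => fderiv ℝ f x (EuclideanSpace.single i 1)

/-- The word `1 … 1 2 … 2 … d … d` in which the letter `i` occurs `γ i` times. -/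
def word {d : ℕ} (γ : Fin d → ℕ) : List (Fin d) :=
  (List.finRange d).flatMap fun i => List.replicate (γ i) i

/-- `∂^γ f = ∂_1^{γ 1} … ∂_d^{γ d} f` for a multi-index `γ`. -/
def mderiv {d : ℕ} (γ : Fin d → ℕ) (f : St d → ℝ) : St d → ℝ :=
  (word γ).foldr pderiv f

/-- The supremum norm, with values in `[0, ∞]`. -/
def supNorm {d : ℕ} (f : St d → ℝ) : ℝ≥0∞ := ⨆ x, ‖f x‖ₑ

/-- `‖f‖_{r,∞}`: the largest supremum norm of a derivative of order at most `r`. -/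
def cbNorm {d : ℕ} (r : ℕ) (f : St d → ℝ) : ℝ≥0∞ :=
  ⨆ γ : Fin d → ℕ, ⨆ _ : ∑ i, γ i ≤ r, supNorm (mderiv γ f)

/-- `‖f‖_{r,1}`: the largest `L¹` norm of a derivative of order at most `r`. -/
def c1Norm {d : ℕ} (r : ℕ) (f : St d → ℝ) : ℝ≥0∞ :=
  ⨆ γ : Fin d → ℕ, ⨆ _ : ∑ i, γ i ≤ r, ∫⁻ x, ‖mderiv γ f x‖ₑ

/-- The space `C_b^r(ℝ^d)`. -/
def MemCb {d : ℕ} (r : ℕ) (f : St d → ℝ) : Prop :=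
  ContDiff ℝ r f ∧ cbNorm r f < ∞

/-- The space `C_b^∞(ℝ^d)`. -/
def MemCbInf {d : ℕ} (f : St d → ℝ) : Prop := ∀ r : ℕ, MemCb r f

/-- The space `C_1^r(ℝ^d)`. -/
def MemC1 {d : ℕ} (r : ℕ) (f : St d → ℝ) : Prop :=
  ContDiff ℝ r f ∧ c1Norm r f < ∞

/-! ### Operators, duality, semigroups -/

/-- The operator `f ↦ ∫ f(y) κ(·, dy)` of a kernel. -/
def kop {d : ℕ} (κ : Kernel (St d) (St d)) : Op d := fun f x => ∫ y, f y ∂(κ x)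

/-- `h = A^* f` for the scalar product of `L²(ℝ^d)`: `⟨A g, f⟩ = ⟨g, h⟩` for all bounded
measurable `g`. -/
def IsDual {d : ℕ} (A : Op d) (f h : St d → ℝ) : Prop :=
  ∀ g, MemMb g → ∫ x, A g x * f x = ∫ x, g x * h x

/-- `A` is a linear operator on the space of bounded measurable functions. -/
structure IsFunctionalOperator {d : ℕ} (A : Op d) : Prop where
  maps : ∀ f, MemMb f → MemMb (A f)
  add : ∀ f g, MemMb f → MemMb g → A (f + g) = A f + A g
  smul : ∀ (c : ℝ) (f), MemMb f → A (c • f) = c • A f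

/-- `P s t` (`0 ≤ s ≤ t ≤ T`) is an inhomogeneous Markov semigroup: as operators,
`P_{s,u} P_{u,t} = P_{s,t}`. -/
structure IsMarkovSemigroup {d : ℕ} (T : ℝ) (P : ℝ → ℝ → Kernel (St d) (St d)) : Prop where
  markov : ∀ s t, 0 ≤ s → s ≤ t → t ≤ T → IsMarkovKernel (P s t)
  refl : ∀ s, 0 ≤ s → s ≤ T → P s s = Kernel.id
  comp : ∀ s u t, 0 ≤ s → s ≤ u → u ≤ t → t ≤ T → (P u t) ∘ₖ (P s u) = P s t

/-- `Q i j` (`i ≤ j ≤ N`) is a discrete time inhomogeneous Markov semigroup; the integers are the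
indices of the points of the time grid. -/
structure IsDiscreteMarkovSemigroup {d : ℕ} (N : ℕ) (Q : ℕ → ℕ → Kernel (St d) (St d)) :
    Prop where
  markov : ∀ i j, i ≤ j → j ≤ N → IsMarkovKernel (Q i j)
  refl : ∀ i, i ≤ N → Q i i = Kernel.id
  comp : ∀ i k j, i ≤ k → k ≤ j → j ≤ N → (Q k j) ∘ₖ (Q i k) = Q i j

/-- The time step `T / n^l`. -/
def step (T : ℝ) (n l : ℕ) : ℝ := T / (n : ℝ) ^ l

/-! ### The assumptions

In all of them `Q l i j` is the kernel of level `l` between the times `i T/n^l` and `j T/n^l`. -/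

/-- Transport of regularity by one operator: `‖A f‖_{r,∞} ≤ K_r ‖f‖_{r,∞}`. -/
def Transports {d : ℕ} (K : ℕ → ℝ≥0) (A : Op d) : Prop :=
  ∀ (r : ℕ) (f : St d → ℝ), MemCb r f → MemCb r (A f) ∧ cbNorm r (A f) ≤ K r * cbNorm r f

/-- Dual transport of regularity by one operator: `‖A^* f‖_{r,1} ≤ K_r ‖f‖_{r,1}`. -/
def TransportsDual {d : ℕ} (K : ℕ → ℝ≥0) (A : Op d) : Prop :=
  ∀ (r : ℕ) (f : St d → ℝ), MemC1 r f →
    ∃ h, IsDual A f h ∧ MemC1 r h ∧ c1Norm r h ≤ K r * c1Norm r f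

/-- The short time estimate of level `l`. -/
def ShortTime {d : ℕ} (K : ℕ → ℝ≥0) (α : ℝ) (β : ℕ) (T : ℝ) (n l : ℕ)
    (P : ℝ → ℝ → Kernel (St d) (St d)) (Q : ℕ → ℕ → ℕ → Kernel (St d) (St d)) : Prop :=
  ∀ (r : ℕ) (f : St d → ℝ), MemCb (β + r) f → ∀ i : ℕ, i + 1 ≤ n ^ l →
    cbNorm r (kop (P (i * step T n l) ((i + 1 : ℕ) * step T n l)) f - kop (Q l i (i + 1)) f) ≤
      K r * cbNorm (β + r) f * ENNReal.ofReal (step T n l ^ (α + 1))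

/-- The dual short time estimate of level `l`. -/
def ShortTimeDual {d : ℕ} (K : ℕ → ℝ≥0) (α : ℝ) (β : ℕ) (T : ℝ) (n l : ℕ)
    (P : ℝ → ℝ → Kernel (St d) (St d)) (Q : ℕ → ℕ → ℕ → Kernel (St d) (St d)) : Prop :=
  ∀ (r : ℕ) (f : St d → ℝ), MemC1 (β + r) f → ∀ i : ℕ, i + 1 ≤ n ^ l →
    ∃ h₁ h₂ : St d → ℝ,
      IsDual (kop (P (i * step T n l) ((i + 1 : ℕ) * step T n l))) f h₁ ∧ MemC1 r h₁ ∧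
      IsDual (kop (Q l i (i + 1))) f h₂ ∧ MemC1 r h₂ ∧
      c1Norm r (h₁ - h₂) ≤ K r * c1Norm (β + r) f * ENNReal.ofReal (step T n l ^ (α + 1))

/-- The regularization property of orders `q`, `η` for a family of operators `A i j`, `i < j ≤ N`,
indexed by the points of the grid `{i δ}`. -/
def Regularizes {d : ℕ} (L : ℝ≥0) (q : ℕ) (η δ : ℝ) (N : ℕ) (A : ℕ → ℕ → Op d) : Prop :=
  ∀ (r : ℕ) (γ : Fin d → ℕ), ∑ i, γ i + r ≤ q → ∀ f : St d → ℝ, MemCbInf f →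
    ∀ i j : ℕ, i < j → j ≤ N →
      MemCb r (A i j (mderiv γ f)) ∧
      cbNorm r (A i j (mderiv γ f)) ≤
        L * ENNReal.ofReal ((j * δ - i * δ) ^ (-η)) * supNorm f

/-! ### The orders of the recursion -/

/-- `m(l, ν)`. -/
def mOrd (α : ℝ) (l : ℕ) (ν : ℝ) : ℕ := ⌈ν / ((1 + α) * l + α)⌉₊

/-- `q_i(l, ν)`. -/
def qOrd (α : ℝ) (i l : ℕ) (ν : ℝ) : ℝ :=
  ν + (⌈(i : ℝ) - (1 + α) * (l + 1) * ((i : ℝ) - 1)⌉ : ℤ)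

/-- The quantity that decreases along the recursion. -/
def fuel (α : ℝ) (l : ℕ) (ν : ℝ) : ℕ := ⌈(ν - (1 + α) * l) / α⌉₊

theorem qOrd_succ_le {α : ℝ} (hα : 0 < α) (i l : ℕ) (ν : ℝ) :
    qOrd α (i + 1) l ν ≤ ν + 1 := by
  unfold qOrd
  have h : ((i + 1 : ℕ) : ℝ) - (1 + α) * (l + 1) * (((i + 1 : ℕ) : ℝ) - 1) ≤ ((1 : ℤ) : ℝ) := by
    push_cast
    have h1 : (0 : ℝ) ≤ i := Nat.cast_nonneg i
    have h2 : (0 : ℝ) ≤ l := Nat.cast_nonneg l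
    nlinarith [mul_nonneg h1 h2, mul_nonneg hα.le h1, mul_nonneg hα.le (mul_nonneg h1 h2)]
  have h' := Int.ceil_le.2 h
  have : ((⌈((i + 1 : ℕ) : ℝ) - (1 + α) * (l + 1) * (((i + 1 : ℕ) : ℝ) - 1)⌉ : ℤ) : ℝ) ≤ 1 := by
    exact_mod_cast h'
  linarith

theorem fuel_lt {α : ℝ} (hα : 0 < α) {l : ℕ} {ν : ℝ} (i : Fin (mOrd α l ν - 1)) :
    fuel α (l + 1) (qOrd α (i + 1) l ν) < fuel α l ν := by
  have hl : (0 : ℝ) ≤ l := Nat.cast_nonneg l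
  have hm : 1 < mOrd α l ν := by have := i.2; omega
  have hden : 0 < (1 + α) * (l : ℝ) + α := by positivity
  have h1 : (1 : ℝ) < ν / ((1 + α) * l + α) := by
    have := Nat.lt_ceil.1 hm
    simpa using this
  have h2 : (1 + α) * (l : ℝ) + α < ν := by
    rw [lt_div_iff₀ hden] at h1
    linarith
  have hq := qOrd_succ_le hα i l ν
  have h3 : (qOrd α (i + 1) l ν - (1 + α) * ((l + 1 : ℕ) : ℝ)) / α ≤
      (ν - (1 + α) * l) / α - 1 := by
    rw [div_le_iff₀ hα, sub_mul, div_mul_cancel₀ _ hα.ne']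
    push_cast
    linarith
  have h4 : 0 < (ν - (1 + α) * l) / α := div_pos (by linarith) hα
  unfold fuel
  have h5 : ⌈(ν - (1 + α) * l) / α - 1⌉₊ = ⌈(ν - (1 + α) * l) / α⌉₊ - 1 := Nat.ceil_sub_one _
  have h6 := Nat.ceil_le_ceil h3
  have h7 : 0 < ⌈(ν - (1 + α) * l) / α⌉₊ := Nat.ceil_pos.2 h4
  omega

/-- `κ(l, ν) = max {β m(l, ν), max_{1 ≤ i < m(l, ν)} i κ(l + 1, q_i(l, ν))}`. -/
def kap (α : ℝ) (hα : 0 < α) (β : ℕ) (l : ℕ) (ν : ℝ) : ℕ :=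
  max (β * mOrd α l ν)
    (Finset.univ.sup fun i : Fin (mOrd α l ν - 1) =>
      ((i : ℕ) + 1) * kap α hα β (l + 1) (qOrd α (i + 1) l ν))
termination_by fuel α l ν
decreasing_by exact fuel_lt hα i

/-- `q_ν = max_{1 ≤ i ≤ m(0, ν)} i max(β, κ(1, q_i(0, ν)))`. -/
def qReg (α : ℝ) (hα : 0 < α) (β : ℕ) (ν : ℝ) : ℕ :=
  (Finset.Icc 1 (mOrd α 0 ν)).sup fun i => i * max β (kap α hα β 1 (qOrd α i 0 ν))

/-! ### The approximation -/

/-- The sum over `a = t_0 < t_1 < … < t_i ≤ e` of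
`(∏_{j=1}^i R_{t_{j-1}, t_j - 1} Λ_{t_j - 1}) R_{t_i, e}`, times being grid indices. -/
def nestedSum {d : ℕ} (R : ℕ → ℕ → Op d) (Λ : ℕ → Op d) (e : ℕ) : ℕ → ℕ → Op d
  | 0, a => R a e
  | i + 1, a => fun f => ∑ b ∈ Finset.Ioc a e, R a (b - 1) (Λ (b - 1) (nestedSum R Λ e i b f))

/-- The approximation of order `ν` on one step of level `l`: `qHat … l ν j` is
`Q̂^{ν, T/n^l}_{t, t + T/n^l}` for `t = j T/n^l`, which is the grid point of index `j n` of
level `l + 1`. -/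
def qHat {d : ℕ} (α : ℝ) (hα : 0 < α) (n : ℕ) (Q : ℕ → ℕ → ℕ → Kernel (St d) (St d))
    (l : ℕ) (ν : ℝ) : ℕ → Op d :=
  fun j f =>
    kop (Q (l + 1) (j * n) ((j + 1) * n)) f +
      ∑ i : Fin (mOrd α l ν - 1),
        nestedSum (fun a b => kop (Q (l + 1) a b))
          (fun b g => qHat α hα n Q (l + 1) (qOrd α (i + 1) l ν) b g -
            kop (Q (l + 1) b (b + 1)) g)
          ((j + 1) * n) (i + 1) (j * n) f
termination_by fuel α l ν
decreasing_by exact fuel_lt hα i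

/-- `T(ν) = inf {t ∈ {j T/n} : t ≥ T (n - m(0, ν)) / (n (m(0, ν) + 1))}`. -/
def tNu (α ν T : ℝ) (n : ℕ) : ℝ :=
  sInf {t : ℝ | (∃ j : ℕ, t = j * step T n 1) ∧
    T * ((n : ℝ) - mOrd α 0 ν) / (n * (mOrd α 0 ν + 1)) ≤ t}

/-- Every `Q k`, `k ≥ 1`, transports regularity, and so does its dual, and it has a modification
(a family of linear operators, not necessarily a semigroup) that has the regularization property
and is close to `Q k` in total variation between the points of the grid of step `T / n`. -/
def RegularModifications {d : ℕ} (K : ℕ → ℝ≥0) (L : ℝ≥0) (α : ℝ) (hα : 0 < α) (β : ℕ)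
    (ν η T : ℝ) (n : ℕ) (Q : ℕ → ℕ → ℕ → Kernel (St d) (St d)) : Prop :=
  ∀ k : ℕ, 1 ≤ k →
    (∀ i j : ℕ, i ≤ j → j ≤ n ^ k →
      Transports K (kop (Q k i j)) ∧ TransportsDual K (kop (Q k i j))) ∧
    ∃ A : ℕ → ℕ → Op d,
      (∀ i j : ℕ, i < j → j ≤ n ^ k → IsFunctionalOperator (A i j)) ∧
      Regularizes L (qReg α hα β ν) η (step T n k) (n ^ k) A ∧
      ∀ a b : ℕ, a < b → b ≤ n → ∀ f : St d → ℝ, MemMb f →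
        supNorm (kop (Q k (a * n ^ (k - 1)) (b * n ^ (k - 1))) f -
            A (a * n ^ (k - 1)) (b * n ^ (k - 1)) f) ≤
          L * ENNReal.ofReal ((b * step T n 1 - a * step T n 1) ^ (-η)) * supNorm f /
            ENNReal.ofReal ((n : ℝ) ^ (ν + mOrd α 0 ν))

end TVApprox

end

noncomputable section

namespace TVApprox

variable {d : ℕ}

/-! ### Derivatives along words -/

/-! On one step of level `l`, let `Δ` be the difference `P - Q` over a step of level `l + 1`.
Iterating the perturbation equation `P = Q + ∑ Q Δ P` expands `P` into the `i`-fold sums of `Q Δ Q …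
Δ Q`, `i < m`, plus a remainder with `m` factors `Δ` that ends in `P`. Each `Δ` costs `β`
derivatives and gains `n^{-(1+α)(l+1)}`; each summation over the `n` inner times costs a factor `n`.
The order `m(l, ν)` is what makes the remainder `O(n^{-ν})`. In the `i`-fold sum `Δ` is replaced by
`Q̂ - Q` with `Q̂` of order `q_i(l, ν)`; after telescoping one factor carries the error `n^{-q_i}`,
and `q_i` is chosen so that the total is again `O(n^{-ν})`. Induction on `fuel` gives
`levelEstimate`: `P - Q̂` is `O(n^{-ν})` at the price of `κ(l, ν)` derivatives, both in `C_b` and,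
for the dual, in `C_1`.

At level `0` the derivatives must be recovered. At most `m + 1` intervals share the `n` steps, so
one of them is long (`Grid.fam_nest`), and a regularizing operator `S` is available there. The
factor `A` to its left loses derivatives in `C_b`. The factor `B` to its right has a dual that loses
derivatives in `C_1`, so `B f` is bounded in a negative Sobolev norm by `‖f‖_∞`; by Hahn–Banach a
mollification of `B f` is a sum of derivatives `∂^γ g_γ` of bounded functions
(`exists_decomposition`). Since `S ∂^γ g_γ` has bounded derivatives, `A S B` is bounded in the
supremum norm (`Reg.of_regularizes`).

The semigroup is only close to such an `S`, with an error of order `1/n` per block, while the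
supremum norms of the sums may grow like `n^c`. The long interval is therefore cut into `M` blocks:
`X S₁ + S Y - S S₁` differs from the product `X Y` by a product of errors (`Reg.concat`,
`exists_reg_blocks`), which yields `n^{-M}` with `M ≥ c + ν`. The intervals governed by `P` inherit
the estimate because the discrete semigroups of level `k` converge to `P` as `k → ∞`
(`Model.supNorm_gridOp_le_of_forall`).

If `β = 0` nothing is lost and no regularization is needed; if `n` is bounded the crude supremum
bound suffices. The factor `T(ν)^{-η}` comes for free: tested on the constant `1`, the
regularization hypothesis forces `T^η ≤ 2L`, and `T(ν) ≤ T`. -/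

theorem length_word (γ : Fin d → ℕ) : (word γ).length = ∑ i, γ i := by
  simp only [word, List.length_flatMap, List.length_replicate]
  rw [← List.sum_ofFn]
  congr 1
  simp [List.ofFn_eq_map]

theorem word_zero : word (0 : Fin d → ℕ) = [] := by
  simp [word]

theorem mderiv_zero (f : St d → ℝ) : mderiv 0 f = f := by
  simp [mderiv, word_zero]

theorem pderiv_add {f g : St d → ℝ} (hf : Differentiable ℝ f) (hg : Differentiable ℝ g)
    (i : Fin d) : pderiv i (f + g) = pderiv i f + pderiv i g := by
  funext x
  simp [pderiv, fderiv_add (hf x) (hg x)]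

theorem pderiv_smul {f : St d → ℝ} (hf : Differentiable ℝ f) (c : ℝ) (i : Fin d) :
    pderiv i (c • f) = c • pderiv i f := by
  funext x
  simp [pderiv, fderiv_const_smul (hf x)]

theorem contDiff_pderiv {f : St d → ℝ} {r : ℕ} (hf : ContDiff ℝ (r + 1 : ℕ) f) (i : Fin d) :
    ContDiff ℝ r (pderiv i f) := by
  have h : ContDiff ℝ r (fderiv ℝ f) := hf.fderiv_right (by norm_cast)
  exact h.clm_apply contDiff_const

theorem contDiff_foldr_pderiv (w : List (Fin d)) {f : St d → ℝ} {r : ℕ}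
    (hf : ContDiff ℝ (w.length + r : ℕ) f) : ContDiff ℝ r (w.foldr pderiv f) := by
  induction w generalizing r with
  | nil => simpa using hf
  | cons i w ih =>
    refine contDiff_pderiv (ih ?_) i
    refine hf.of_le ?_
    simp only [List.length_cons]
    exact_mod_cast (by omega)

theorem foldr_pderiv_add (w : List (Fin d)) {f g : St d → ℝ}
    (hf : ContDiff ℝ w.length f) (hg : ContDiff ℝ w.length g) :
    w.foldr pderiv (f + g) = w.foldr pderiv f + w.foldr pderiv g := by
  induction w with
  | nil => rfl
  | cons i w ih =>
    have hle : ((w.length : ℕ) : WithTop ℕ∞) ≤ ((i :: w).length : ℕ) := by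
      simp only [List.length_cons]; exact_mod_cast Nat.le_succ _
    have h1 : ∀ {u : St d → ℝ}, ContDiff ℝ (i :: w).length u →
        Differentiable ℝ (w.foldr pderiv u) := fun {u} hu =>
      (contDiff_foldr_pderiv w (r := 1) (by simpa using hu)).differentiable (by simp)
    rw [List.foldr_cons, ih (hf.of_le hle) (hg.of_le hle), pderiv_add (h1 hf) (h1 hg)]
    rfl

theorem foldr_pderiv_smul (w : List (Fin d)) {f : St d → ℝ} (c : ℝ)
    (hf : ContDiff ℝ w.length f) :
    w.foldr pderiv (c • f) = c • w.foldr pderiv f := by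
  induction w with
  | nil => rfl
  | cons i w ih =>
    have hle : ((w.length : ℕ) : WithTop ℕ∞) ≤ ((i :: w).length : ℕ) := by
      simp only [List.length_cons]; exact_mod_cast Nat.le_succ _
    have h1 : Differentiable ℝ (w.foldr pderiv f) :=
      (contDiff_foldr_pderiv w (r := 1) (by simpa using hf)).differentiable (by simp)
    rw [List.foldr_cons, ih (hf.of_le hle), pderiv_smul h1]
    rfl

theorem contDiff_mderiv {γ : Fin d → ℕ} {f : St d → ℝ} {r k : ℕ} (hf : ContDiff ℝ k f)
    (h : ∑ i, γ i + r ≤ k) : ContDiff ℝ r (mderiv γ f) := by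
  refine contDiff_foldr_pderiv _ (hf.of_le ?_)
  rw [length_word]
  exact_mod_cast h

theorem mderiv_add {γ : Fin d → ℕ} {f g : St d → ℝ} {r : ℕ} (h : ∑ i, γ i ≤ r)
    (hf : ContDiff ℝ r f) (hg : ContDiff ℝ r g) :
    mderiv γ (f + g) = mderiv γ f + mderiv γ g := by
  have hle : ((word γ).length : WithTop ℕ∞) ≤ r := by rw [length_word]; exact_mod_cast h
  exact foldr_pderiv_add _ (hf.of_le hle) (hg.of_le hle)

theorem mderiv_smul {γ : Fin d → ℕ} {f : St d → ℝ} {r : ℕ} (h : ∑ i, γ i ≤ r) (c : ℝ)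
    (hf : ContDiff ℝ r f) : mderiv γ (c • f) = c • mderiv γ f := by
  have hle : ((word γ).length : WithTop ℕ∞) ≤ r := by rw [length_word]; exact_mod_cast h
  exact foldr_pderiv_smul _ c (hf.of_le hle)

/-- Needed to bound each partial derivative by `cbNorm 1`, which gives Lipschitz continuity in
`MemCb.lipschitz`. -/
theorem word_single (i : Fin d) : word (Pi.single i 1) = [i] := by
  have h : ∀ l : List (Fin d), l.Nodup →
      (l.flatMap fun j => List.replicate ((Pi.single i 1 : Fin d → ℕ) j) j) =
        if i ∈ l then [i] else [] := by
    intro l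
    induction l with
    | nil => simp
    | cons a l ih =>
      intro hl
      rw [List.nodup_cons] at hl
      rw [List.flatMap_cons, ih hl.2]
      by_cases ha : a = i
      · subst ha
        simp [hl.1]
      · simp [ha, Ne.symm ha]
  have := h (List.finRange d) (List.nodup_finRange d)
  simpa [word] using this

theorem mderiv_single (i : Fin d) (f : St d → ℝ) :
    mderiv (Pi.single i 1) f = pderiv i f := by
  simp [mderiv, word_single]

/-! ### The norms -/

theorem enorm_le_supNorm (f : St d → ℝ) (x : St d) : ‖f x‖ₑ ≤ supNorm f :=
  le_iSup (fun x => ‖f x‖ₑ) x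

theorem supNorm_le {f : St d → ℝ} {c : ℝ≥0∞} (h : ∀ x, ‖f x‖ₑ ≤ c) : supNorm f ≤ c :=
  iSup_le h

theorem supNorm_zero : supNorm (0 : St d → ℝ) = 0 := by
  simp [supNorm]

theorem supNorm_add_le (f g : St d → ℝ) : supNorm (f + g) ≤ supNorm f + supNorm g :=
  supNorm_le fun x => (enorm_add_le (f x) (g x)).trans
    (add_le_add (enorm_le_supNorm f x) (enorm_le_supNorm g x))

theorem supNorm_smul_le (c : ℝ) (f : St d → ℝ) : supNorm (c • f) ≤ ‖c‖ₑ * supNorm f :=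
  supNorm_le fun x => by
    rw [Pi.smul_apply, smul_eq_mul, enorm_mul]
    gcongr
    exact enorm_le_supNorm f x

theorem supNorm_neg (f : St d → ℝ) : supNorm (-f) = supNorm f := by
  simp [supNorm]

theorem supNorm_sub_le (f g : St d → ℝ) : supNorm (f - g) ≤ supNorm f + supNorm g := by
  rw [sub_eq_add_neg, ← supNorm_neg g]
  exact supNorm_add_le f (-g)

theorem supNorm_sum_le {ι : Type*} (s : Finset ι) (f : ι → St d → ℝ) :
    supNorm (∑ i ∈ s, f i) ≤ ∑ i ∈ s, supNorm (f i) := by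
  classical
  induction s using Finset.induction_on with
  | empty => simp [supNorm_zero]
  | insert a s ha ih =>
    rw [Finset.sum_insert ha, Finset.sum_insert ha]
    exact (supNorm_add_le _ _).trans (by gcongr)

theorem supNorm_mderiv_le_cbNorm {γ : Fin d → ℕ} {r : ℕ} (h : ∑ i, γ i ≤ r) (f : St d → ℝ) :
    supNorm (mderiv γ f) ≤ cbNorm r f :=
  le_iSup₂ (f := fun (γ : Fin d → ℕ) (_ : ∑ i, γ i ≤ r) => supNorm (mderiv γ f)) γ h

theorem supNorm_le_cbNorm (r : ℕ) (f : St d → ℝ) : supNorm f ≤ cbNorm r f := by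
  have := supNorm_mderiv_le_cbNorm (γ := 0) (r := r) (by simp) f
  rwa [mderiv_zero] at this

theorem cbNorm_le {r : ℕ} {f : St d → ℝ} {c : ℝ≥0∞}
    (h : ∀ γ : Fin d → ℕ, ∑ i, γ i ≤ r → supNorm (mderiv γ f) ≤ c) : cbNorm r f ≤ c :=
  iSup₂_le h

theorem cbNorm_zero_eq (f : St d → ℝ) : cbNorm 0 f = supNorm f := by
  refine le_antisymm (cbNorm_le fun γ hγ => ?_) (supNorm_le_cbNorm 0 f)
  have : γ = 0 := by
    funext i
    have := Finset.single_le_sum (f := γ) (fun _ _ => Nat.zero_le _) (Finset.mem_univ i)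
    simp only [Pi.zero_apply]; omega
  rw [this, mderiv_zero]

theorem cbNorm_mono {r r' : ℕ} (h : r ≤ r') (f : St d → ℝ) : cbNorm r f ≤ cbNorm r' f :=
  cbNorm_le fun _ hγ => supNorm_mderiv_le_cbNorm (hγ.trans h) f

theorem cbNorm_add_le {r : ℕ} {f g : St d → ℝ} (hf : ContDiff ℝ r f) (hg : ContDiff ℝ r g) :
    cbNorm r (f + g) ≤ cbNorm r f + cbNorm r g :=
  cbNorm_le fun γ hγ => by
    rw [mderiv_add hγ hf hg]
    exact (supNorm_add_le _ _).trans
      (add_le_add (supNorm_mderiv_le_cbNorm hγ f) (supNorm_mderiv_le_cbNorm hγ g))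

theorem cbNorm_smul_le {r : ℕ} {f : St d → ℝ} (c : ℝ) (hf : ContDiff ℝ r f) :
    cbNorm r (c • f) ≤ ‖c‖ₑ * cbNorm r f :=
  cbNorm_le fun γ hγ => by
    rw [mderiv_smul hγ c hf]
    exact (supNorm_smul_le _ _).trans (by gcongr; exact supNorm_mderiv_le_cbNorm hγ f)

theorem lintegral_mderiv_le_c1Norm {γ : Fin d → ℕ} {r : ℕ} (h : ∑ i, γ i ≤ r) (f : St d → ℝ) :
    ∫⁻ x, ‖mderiv γ f x‖ₑ ≤ c1Norm r f :=
  le_iSup₂ (f := fun (γ : Fin d → ℕ) (_ : ∑ i, γ i ≤ r) => ∫⁻ x, ‖mderiv γ f x‖ₑ) γ h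

theorem lintegral_le_c1Norm (r : ℕ) (f : St d → ℝ) : ∫⁻ x, ‖f x‖ₑ ≤ c1Norm r f := by
  have := lintegral_mderiv_le_c1Norm (γ := 0) (r := r) (by simp) f
  rwa [mderiv_zero] at this

theorem c1Norm_le {r : ℕ} {f : St d → ℝ} {c : ℝ≥0∞}
    (h : ∀ γ : Fin d → ℕ, ∑ i, γ i ≤ r → ∫⁻ x, ‖mderiv γ f x‖ₑ ≤ c) : c1Norm r f ≤ c :=
  iSup₂_le h

theorem c1Norm_mono {r r' : ℕ} (h : r ≤ r') (f : St d → ℝ) : c1Norm r f ≤ c1Norm r' f :=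
  c1Norm_le fun _ hγ => lintegral_mderiv_le_c1Norm (hγ.trans h) f

theorem c1Norm_add_le {r : ℕ} {f g : St d → ℝ} (hf : ContDiff ℝ r f) (hg : ContDiff ℝ r g) :
    c1Norm r (f + g) ≤ c1Norm r f + c1Norm r g :=
  c1Norm_le fun γ hγ => by
    rw [mderiv_add hγ hf hg]
    have hm : Measurable fun x => ‖mderiv γ f x‖ₑ :=
      ((contDiff_mderiv (r := 0) hf (by simpa using hγ)).continuous.measurable).enorm
    calc ∫⁻ x, ‖(mderiv γ f + mderiv γ g) x‖ₑ
        ≤ ∫⁻ x, (‖mderiv γ f x‖ₑ + ‖mderiv γ g x‖ₑ) := lintegral_mono fun x => enorm_add_le _ _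
      _ = (∫⁻ x, ‖mderiv γ f x‖ₑ) + ∫⁻ x, ‖mderiv γ g x‖ₑ := lintegral_add_left hm _
      _ ≤ _ := add_le_add (lintegral_mderiv_le_c1Norm hγ f) (lintegral_mderiv_le_c1Norm hγ g)

theorem c1Norm_smul_le {r : ℕ} {f : St d → ℝ} (c : ℝ) (hf : ContDiff ℝ r f) :
    c1Norm r (c • f) ≤ ‖c‖ₑ * c1Norm r f :=
  c1Norm_le fun γ hγ => by
    rw [mderiv_smul hγ c hf]
    have : ∀ x, ‖(c • mderiv γ f) x‖ₑ = ‖c‖ₑ * ‖mderiv γ f x‖ₑ := fun x => by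
      simp [enorm_mul]
    simp_rw [this]
    rw [lintegral_const_mul' _ _ (by simp)]
    gcongr
    exact lintegral_mderiv_le_c1Norm hγ f

/-! ### The function spaces -/

theorem memMb_iff {f : St d → ℝ} : MemMb f ↔ Measurable f ∧ supNorm f < ∞ := by
  refine and_congr_right fun _ => ⟨fun ⟨M, hM⟩ => ?_, fun h => ⟨(supNorm f).toReal, fun x => ?_⟩⟩
  · refine lt_of_le_of_lt (supNorm_le (c := ENNReal.ofReal M) fun x => ?_) ENNReal.ofReal_lt_top
    rw [← ofReal_norm, Real.norm_eq_abs]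
    exact ENNReal.ofReal_le_ofReal (hM x)
  · have := (ENNReal.toReal_le_toReal (by simp) h.ne).2 (enorm_le_supNorm f x)
    simpa using this

theorem MemMb.add {f g : St d → ℝ} (hf : MemMb f) (hg : MemMb g) : MemMb (f + g) := by
  rw [memMb_iff] at *
  exact ⟨hf.1.add hg.1, (supNorm_add_le f g).trans_lt (ENNReal.add_lt_top.2 ⟨hf.2, hg.2⟩)⟩

theorem MemMb.smul {f : St d → ℝ} (c : ℝ) (hf : MemMb f) : MemMb (c • f) := by
  rw [memMb_iff] at *
  exact ⟨hf.1.const_smul c, (supNorm_smul_le c f).trans_lt (ENNReal.mul_lt_top (by simp) hf.2)⟩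

theorem MemMb.neg {f : St d → ℝ} (hf : MemMb f) : MemMb (-f) := by
  simpa using hf.smul (-1)

theorem MemMb.sub {f g : St d → ℝ} (hf : MemMb f) (hg : MemMb g) : MemMb (f - g) := by
  simpa [sub_eq_add_neg] using hf.add hg.neg

theorem memMb_zero : MemMb (0 : St d → ℝ) := memMb_iff.2 ⟨measurable_zero, by simp [supNorm_zero]⟩

theorem MemMb.sum {ι : Type*} {s : Finset ι} {f : ι → St d → ℝ} (h : ∀ i ∈ s, MemMb (f i)) :
    MemMb (∑ i ∈ s, f i) :=
  Finset.sum_induction _ MemMb (fun _ _ => MemMb.add) memMb_zero h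

theorem MemMb.integrable {f : St d → ℝ} (hf : MemMb f) (μ : Measure (St d)) [IsFiniteMeasure μ] :
    Integrable f μ := by
  obtain ⟨hm, M, hM⟩ := hf
  exact Integrable.of_bound hm.aestronglyMeasurable M (Filter.Eventually.of_forall hM)

theorem MemMb.mul_integrable {f h : St d → ℝ} (hf : MemMb f) (hh : Integrable h) :
    Integrable fun x => f x * h x := by
  obtain ⟨hm, M, hM⟩ := hf
  exact hh.bdd_mul hm.aestronglyMeasurable (Filter.Eventually.of_forall hM)

theorem MemCb.memMb {r : ℕ} {f : St d → ℝ} (hf : MemCb r f) : MemMb f :=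
  memMb_iff.2 ⟨hf.1.continuous.measurable, (supNorm_le_cbNorm r f).trans_lt hf.2⟩

theorem MemCbInf.memMb {f : St d → ℝ} (hf : MemCbInf f) : MemMb f := (hf 0).memMb

theorem MemCb.of_le {r r' : ℕ} (h : r ≤ r') {f : St d → ℝ} (hf : MemCb r' f) : MemCb r f :=
  ⟨hf.1.of_le (by exact_mod_cast h), (cbNorm_mono h f).trans_lt hf.2⟩

theorem MemCb.add {r : ℕ} {f g : St d → ℝ} (hf : MemCb r f) (hg : MemCb r g) :
    MemCb r (f + g) :=
  ⟨hf.1.add hg.1, (cbNorm_add_le hf.1 hg.1).trans_lt (ENNReal.add_lt_top.2 ⟨hf.2, hg.2⟩)⟩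

theorem MemCb.smul {r : ℕ} {f : St d → ℝ} (c : ℝ) (hf : MemCb r f) : MemCb r (c • f) :=
  ⟨contDiff_const.smul hf.1,
    (cbNorm_smul_le c hf.1).trans_lt (ENNReal.mul_lt_top (by simp) hf.2)⟩

theorem MemCbInf.smul {f : St d → ℝ} (c : ℝ) (hf : MemCbInf f) : MemCbInf (c • f) :=
  fun r => (hf r).smul c

theorem MemCbInf.mderiv {f : St d → ℝ} (hf : MemCbInf f) (γ : Fin d → ℕ) :
    MemMb (mderiv γ f) :=
  memMb_iff.2 ⟨(contDiff_mderiv (r := 0) (hf (∑ i, γ i)).1 (by simp)).continuous.measurable,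
    (supNorm_mderiv_le_cbNorm le_rfl f).trans_lt (hf (∑ i, γ i)).2⟩

theorem MemC1.integrable {r : ℕ} {f : St d → ℝ} (hf : MemC1 r f) : Integrable f :=
  ⟨hf.1.continuous.aestronglyMeasurable, (lintegral_le_c1Norm r f).trans_lt hf.2⟩

theorem MemC1.of_le {r r' : ℕ} (h : r ≤ r') {f : St d → ℝ} (hf : MemC1 r' f) : MemC1 r f :=
  ⟨hf.1.of_le (by exact_mod_cast h), (c1Norm_mono h f).trans_lt hf.2⟩

theorem MemC1.add {r : ℕ} {f g : St d → ℝ} (hf : MemC1 r f) (hg : MemC1 r g) :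
    MemC1 r (f + g) :=
  ⟨hf.1.add hg.1, (c1Norm_add_le hf.1 hg.1).trans_lt (ENNReal.add_lt_top.2 ⟨hf.2, hg.2⟩)⟩

theorem MemC1.smul {r : ℕ} {f : St d → ℝ} (c : ℝ) (hf : MemC1 r f) : MemC1 r (c • f) :=
  ⟨contDiff_const.smul hf.1,
    (c1Norm_smul_le c hf.1).trans_lt (ENNReal.mul_lt_top (by simp) hf.2)⟩

theorem MemC1.sub {r : ℕ} {f g : St d → ℝ} (hf : MemC1 r f) (hg : MemC1 r g) :
    MemC1 r (f - g) := by
  simpa [sub_eq_add_neg] using hf.add (hg.smul (-1))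

/-! ### Differences of finite kernels -/

theorem memMb_kop {κ : Kernel (St d) (St d)} [IsFiniteKernel κ] {f : St d → ℝ} (hf : MemMb f) :
    MemMb (kop κ f) := by
  obtain ⟨hm, M, hM⟩ := hf
  refine ⟨hm.stronglyMeasurable.integral_kernel.measurable, M * (κ.bound).toReal, fun x => ?_⟩
  have hM0 : 0 ≤ M := (abs_nonneg _).trans (hM x)
  have h1 : ‖∫ y, f y ∂(κ x)‖ ≤ M * (κ x).real Set.univ :=
    norm_integral_le_of_norm_le_const (Filter.Eventually.of_forall hM)
  refine h1.trans (mul_le_mul_of_nonneg_left ?_ hM0)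
  exact ENNReal.toReal_mono (Kernel.bound_ne_top κ) (Kernel.measure_le_bound κ x _)

theorem kop_add {κ : Kernel (St d) (St d)} [IsFiniteKernel κ] {f g : St d → ℝ} (hf : MemMb f)
    (hg : MemMb g) : kop κ (f + g) = kop κ f + kop κ g :=
  funext fun x => integral_add (hf.integrable (κ x)) (hg.integrable (κ x))

theorem kop_smul (κ : Kernel (St d) (St d)) (c : ℝ) (f : St d → ℝ) :
    kop κ (c • f) = c • kop κ f :=
  funext fun _ => integral_const_mul c f

theorem kop_sub {κ : Kernel (St d) (St d)} [IsFiniteKernel κ] {f g : St d → ℝ} (hf : MemMb f)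
    (hg : MemMb g) : kop κ (f - g) = kop κ f - kop κ g :=
  funext fun x => integral_sub (hf.integrable (κ x)) (hg.integrable (κ x))

theorem kop_comp {κ κ' : Kernel (St d) (St d)} [IsFiniteKernel κ] [IsFiniteKernel κ']
    {f : St d → ℝ} (hf : MemMb f) : kop (κ' ∘ₖ κ) f = kop κ (kop κ' f) :=
  funext fun x => ProbabilityTheory.Kernel.integral_comp (hf.integrable ((κ' ∘ₖ κ) x))

theorem kop_add_kernel {κ κ' : Kernel (St d) (St d)} [IsFiniteKernel κ] [IsFiniteKernel κ']
    {f : St d → ℝ} (hf : MemMb f) : kop (κ + κ') f = kop κ f + kop κ' f := by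
  funext x
  simp only [kop, _root_.add_apply, Pi.add_apply]
  exact integral_add_measure (hf.integrable _) (hf.integrable _)

theorem kop_id (f : St d → ℝ) (hf : MemMb f) : kop Kernel.id f = f := by
  funext x
  simp only [kop, Kernel.id_apply]
  exact integral_dirac' f x hf.1.stronglyMeasurable

theorem supNorm_kop_le {κ : Kernel (St d) (St d)} [IsMarkovKernel κ] {f : St d → ℝ} :
    supNorm (kop κ f) ≤ supNorm f :=
  supNorm_le fun x => by
    calc ‖∫ y, f y ∂(κ x)‖ₑ ≤ ∫⁻ y, ‖f y‖ₑ ∂(κ x) := enorm_integral_le_lintegral_enorm _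
      _ ≤ ∫⁻ _, supNorm f ∂(κ x) := lintegral_mono fun y => enorm_le_supNorm f y
      _ = supNorm f := by simp

/-- On bounded measurable functions, `A` is a difference of two finite kernels. -/
def IsKer (A : Op d) : Prop :=
  ∃ κ κ' : Kernel (St d) (St d), IsFiniteKernel κ ∧ IsFiniteKernel κ' ∧
    ∀ f, MemMb f → A f = kop κ f - kop κ' f

namespace IsKer

theorem maps {A : Op d} (hA : IsKer A) {f : St d → ℝ} (hf : MemMb f) : MemMb (A f) := by
  obtain ⟨κ, κ', _, _, h⟩ := hA
  rw [h f hf]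
  exact (memMb_kop hf).sub (memMb_kop hf)

theorem map_add {A : Op d} (hA : IsKer A) {f g : St d → ℝ} (hf : MemMb f) (hg : MemMb g) :
    A (f + g) = A f + A g := by
  obtain ⟨κ, κ', _, _, h⟩ := hA
  rw [h _ (hf.add hg), h f hf, h g hg, kop_add hf hg, kop_add hf hg]
  abel

theorem map_smul {A : Op d} (hA : IsKer A) (c : ℝ) {f : St d → ℝ} (hf : MemMb f) :
    A (c • f) = c • A f := by
  obtain ⟨κ, κ', _, _, h⟩ := hA
  rw [h _ (hf.smul c), h f hf, kop_smul, kop_smul, smul_sub]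

theorem isFunctionalOperator {A : Op d} (hA : IsKer A) : IsFunctionalOperator A :=
  ⟨fun _ => hA.maps, fun _ _ => hA.map_add, fun c _ => hA.map_smul c⟩

theorem of_kop (κ : Kernel (St d) (St d)) [IsFiniteKernel κ] : IsKer (kop κ) := by
  refine ⟨κ, 0, inferInstance, inferInstance, fun f _ => ?_⟩
  funext x
  simp [kop]

theorem congr {A B : Op d} (hA : IsKer A) (h : ∀ f, MemMb f → A f = B f) : IsKer B := by
  obtain ⟨κ, κ', h1, h2, h3⟩ := hA
  exact ⟨κ, κ', h1, h2, fun f hf => (h f hf).symm.trans (h3 f hf)⟩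

theorem zero : IsKer (0 : Op d) := by
  refine ⟨0, 0, inferInstance, inferInstance, fun f _ => ?_⟩
  simp

theorem add {A B : Op d} (hA : IsKer A) (hB : IsKer B) : IsKer (A + B) := by
  obtain ⟨κ, κ', _, _, h⟩ := hA
  obtain ⟨μ, μ', _, _, h'⟩ := hB
  refine ⟨κ + μ, κ' + μ', inferInstance, inferInstance, fun f hf => ?_⟩
  rw [Pi.add_apply, h f hf, h' f hf, kop_add_kernel hf, kop_add_kernel hf]
  abel

theorem neg {A : Op d} (hA : IsKer A) : IsKer (-A) := by
  obtain ⟨κ, κ', h1, h2, h⟩ := hA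
  refine ⟨κ', κ, h2, h1, fun f hf => ?_⟩
  rw [Pi.neg_apply, h f hf, neg_sub]

theorem comp {A B : Op d} (hA : IsKer A) (hB : IsKer B) : IsKer fun f => A (B f) := by
  obtain ⟨κ, κ', _, _, h⟩ := hA
  obtain ⟨μ, μ', _, _, h'⟩ := hB
  -- Expand `(κ - κ')(μ - μ')` and collect the terms of equal sign.
  refine ⟨μ ∘ₖ κ + μ' ∘ₖ κ', μ' ∘ₖ κ + μ ∘ₖ κ', inferInstance, inferInstance, fun f hf => ?_⟩
  have h1 : MemMb (kop μ f) := memMb_kop hf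
  have h2 : MemMb (kop μ' f) := memMb_kop hf
  beta_reduce
  rw [h' f hf, h _ (h1.sub h2), kop_sub h1 h2, kop_sub h1 h2, kop_add_kernel hf,
    kop_add_kernel hf, kop_comp hf, kop_comp hf, kop_comp hf, kop_comp hf]
  abel

end IsKer

namespace IsFunctionalOperator

theorem map_zero {A : Op d} (hA : IsFunctionalOperator A) : A 0 = 0 := by
  simpa using hA.smul 0 0 memMb_zero

theorem map_sub {A : Op d} (hA : IsFunctionalOperator A) {f g : St d → ℝ} (hf : MemMb f)
    (hg : MemMb g) : A (f - g) = A f - A g := by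
  have h : f - g = f + (-1 : ℝ) • g := by simp [sub_eq_add_neg]
  rw [h, hA.add f _ hf (hg.smul _), hA.smul _ g hg]
  simp [sub_eq_add_neg]

theorem map_sum {A : Op d} (hA : IsFunctionalOperator A) {ι : Type*} {s : Finset ι}
    {f : ι → St d → ℝ} (hf : ∀ i ∈ s, MemMb (f i)) : A (∑ i ∈ s, f i) = ∑ i ∈ s, A (f i) := by
  classical
  induction s using Finset.induction_on with
  | empty => simp [hA.map_zero]
  | insert a s ha ih =>
    rw [Finset.sum_insert ha, Finset.sum_insert ha,
      hA.add _ _ (hf a (by simp)) (MemMb.sum fun i hi => hf i (by simp [hi])),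
      ih fun i hi => hf i (by simp [hi])]

theorem add_op {A B : Op d} (hA : IsFunctionalOperator A) (hB : IsFunctionalOperator B) :
    IsFunctionalOperator (A + B) where
  maps f hf := (hA.maps f hf).add (hB.maps f hf)
  add f g hf hg := by
    simp only [Pi.add_apply, hA.add f g hf hg, hB.add f g hf hg]; abel
  smul c f hf := by simp only [Pi.add_apply, hA.smul c f hf, hB.smul c f hf, smul_add]

theorem neg_op {A : Op d} (hA : IsFunctionalOperator A) : IsFunctionalOperator (-A) where
  maps f hf := (hA.maps f hf).neg
  add f g hf hg := by simp only [Pi.neg_apply, hA.add f g hf hg]; abel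
  smul c f hf := by simp only [Pi.neg_apply, hA.smul c f hf, smul_neg]

theorem comp {A B : Op d} (hA : IsFunctionalOperator A) (hB : IsFunctionalOperator B) :
    IsFunctionalOperator fun f => A (B f) where
  maps f hf := hA.maps _ (hB.maps f hf)
  add f g hf hg := by
    simp only [hB.add f g hf hg, hA.add _ _ (hB.maps f hf) (hB.maps g hg)]
  smul c f hf := by simp only [hB.smul c f hf, hA.smul c _ (hB.maps f hf)]

end IsFunctionalOperator

/-! ### Operators that lose a given number of derivatives -/

/-- `A` is a difference of finite kernels, it is bounded by `s` for the supremum norm, and it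
loses `κ` derivatives with constant `G`, as does its dual; only derivatives of order at most `R`
are taken into account. -/
structure Est (R κ : ℕ) (G s : ℝ≥0) (A : Op d) : Prop where
  ker : IsKer A
  sup : ∀ f, MemMb f → supNorm (A f) ≤ s * supNorm f
  cb : ∀ (r : ℕ) (f : St d → ℝ), κ + r ≤ R → MemCb (κ + r) f →
    MemCb r (A f) ∧ cbNorm r (A f) ≤ G * cbNorm (κ + r) f
  dual : ∀ (r : ℕ) (f : St d → ℝ), κ + r ≤ R → MemC1 (κ + r) f →
    ∃ h, IsDual A f h ∧ MemC1 r h ∧ c1Norm r h ≤ G * c1Norm (κ + r) f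

namespace Est

variable {R κ κ₁ κ₂ : ℕ} {G G₁ G₂ s s₁ s₂ : ℝ≥0} {A B : Op d}

theorem mono (h : Est R κ₁ G₁ s₁ A) (hκ : κ₁ ≤ κ₂) (hG : G₁ ≤ G₂) (hs : s₁ ≤ s₂) :
    Est R κ₂ G₂ s₂ A where
  ker := h.ker
  sup f hf := (h.sup f hf).trans (by gcongr)
  cb r f hr hf := by
    obtain ⟨h1, h2⟩ := h.cb r f (by omega) (hf.of_le (by omega))
    refine ⟨h1, h2.trans ?_⟩
    have := cbNorm_mono (show κ₁ + r ≤ κ₂ + r by omega) f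
    gcongr
  dual r f hr hf := by
    obtain ⟨g, h1, h2, h3⟩ := h.dual r f (by omega) (hf.of_le (by omega))
    refine ⟨g, h1, h2, h3.trans ?_⟩
    have := c1Norm_mono (show κ₁ + r ≤ κ₂ + r by omega) f
    gcongr

theorem congr (h : Est R κ G s A) (hAB : ∀ f, MemMb f → A f = B f) : Est R κ G s B where
  ker := h.ker.congr hAB
  sup f hf := hAB f hf ▸ h.sup f hf
  cb r f hr hf := hAB f hf.memMb ▸ h.cb r f hr hf
  dual r f hr hf := by
    obtain ⟨g, h1, h2⟩ := h.dual r f hr hf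
    exact ⟨g, fun u hu => hAB u hu ▸ h1 u hu, h2⟩

theorem zero : Est R κ 0 0 (0 : Op d) where
  ker := IsKer.zero
  sup f _ := by simp [supNorm_zero]
  cb r f _ _ := by
    have h : (0 : St d → ℝ) = (0 : ℝ) • 0 := by simp
    have h0 : ContDiff ℝ r (0 : St d → ℝ) := contDiff_const
    have h1 : cbNorm r (0 : St d → ℝ) ≤ 0 := by
      rw [h]; exact (cbNorm_smul_le 0 h0).trans (by simp)
    exact ⟨⟨h0, h1.trans_lt (by simp)⟩, h1.trans zero_le⟩
  dual r f _ _ := by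
    have h : (0 : St d → ℝ) = (0 : ℝ) • 0 := by simp
    have h0 : ContDiff ℝ r (0 : St d → ℝ) := contDiff_const
    have h1 : c1Norm r (0 : St d → ℝ) ≤ 0 := by
      rw [h]; exact (c1Norm_smul_le 0 h0).trans (by simp)
    exact ⟨0, fun g _ => by simp, ⟨h0, h1.trans_lt (by simp)⟩, h1.trans zero_le⟩

theorem add (hA : Est R κ G₁ s₁ A) (hB : Est R κ G₂ s₂ B) :
    Est R κ (G₁ + G₂) (s₁ + s₂) (A + B) where
  ker := hA.ker.add hB.ker
  sup f hf := by
    push_cast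
    rw [add_mul]
    exact (supNorm_add_le _ _).trans (add_le_add (hA.sup f hf) (hB.sup f hf))
  cb r f hr hf := by
    obtain ⟨h1, h2⟩ := hA.cb r f hr hf
    obtain ⟨h3, h4⟩ := hB.cb r f hr hf
    refine ⟨h1.add h3, (cbNorm_add_le h1.1 h3.1).trans ?_⟩
    push_cast
    rw [add_mul]
    exact add_le_add h2 h4
  dual r f hr hf := by
    obtain ⟨u, h1, h2, h3⟩ := hA.dual r f hr hf
    obtain ⟨v, h4, h5, h6⟩ := hB.dual r f hr hf
    refine ⟨u + v, fun g hg => ?_, h2.add h5, (c1Norm_add_le h2.1 h5.1).trans ?_⟩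
    · simp only [Pi.add_apply, add_mul, mul_add]
      rw [integral_add ((hA.ker.maps hg).mul_integrable hf.integrable)
        ((hB.ker.maps hg).mul_integrable hf.integrable), integral_add
        (hg.mul_integrable h2.integrable) (hg.mul_integrable h5.integrable), h1 g hg, h4 g hg]
    · push_cast
      rw [add_mul]
      exact add_le_add h3 h6

theorem neg (hA : Est R κ G s A) : Est R κ G s (-A) where
  ker := hA.ker.neg
  sup f hf := by rw [Pi.neg_apply, supNorm_neg]; exact hA.sup f hf
  cb r f hr hf := by
    obtain ⟨h1, h2⟩ := hA.cb r f hr hf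
    have h : (-A) f = (-1 : ℝ) • A f := by simp
    rw [h]
    exact ⟨h1.smul _, (cbNorm_smul_le _ h1.1).trans (by simpa using h2)⟩
  dual r f hr hf := by
    obtain ⟨u, h1, h2, h3⟩ := hA.dual r f hr hf
    refine ⟨(-1 : ℝ) • u, fun g hg => ?_, h2.smul _,
      (c1Norm_smul_le _ h2.1).trans (by simpa using h3)⟩
    simp [integral_neg, h1 g hg]

theorem sub (hA : Est R κ G₁ s₁ A) (hB : Est R κ G₂ s₂ B) :
    Est R κ (G₁ + G₂) (s₁ + s₂) (A - B) := by
  rw [sub_eq_add_neg]; exact hA.add hB.neg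

theorem sum {ι : Type*} {t : Finset ι} {A : ι → Op d} {G s : ι → ℝ≥0}
    (h : ∀ i ∈ t, Est R κ (G i) (s i) (A i)) :
    Est R κ (∑ i ∈ t, G i) (∑ i ∈ t, s i) (∑ i ∈ t, A i) := by
  classical
  induction t using Finset.induction_on with
  | empty => simpa using Est.zero
  | insert a t ha ih =>
    rw [Finset.sum_insert ha, Finset.sum_insert ha, Finset.sum_insert ha]
    exact (h a (by simp)).add (ih fun i hi => h i (by simp [hi]))

theorem comp (hA : Est R κ₁ G₁ s₁ A) (hB : Est R κ₂ G₂ s₂ B) :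
    Est R (κ₁ + κ₂) (G₁ * G₂) (s₁ * s₂) (fun f => A (B f)) where
  ker := hA.ker.comp hB.ker
  sup f hf := by
    refine (hA.sup _ (hB.ker.maps hf)).trans ?_
    push_cast
    rw [mul_assoc]
    gcongr
    exact hB.sup f hf
  cb r f hr hf := by
    have e : κ₁ + κ₂ + r = κ₂ + (κ₁ + r) := by omega
    rw [e] at hf ⊢
    obtain ⟨h1, h2⟩ := hB.cb (κ₁ + r) f (by omega) hf
    obtain ⟨h3, h4⟩ := hA.cb r _ (by omega) h1
    refine ⟨h3, h4.trans ?_⟩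
    push_cast
    rw [mul_assoc]
    gcongr
  dual r f hr hf := by
    have e : κ₁ + κ₂ + r = κ₁ + (κ₂ + r) := by omega
    rw [e] at hf ⊢
    -- `(AB)^* = B^* A^*`: the dual of `A` acts first and must leave `κ₂ + r` derivatives for that
    -- of `B`.
    obtain ⟨u, h1, h2, h3⟩ := hA.dual (κ₂ + r) f (by omega) hf
    obtain ⟨v, h4, h5, h6⟩ := hB.dual r u (by omega) h2
    refine ⟨v, fun g hg => (h1 _ (hB.ker.maps hg)).trans (h4 g hg), h5, h6.trans ?_⟩
    push_cast
    rw [mul_comm (G₁ : ℝ≥0∞), mul_assoc]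
    gcongr

theorem id : Est R 0 1 1 (fun f : St d → ℝ => f) where
  ker := (IsKer.of_kop Kernel.id).congr fun f hf => kop_id f hf
  sup f _ := by simp
  cb r f _ hf := by
    rw [zero_add] at *
    exact ⟨hf, by simp⟩
  dual r f _ hf := by
    rw [zero_add] at *
    exact ⟨f, fun g _ => rfl, hf, by simp⟩

theorem of_transports {K : ℕ → ℝ≥0} {κ : Kernel (St d) (St d)} [IsMarkovKernel κ]
    (h : Transports K (kop κ)) (h' : TransportsDual K (kop κ)) {Kh : ℝ≥0}
    (hK : ∀ r ≤ R, K r ≤ Kh) : Est R 0 Kh 1 (kop κ) where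
  ker := IsKer.of_kop κ
  sup f _ := by simpa using supNorm_kop_le
  cb r f hr hf := by
    rw [zero_add] at *
    obtain ⟨h1, h2⟩ := h r f hf
    have := hK r hr
    exact ⟨h1, h2.trans (by gcongr)⟩
  dual r f hr hf := by
    rw [zero_add] at *
    obtain ⟨u, h0, h1, h2⟩ := h' r f hf
    have := hK r hr
    exact ⟨u, h0, h1, h2.trans (by gcongr)⟩

/-- The bound for the integral of `A f` against a test function. -/
theorem enorm_integral_le (hA : Est R κ G s A) (hκ : κ ≤ R) {f h : St d → ℝ} (hf : MemMb f)
    (hh : MemC1 κ h) : ‖∫ x, A f x * h x‖ₑ ≤ G * supNorm f * c1Norm κ h := by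
  obtain ⟨u, h1, h2, h3⟩ := hA.dual 0 h hκ hh
  rw [h1 f hf]
  calc ‖∫ x, f x * u x‖ₑ ≤ ∫⁻ x, ‖f x * u x‖ₑ := enorm_integral_le_lintegral_enorm _
    _ ≤ ∫⁻ x, supNorm f * ‖u x‖ₑ := lintegral_mono fun x => by
        rw [enorm_mul]; gcongr; exact enorm_le_supNorm f x
    _ = supNorm f * ∫⁻ x, ‖u x‖ₑ := lintegral_const_mul' _ _ (memMb_iff.1 hf).2.ne
    _ ≤ supNorm f * (G * c1Norm κ h) := by
        gcongr
        exact (lintegral_le_c1Norm 0 u).trans h3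
    _ = G * supNorm f * c1Norm κ h := by ring

theorem supNorm_le (hA : Est R κ G s A) (hκ : κ ≤ R) {f : St d → ℝ} (hf : MemCb κ f) :
    supNorm (A f) ≤ G * cbNorm κ f := by
  have := (hA.cb 0 f hκ hf).2
  rwa [cbNorm_zero_eq] at this

end Est

/-! ### Multi-indices of bounded order -/

/-- The multi-indices of order at most `r`. -/
def multiIndices (d r : ℕ) : Finset (Fin d → ℕ) :=
  (Finset.Icc 0 fun _ => r).filter fun γ => ∑ i, γ i ≤ r

theorem mem_multiIndices {r : ℕ} {γ : Fin d → ℕ} : γ ∈ multiIndices d r ↔ ∑ i, γ i ≤ r := by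
  simp only [multiIndices, Finset.mem_filter, Finset.mem_Icc, and_iff_right_iff_imp]
  exact fun h => ⟨fun i => Nat.zero_le _, fun i =>
    (Finset.single_le_sum (f := γ) (fun _ _ => Nat.zero_le _) (Finset.mem_univ i)).trans h⟩

/-- Only finitely many multi-indices have order at most `r`, so a finite sum dominates the supremum.
-/
theorem cbNorm_lt_top {r : ℕ} {f : St d → ℝ}
    (h : ∀ γ : Fin d → ℕ, supNorm (mderiv γ f) < ∞) : cbNorm r f < ∞ := by
  refine lt_of_le_of_lt (cbNorm_le (c := ∑ γ ∈ multiIndices d r, supNorm (mderiv γ f))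
    fun γ hγ => ?_) (ENNReal.sum_lt_top.2 fun γ _ => h γ)
  exact Finset.single_le_sum (f := fun γ => supNorm (mderiv γ f)) (fun _ _ => zero_le)
    (mem_multiIndices.2 hγ)

theorem c1Norm_lt_top {r : ℕ} {f : St d → ℝ}
    (h : ∀ γ : Fin d → ℕ, ∫⁻ x, ‖mderiv γ f x‖ₑ < ∞) : c1Norm r f < ∞ := by
  refine lt_of_le_of_lt (c1Norm_le (c := ∑ γ ∈ multiIndices d r, ∫⁻ x, ‖mderiv γ f x‖ₑ)
    fun γ hγ => ?_) (ENNReal.sum_lt_top.2 fun γ _ => h γ)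
  exact Finset.single_le_sum (f := fun γ => ∫⁻ x, ‖mderiv γ f x‖ₑ) (fun _ _ => zero_le)
    (mem_multiIndices.2 hγ)

/-! ### Test functions and regularization of functionals on `L¹` -/

/-- Smooth functions with compact support. -/
def IsTest (φ : St d → ℝ) : Prop := (∀ r : ℕ, ContDiff ℝ r φ) ∧ HasCompactSupport φ

namespace IsTest

variable {φ ψ : St d → ℝ}

theorem continuous (h : IsTest φ) : Continuous φ := (h.1 0).continuous

theorem differentiable (h : IsTest φ) : Differentiable ℝ φ := (h.1 1).differentiable (by simp)

theorem integrable (h : IsTest φ) : Integrable φ :=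
  h.continuous.integrable_of_hasCompactSupport h.2

theorem fderiv_apply (h : IsTest φ) (v : St d) : IsTest fun x => fderiv ℝ φ x v := by
  refine ⟨fun r => ?_, ?_⟩
  · have h' : ContDiff ℝ r (fderiv ℝ φ) := (h.1 (r + 1)).fderiv_right (by norm_cast)
    exact h'.clm_apply contDiff_const
  · exact (h.2.fderiv_apply ℝ v)

theorem pderiv (h : IsTest φ) (i : Fin d) : IsTest (pderiv i φ) := h.fderiv_apply _

theorem foldr_pderiv (h : IsTest φ) (w : List (Fin d)) : IsTest (w.foldr TVApprox.pderiv φ) := by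
  induction w with
  | nil => exact h
  | cons i w ih => exact ih.pderiv i

theorem mderiv (h : IsTest φ) (γ : Fin d → ℕ) : IsTest (mderiv γ φ) := h.foldr_pderiv _

theorem add (h : IsTest φ) (h' : IsTest ψ) : IsTest (φ + ψ) :=
  ⟨fun r => (h.1 r).add (h'.1 r), h.2.add h'.2⟩

theorem smul (c : ℝ) (h : IsTest φ) : IsTest (c • φ) :=
  ⟨fun r => contDiff_const.smul (h.1 r), h.2.smul_left (f := fun _ => c)⟩

theorem zero : IsTest (0 : St d → ℝ) := ⟨fun _ => contDiff_const, HasCompactSupport.zero⟩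

theorem comp_const_sub (h : IsTest φ) (x : St d) : IsTest fun y => φ (x - y) :=
  ⟨fun r => (h.1 r).comp (contDiff_const.sub contDiff_id),
    h.2.comp_homeomorph (Homeomorph.subLeft x)⟩

theorem memC1 (h : IsTest φ) (r : ℕ) : MemC1 r φ :=
  ⟨h.1 r, c1Norm_lt_top fun γ => (h.mderiv γ).integrable.2⟩

end IsTest

theorem pderiv_comp_const_sub {φ : St d → ℝ} (h : Differentiable ℝ φ) (x : St d) (i : Fin d) :
    pderiv i (fun y => φ (x - y)) = (-1 : ℝ) • fun y => pderiv i φ (x - y) := by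
  funext y
  have h1 : HasFDerivAt (fun y => x - y) (-(ContinuousLinearMap.id ℝ (St d))) y :=
    (hasFDerivAt_id y).const_sub x
  have h2 := (h (x - y)).hasFDerivAt.comp y h1
  have h3 : fderiv ℝ (fun y => φ (x - y)) y =
      (fderiv ℝ φ (x - y)).comp (-(ContinuousLinearMap.id ℝ (St d))) := h2.fderiv
  simp [pderiv, h3]

theorem foldr_pderiv_comp_const_sub {φ : St d → ℝ} (h : IsTest φ) (x : St d)
    (w : List (Fin d)) : w.foldr pderiv (fun y => φ (x - y)) =
      ((-1 : ℝ) ^ w.length) • fun y => w.foldr pderiv φ (x - y) := by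
  induction w with
  | nil => simp
  | cons i w ih =>
    have h1 := h.foldr_pderiv w
    rw [List.foldr_cons, ih, pderiv_smul (h1.comp_const_sub x).differentiable,
      pderiv_comp_const_sub h1.differentiable, smul_smul, List.length_cons, pow_succ]
    rfl

theorem mderiv_comp_const_sub {φ : St d → ℝ} (h : IsTest φ) (x : St d) (γ : Fin d → ℕ) :
    mderiv γ (fun y => φ (x - y)) = ((-1 : ℝ) ^ ∑ i, γ i) • fun y => mderiv γ φ (x - y) := by
  rw [← length_word]
  exact foldr_pderiv_comp_const_sub h x _

/-- A functional on `L¹` evaluated at a function. -/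
def pairing (Λ : Lp ℝ 1 (volume : Measure (St d)) →L[ℝ] ℝ) (u : St d → ℝ) : ℝ :=
  open Classical in if h : Integrable u then Λ (h.toL1 u) else 0

theorem pairing_eq (Λ : Lp ℝ 1 (volume : Measure (St d)) →L[ℝ] ℝ) {u : St d → ℝ}
    (h : Integrable u) : pairing Λ u = Λ (h.toL1 u) := by
  simp [pairing, h]

theorem pairing_add (Λ : Lp ℝ 1 (volume : Measure (St d)) →L[ℝ] ℝ) {u v : St d → ℝ}
    (hu : Integrable u) (hv : Integrable v) :
    pairing Λ (u + v) = pairing Λ u + pairing Λ v := by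
  rw [pairing_eq Λ hu, pairing_eq Λ hv, pairing_eq Λ (hu.add hv), ← map_add]
  rfl

theorem pairing_smul (Λ : Lp ℝ 1 (volume : Measure (St d)) →L[ℝ] ℝ) (c : ℝ) {u : St d → ℝ}
    (hu : Integrable u) : pairing Λ (c • u) = c * pairing Λ u := by
  rw [pairing_eq Λ hu, pairing_eq Λ (hu.smul c), ← smul_eq_mul, ← map_smul]
  rfl

theorem pairing_sub (Λ : Lp ℝ 1 (volume : Measure (St d)) →L[ℝ] ℝ) {u v : St d → ℝ}
    (hu : Integrable u) (hv : Integrable v) :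
    pairing Λ (u - v) = pairing Λ u - pairing Λ v := by
  rw [pairing_eq Λ hu, pairing_eq Λ hv, pairing_eq Λ (hu.sub hv), ← map_sub]
  rfl

theorem norm_pairing_le (Λ : Lp ℝ 1 (volume : Measure (St d)) →L[ℝ] ℝ) {u : St d → ℝ}
    (hu : Integrable u) : ‖pairing Λ u‖ ≤ ‖Λ‖ * ∫ x, ‖u x‖ := by
  rw [pairing_eq Λ hu, ← L1.norm_of_fun_eq_integral_norm]
  exact Λ.le_opNorm _

/-- The function `x ↦ Λ (φ (x - ·))`. -/
def smear (Λ : Lp ℝ 1 (volume : Measure (St d)) →L[ℝ] ℝ) (φ : St d → ℝ) : St d → ℝ :=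
  fun x => pairing Λ fun y => φ (x - y)

theorem norm_smear_le (Λ : Lp ℝ 1 (volume : Measure (St d)) →L[ℝ] ℝ) {φ : St d → ℝ}
    (h : IsTest φ) (x : St d) : ‖smear Λ φ x‖ ≤ ‖Λ‖ * ∫ y, ‖φ y‖ := by
  refine (norm_pairing_le Λ (h.comp_const_sub x).integrable).trans_eq ?_
  rw [integral_sub_left_eq_self (fun y => ‖φ y‖) volume x]

/-- The second order Taylor estimate in `L¹`. -/
theorem IsTest.exists_integral_taylor_le {φ : St d → ℝ} (h : IsTest φ) :
    ∃ C : ℝ, ∀ v : St d, ‖v‖ ≤ 1 →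
      ∫ z, ‖φ (z + v) - φ z - fderiv ℝ φ z v‖ ≤ C * ‖v‖ ^ 2 := by
  have h1 : ContDiff ℝ (1 : ℕ) (fderiv ℝ φ) := (h.1 2).fderiv_right (by norm_num)
  obtain ⟨M, hM⟩ := h1.lipschitzWith_of_hasCompactSupport (h.2.fderiv ℝ) (by simp)
  -- For `‖v‖ ≤ 1` and `z` outside `S`, neither `z` nor `z + v` meets the support of `φ`, so the
  -- integrand vanishes. On the compact set `S` it is at most `M ‖v‖²`, because `fderiv ℝ φ` is
  -- `M`-Lipschitz.
  set S := Metric.cthickening 1 (tsupport φ)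
  have hS : IsCompact S := h.2.isCompact.cthickening
  have key : ∀ v : St d, ‖v‖ ≤ 1 → ∀ z, ‖φ (z + v) - φ z - fderiv ℝ φ z v‖ ≤
      S.indicator (fun _ => (M : ℝ) * ‖v‖ ^ 2) z := by
    intro v hv z
    by_cases hz : z ∈ S
    · rw [Set.indicator_of_mem hz]
      have := (convex_closedBall z ‖v‖).norm_image_sub_le_of_norm_fderiv_le' (𝕜 := ℝ) (f := φ)
        (φ := fderiv ℝ φ z) (C := M * ‖v‖) (x := z) (y := z + v)
        (fun x _ => h.differentiable x) (fun x hx => ?_) (by simp) (by simp)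
      · simpa [pow_two, mul_assoc] using this
      · have h3 := hM.dist_le_mul x z
        rw [dist_eq_norm] at h3
        exact h3.trans (by gcongr; exact hx)
    · rw [Set.indicator_of_notMem hz]
      have h3 : z ∉ tsupport φ := fun h' => hz (Metric.self_subset_cthickening _ h')
      have h4 : z + v ∉ tsupport φ := fun h' => hz (by
        refine Metric.mem_cthickening_of_dist_le z (z + v) 1 _ h' ?_
        simpa [dist_eq_norm] using hv)
      have h5 : fderiv ℝ φ z = 0 := fderiv_of_notMem_tsupport ℝ h3
      simp [image_eq_zero_of_notMem_tsupport h3, image_eq_zero_of_notMem_tsupport h4, h5]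
  refine ⟨volume.real S * M, fun v hv => ?_⟩
  calc ∫ z, ‖φ (z + v) - φ z - fderiv ℝ φ z v‖
      ≤ ∫ z, S.indicator (fun _ => (M : ℝ) * ‖v‖ ^ 2) z := by
        refine integral_mono_of_nonneg (Filter.Eventually.of_forall fun _ => norm_nonneg _) ?_
          (Filter.Eventually.of_forall (key v hv))
        exact (integrable_indicator_iff hS.measurableSet).2
          (integrableOn_const hS.measure_lt_top.ne)
    _ = _ := by
        rw [integral_indicator_const _ hS.measurableSet, smul_eq_mul, mul_assoc]

/-- Differentiation passes through `Λ` because the Taylor remainder of the translates of `φ` is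
`O(‖v‖²)` in `L¹`. Continuity of `Λ` on `L¹` is all that is used; no representing function of `Λ`
enters. -/
theorem exists_hasFDerivAt_smear (Λ : Lp ℝ 1 (volume : Measure (St d)) →L[ℝ] ℝ) {φ : St d → ℝ}
    (h : IsTest φ) (x : St d) : ∃ D : St d →L[ℝ] ℝ, HasFDerivAt (smear Λ φ) D x ∧
      ∀ v, D v = smear Λ (fun z => fderiv ℝ φ z v) x := by
  have hi : ∀ v, Integrable fun y => fderiv ℝ φ (x - y) v := fun v =>
    ((h.fderiv_apply v).comp_const_sub x).integrable
  let D₀ : St d →ₗ[ℝ] ℝ :=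
    { toFun := fun v => smear Λ (fun z => fderiv ℝ φ z v) x
      map_add' := fun v w => by
        simp only [smear, map_add]
        exact pairing_add Λ (hi v) (hi w)
      map_smul' := fun c v => by
        simp only [smear, map_smul]
        exact pairing_smul Λ c (hi v) }
  refine ⟨LinearMap.toContinuousLinearMap D₀, ?_, fun v => rfl⟩
  rw [hasFDerivAt_iff_isLittleO_nhds_zero]
  obtain ⟨C, hC⟩ := h.exists_integral_taylor_le
  refine Asymptotics.IsBigO.trans_isLittleO (g := fun v : St d => ‖v‖ ^ 2) ?_
    (Asymptotics.isLittleO_norm_pow_id one_lt_two)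
  refine Asymptotics.IsBigO.of_bound (‖Λ‖ * C) ?_
  filter_upwards [Metric.closedBall_mem_nhds (0 : St d) one_pos] with v hv
  have hv' : ‖v‖ ≤ 1 := by simpa using hv
  have h1 := (h.comp_const_sub (x + v)).integrable
  have h2 := (h.comp_const_sub x).integrable
  have e : smear Λ φ (x + v) - smear Λ φ x - D₀ v =
      pairing Λ (((fun y => φ (x + v - y)) - fun y => φ (x - y)) -
        fun y => fderiv ℝ φ (x - y) v) := by
    rw [pairing_sub Λ (h1.sub h2) (hi v), pairing_sub Λ h1 h2]
    rfl
  have e' : (fun y => ‖(((fun y => φ (x + v - y)) - fun y => φ (x - y)) -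
        fun y => fderiv ℝ φ (x - y) v) y‖) =
      fun y => (fun z => ‖φ (z + v) - φ z - fderiv ℝ φ z v‖) (x - y) := by
    funext y
    simp only [Pi.sub_apply]
    congr 4
    abel
  rw [LinearMap.coe_toContinuousLinearMap', e]
  refine (norm_pairing_le Λ ((h1.sub h2).sub (hi v))).trans ?_
  rw [e', integral_sub_left_eq_self (fun z => ‖φ (z + v) - φ z - fderiv ℝ φ z v‖) volume x,
    Real.norm_of_nonneg (by positivity : (0 : ℝ) ≤ ‖v‖ ^ 2), mul_assoc]
  gcongr
  exact hC v hv'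

theorem differentiable_smear (Λ : Lp ℝ 1 (volume : Measure (St d)) →L[ℝ] ℝ) {φ : St d → ℝ}
    (h : IsTest φ) : Differentiable ℝ (smear Λ φ) := fun x => by
  obtain ⟨D, hD, -⟩ := exists_hasFDerivAt_smear Λ h x
  exact hD.differentiableAt

theorem fderiv_smear (Λ : Lp ℝ 1 (volume : Measure (St d)) →L[ℝ] ℝ) {φ : St d → ℝ}
    (h : IsTest φ) (x v : St d) :
    fderiv ℝ (smear Λ φ) x v = smear Λ (fun z => fderiv ℝ φ z v) x := by
  obtain ⟨D, hD, hD'⟩ := exists_hasFDerivAt_smear Λ h x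
  rw [hD.fderiv, hD']

theorem contDiff_smear (Λ : Lp ℝ 1 (volume : Measure (St d)) →L[ℝ] ℝ) {φ : St d → ℝ}
    (h : IsTest φ) (r : ℕ) : ContDiff ℝ r (smear Λ φ) := by
  induction r generalizing φ with
  | zero => exact contDiff_zero.2 (differentiable_smear Λ h).continuous
  | succ r ih =>
    push_cast
    refine contDiff_succ_iff_fderiv_apply.2 ⟨differentiable_smear Λ h, by simp, fun v => ?_⟩
    simp only [fderiv_smear Λ h]
    exact ih (h.fderiv_apply v)

theorem mderiv_smear (Λ : Lp ℝ 1 (volume : Measure (St d)) →L[ℝ] ℝ) {φ : St d → ℝ}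
    (h : IsTest φ) (γ : Fin d → ℕ) : mderiv γ (smear Λ φ) = smear Λ (mderiv γ φ) := by
  have key : ∀ w : List (Fin d), w.foldr pderiv (smear Λ φ) = smear Λ (w.foldr pderiv φ) := by
    intro w
    induction w with
    | nil => rfl
    | cons i w ih =>
      rw [List.foldr_cons, ih]
      funext x
      exact fderiv_smear Λ (h.foldr_pderiv w) x _
  exact key _

theorem supNorm_smear_le (Λ : Lp ℝ 1 (volume : Measure (St d)) →L[ℝ] ℝ) {φ : St d → ℝ}
    (h : IsTest φ) : supNorm (smear Λ φ) ≤ ENNReal.ofReal (‖Λ‖ * ∫ y, ‖φ y‖) :=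
  supNorm_le fun x => by
    rw [← ofReal_norm]
    exact ENNReal.ofReal_le_ofReal (norm_smear_le Λ h x)

theorem memCbInf_smear (Λ : Lp ℝ 1 (volume : Measure (St d)) →L[ℝ] ℝ) {φ : St d → ℝ}
    (h : IsTest φ) : MemCbInf (smear Λ φ) := fun r =>
  ⟨contDiff_smear Λ h r, cbNorm_lt_top fun γ => by
    rw [mderiv_smear Λ h]
    exact (supNorm_smear_le Λ (h.mderiv γ)).trans_lt ENNReal.ofReal_lt_top⟩

/-- Integration against a bounded measurable function, as a functional on `L¹`. -/
theorem MemMb.exists_functional {F : St d → ℝ} (hF : MemMb F) :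
    ∃ Λ : Lp ℝ 1 (volume : Measure (St d)) →L[ℝ] ℝ,
      ∀ u : Lp ℝ 1 (volume : Measure (St d)), Λ u = ∫ x, F x * u x := by
  obtain ⟨M, hM⟩ := hF.2
  have hi : ∀ u : Lp ℝ 1 (volume : Measure (St d)), Integrable fun x => F x * u x := fun u =>
    hF.mul_integrable (L1.integrable_coeFn u)
  let Λ₀ : Lp ℝ 1 (volume : Measure (St d)) →ₗ[ℝ] ℝ :=
    { toFun := fun u => ∫ x, F x * u x
      map_add' := fun u v => by
        rw [← integral_add (hi u) (hi v)]
        refine integral_congr_ae ?_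
        filter_upwards [Lp.coeFn_add u v] with x hx
        rw [hx, Pi.add_apply, mul_add]
      map_smul' := fun c u => by
        rw [RingHom.id_apply, smul_eq_mul, ← integral_const_mul]
        refine integral_congr_ae ?_
        filter_upwards [Lp.coeFn_smul c u] with x hx
        rw [hx, Pi.smul_apply, smul_eq_mul]
        ring }
  refine ⟨Λ₀.mkContinuous M fun u => ?_, fun u => rfl⟩
  rw [L1.norm_eq_integral_norm, ← integral_const_mul]
  refine norm_integral_le_of_norm_le ((L1.integrable_coeFn u).norm.const_mul M)
    (Filter.Eventually.of_forall fun x => ?_)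
  rw [norm_mul]
  gcongr
  exact hM x

theorem smear_eq_integral {F : St d → ℝ} {Λ : Lp ℝ 1 (volume : Measure (St d)) →L[ℝ] ℝ}
    (hΛ : ∀ u : Lp ℝ 1 (volume : Measure (St d)), Λ u = ∫ x, F x * u x) {φ : St d → ℝ}
    (h : IsTest φ) (x : St d) : smear Λ φ x = ∫ y, F y * φ (x - y) := by
  have hi := (h.comp_const_sub x).integrable
  rw [smear, pairing_eq Λ hi, hΛ]
  refine integral_congr_ae ?_
  filter_upwards [hi.coeFn_toL1] with y hy
  rw [hy]

/-! ### Mollification -/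

theorem exists_mollifier {ε : ℝ} (hε : 0 < ε) :
    ∃ φ : St d → ℝ, IsTest φ ∧ ∫ x, ‖φ x‖ = 1 ∧ ∀ F : St d → ℝ, Measurable F → ∀ x δ,
      (∀ y ∈ Metric.ball x ε, dist (F y) (F x) ≤ δ) →
        dist (∫ y, F y * φ (x - y)) (F x) ≤ δ := by
  let φ : ContDiffBump (0 : St d) := ⟨ε / 2, ε, half_pos hε, half_lt_self hε⟩
  refine ⟨φ.normed volume, ⟨fun r => φ.contDiff_normed, φ.hasCompactSupport_normed⟩, ?_, ?_⟩
  · rw [← φ.integral_normed (μ := (volume : Measure (St d)))]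
    congr 1
    funext x
    exact Real.norm_of_nonneg (φ.nonneg_normed x)
  · intro F hF x δ hx
    have h1 := φ.dist_normed_convolution_le (μ := volume) hF.aestronglyMeasurable hx
    rw [convolution_def] at h1
    have e : ∫ y, F y * φ.normed volume (x - y) =
        ∫ t, (ContinuousLinearMap.lsmul ℝ ℝ) (φ.normed volume t) (F (x - t)) := by
      rw [← integral_sub_left_eq_self _ volume x]
      refine integral_congr_ae (Filter.Eventually.of_forall fun t => ?_)
      simp [mul_comm]
    rw [e]
    exact h1

/-- Uniform limits of functions of class `C_b^∞`. -/
def SmoothLim (F : St d → ℝ) : Prop :=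
  ∀ ε : ℝ≥0, 0 < ε → ∃ g, MemCbInf g ∧ supNorm (F - g) ≤ ε

theorem supNorm_le_of_forall_dist_le {F g : St d → ℝ} {ε : ℝ≥0}
    (h : ∀ x, dist (g x) (F x) ≤ ε) : supNorm (F - g) ≤ ε :=
  supNorm_le fun x => by
    rw [← ofReal_norm, Pi.sub_apply, ← dist_eq_norm, dist_comm, ← ENNReal.ofReal_coe_nnreal]
    exact ENNReal.ofReal_le_ofReal (h x)

theorem MemCb.lipschitz {F : St d → ℝ} (hF : MemCb 1 F) : ∃ M : ℝ≥0, LipschitzWith M F := by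
  refine ⟨d * (cbNorm 1 F).toNNReal, lipschitzWith_of_nnnorm_fderiv_le
    (hF.1.differentiable (by simp)) fun x => ?_⟩
  rw [← NNReal.coe_le_coe]
  push_cast
  refine ContinuousLinearMap.opNorm_le_bound _ (by positivity) fun v => ?_
  have hv : v = ∑ i, v i • EuclideanSpace.single i (1 : ℝ) := by
    ext j
    simp [Finset.sum_apply, Pi.single_apply]
  have hb : ∀ i, ‖fderiv ℝ F x (EuclideanSpace.single i 1)‖ ≤ (cbNorm 1 F).toNNReal := by
    intro i
    have h1 := (enorm_le_supNorm (pderiv i F) x).trans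
      (mderiv_single i F ▸ supNorm_mderiv_le_cbNorm (γ := Pi.single i 1) (r := 1) (by simp) F)
    have := ENNReal.toNNReal_mono hF.2.ne h1
    exact_mod_cast this
  calc ‖fderiv ℝ F x v‖ = ‖∑ i, v i • fderiv ℝ F x (EuclideanSpace.single i 1)‖ := by
        conv_lhs => rw [hv]
        rw [map_sum]
        simp only [map_smul]
    _ ≤ ∑ i, ‖v i • fderiv ℝ F x (EuclideanSpace.single i 1)‖ := norm_sum_le _ _
    _ ≤ ∑ _i : Fin d, ‖v‖ * (cbNorm 1 F).toNNReal := by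
        refine Finset.sum_le_sum fun i _ => ?_
        rw [norm_smul]
        exact mul_le_mul (PiLp.norm_apply_le v i) (hb i) (norm_nonneg _) (norm_nonneg _)
    _ = d * (cbNorm 1 F).toNNReal * ‖v‖ := by
        simp; ring

theorem UniformContinuous.exists_mollifier {F : St d → ℝ} (hF : UniformContinuous F) {ε : ℝ≥0}
    (hε : 0 < ε) : ∃ φ : St d → ℝ, IsTest φ ∧ ∫ x, ‖φ x‖ = 1 ∧
      supNorm (F - fun x => ∫ y, F y * φ (x - y)) ≤ ε := by
  obtain ⟨δ, hδ, h⟩ := Metric.uniformContinuous_iff.1 hF ε (by exact_mod_cast hε)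
  obtain ⟨φ, h1, h2, h3⟩ := TVApprox.exists_mollifier (d := d) hδ
  exact ⟨φ, h1, h2, supNorm_le_of_forall_dist_le fun x =>
    h3 F hF.continuous.measurable x ε fun y hy => (h hy).le⟩

theorem exists_memCbInf_of_uniformContinuous {F : St d → ℝ} (hF : MemMb F)
    (hu : UniformContinuous F) {ε : ℝ≥0} (hε : 0 < ε) :
    ∃ g, MemCbInf g ∧ supNorm (F - g) ≤ ε ∧ supNorm g ≤ supNorm F := by
  obtain ⟨φ, h1, h2, h3⟩ := UniformContinuous.exists_mollifier hu hε
  obtain ⟨Λ, hΛ⟩ := hF.exists_functional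
  have e : smear Λ φ = fun x => ∫ y, F y * φ (x - y) := funext (smear_eq_integral hΛ h1)
  refine ⟨smear Λ φ, memCbInf_smear Λ h1, e ▸ h3, supNorm_le fun x => ?_⟩
  rw [smear_eq_integral hΛ h1 x]
  have h4 : ∫⁻ y, ‖φ (x - y)‖ₑ = 1 := by
    have := (h1.comp_const_sub x).integrable
    rw [← ofReal_integral_norm_eq_lintegral_enorm this,
      integral_sub_left_eq_self (fun y => ‖φ y‖) volume x, h2, ENNReal.ofReal_one]
  calc ‖∫ y, F y * φ (x - y)‖ₑ ≤ ∫⁻ y, ‖F y * φ (x - y)‖ₑ := enorm_integral_le_lintegral_enorm _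
    _ ≤ ∫⁻ y, supNorm F * ‖φ (x - y)‖ₑ := lintegral_mono fun y => by
        rw [enorm_mul]; gcongr; exact enorm_le_supNorm F y
    _ = supNorm F := by rw [lintegral_const_mul' _ _ (memMb_iff.1 hF).2.ne, h4, mul_one]

theorem MemCb.smoothLim {F : St d → ℝ} (hF : MemCb 1 F) : SmoothLim F := fun ε hε => by
  obtain ⟨M, hM⟩ := hF.lipschitz
  obtain ⟨g, h1, h2, -⟩ := exists_memCbInf_of_uniformContinuous hF.memMb hM.uniformContinuous hε
  exact ⟨g, h1, h2⟩

theorem SmoothLim.add {F H : St d → ℝ} (hF : SmoothLim F) (hH : SmoothLim H) :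
    SmoothLim (F + H) := fun ε hε => by
  obtain ⟨f, h1, h2⟩ := hF (ε / 2) (half_pos hε)
  obtain ⟨h, h3, h4⟩ := hH (ε / 2) (half_pos hε)
  refine ⟨f + h, fun r => (h1 r).add (h3 r), ?_⟩
  have e : F + H - (f + h) = (F - f) + (H - h) := by abel
  rw [e]
  refine (supNorm_add_le _ _).trans ((add_le_add h2 h4).trans_eq ?_)
  rw [← ENNReal.coe_add, add_halves]

theorem SmoothLim.neg {F : St d → ℝ} (hF : SmoothLim F) : SmoothLim (-F) := fun ε hε => by
  obtain ⟨f, h1, h2⟩ := hF ε hε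
  refine ⟨(-1 : ℝ) • f, h1.smul _, ?_⟩
  have e : -F - (-1 : ℝ) • f = -(F - f) := by simp; abel
  rw [e, supNorm_neg]
  exact h2

/-! ### Decomposition of a function that is small in a negative Sobolev norm -/

/-- A function `F` with `|∫ F h| ≤ G ‖h‖_{κ,1}` is, after mollification, a sum of derivatives
`∂^γ g_γ` with `|γ| ≤ κ` and `‖g_γ‖_∞ ≤ G`. -/
theorem exists_decomposition {F : St d → ℝ} (hF : MemMb F) {κ : ℕ} {G : ℝ≥0}
    (hG : ∀ h, MemC1 κ h → ‖∫ x, F x * h x‖ₑ ≤ G * c1Norm κ h) {φ : St d → ℝ} (hφ : IsTest φ)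
    (hφ1 : ∫ x, ‖φ x‖ = 1) :
    ∃ g : (Fin d → ℕ) → St d → ℝ, (∀ γ, MemCbInf (g γ) ∧ supNorm (g γ) ≤ G) ∧
      (fun x => ∫ y, F y * φ (x - y)) = ∑ γ ∈ multiIndices d κ, mderiv γ (g γ) := by
  classical
  let I := {γ : Fin d → ℕ // γ ∈ multiIndices d κ}
  -- The product carries the maximum norm, so the jet `(∂^γ h)_γ` of a test function has a norm that
  -- dominates `c1Norm κ h`. On the subspace `p` of jets, `h ↦ ∫ F h` is then bounded by `G`.
  let E := I → Lp ℝ 1 (volume : Measure (St d))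
  let o : I := ⟨0, mem_multiIndices.2 (by simp)⟩
  obtain ⟨Λ, hΛ⟩ := hF.exists_functional
  let ℓ : E →L[ℝ] ℝ := Λ.comp (ContinuousLinearMap.proj o)
  let jet (h : St d → ℝ) (hh : IsTest h) : E := fun γ => (hh.mderiv γ.1).integrable.toL1 _
  let p : Submodule ℝ E :=
    { carrier := {u | ∃ (h : St d → ℝ) (hh : IsTest h), u = jet h hh}
      zero_mem' := by
        refine ⟨0, IsTest.zero, ?_⟩
        funext γ
        refine (Integrable.toL1_zero ?_).symm.trans ((Integrable.toL1_eq_toL1_iff _ _ _ _).2 ?_)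
        · exact integrable_zero _ _ _
        · have h0 : mderiv γ.1 (0 : St d → ℝ) = 0 := by
            have := mderiv_smul (γ := γ.1) (f := (0 : St d → ℝ)) le_rfl 0 contDiff_const
            simpa using this
          rw [h0]
      add_mem' := by
        rintro _ _ ⟨h, hh, rfl⟩ ⟨k, hk, rfl⟩
        refine ⟨h + k, hh.add hk, ?_⟩
        funext γ
        refine (Integrable.toL1_add _ _ _ _).symm.trans ((Integrable.toL1_eq_toL1_iff _ _ _ _).2 ?_)
        rw [mderiv_add le_rfl (hh.1 _) (hk.1 _)]
      smul_mem' := by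
        rintro c _ ⟨h, hh, rfl⟩
        refine ⟨c • h, hh.smul c, ?_⟩
        funext γ
        refine (Integrable.toL1_smul' _ _ _).symm.trans ((Integrable.toL1_eq_toL1_iff _ _ _ _).2 ?_)
        rw [mderiv_smul le_rfl c (hh.1 _)] }
  have hjet : ∀ (h : St d → ℝ) (hh : IsTest h), ℓ (jet h hh) = ∫ x, F x * h x := by
    intro h hh
    change Λ ((hh.mderiv 0).integrable.toL1 _) = _
    rw [hΛ]
    refine integral_congr_ae ?_
    filter_upwards [(hh.mderiv 0).integrable.coeFn_toL1] with x hx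
    rw [hx, mderiv_zero]
  have hbound : ∀ u : p, ‖(ℓ.comp p.subtypeL) u‖ ≤ G * ‖u‖ := by
    rintro ⟨_, h, hh, rfl⟩
    change ‖ℓ (jet h hh)‖ ≤ G * ‖jet h hh‖
    rw [hjet h hh]
    have h1 : c1Norm κ h ≤ ‖jet h hh‖ₑ := c1Norm_le fun γ hγ => by
      have h2 := norm_le_pi_norm (jet h hh) ⟨γ, mem_multiIndices.2 hγ⟩
      rw [← Integrable.enorm_toL1 (hh.mderiv γ).integrable, ← ofReal_norm, ← ofReal_norm]
      exact ENNReal.ofReal_le_ofReal h2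
    have h2 := (hG h (hh.memC1 κ)).trans (mul_le_mul_right h1 _)
    have h3 := ENNReal.toReal_mono (ENNReal.mul_ne_top (by simp) (by simp)) h2
    simpa using h3
  -- Hahn–Banach: the functional extends from jets to all of `E` with the same norm, hence splits
  -- into one functional on `L¹` per multi-index, each of norm at most `G`.
  obtain ⟨Ψ, hΨ, hΨn⟩ := exists_extension_norm_eq p (ℓ.comp p.subtypeL)
  have hΨG : ‖Ψ‖ ≤ G := hΨn ▸ ContinuousLinearMap.opNorm_le_bound _ G.2 hbound
  let Ψc (γ : I) : Lp ℝ 1 (volume : Measure (St d)) →L[ℝ] ℝ :=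
    Ψ.comp (ContinuousLinearMap.single ℝ (fun _ : I => Lp ℝ 1 (volume : Measure (St d))) γ)
  have hΨc : ∀ γ, ‖Ψc γ‖ ≤ G := fun γ =>
    ContinuousLinearMap.opNorm_le_bound _ G.2 fun u => by
      refine (Ψ.le_opNorm _).trans ?_
      have : ‖(Pi.single γ u : E)‖ ≤ ‖u‖ := by
        refine (pi_norm_le_iff_of_nonneg (norm_nonneg _)).2 fun j => ?_
        by_cases hj : j = γ
        · subst hj; simp
        · simp [hj]
      exact mul_le_mul hΨG this (norm_nonneg _) G.2
  have hΨsum : ∀ u : E, Ψ u = ∑ γ, Ψc γ (u γ) := fun u => by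
    conv_lhs => rw [← Finset.univ_sum_single u, map_sum]
    rfl
  -- The sign compensates for differentiating `φ (x - ·)` in `y` instead of `x`. Smearing with `φ`
  -- turns the component functionals into smooth functions with `‖g_γ‖_∞ ≤ G`, since `‖φ‖_1 = 1`.
  let g (γ : Fin d → ℕ) : St d → ℝ :=
    if h : γ ∈ multiIndices d κ then ((-1 : ℝ) ^ ∑ i, γ i) • smear (Ψc ⟨γ, h⟩) φ else 0
  have hg : ∀ γ : I, g γ.1 = ((-1 : ℝ) ^ ∑ i, γ.1 i) • smear (Ψc γ) φ := fun γ => by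
    simp [g, γ.2]
  have hzero : MemCbInf (0 : St d → ℝ) := by
    simpa using (memCbInf_smear Λ hφ).smul 0
  refine ⟨g, fun γ => ?_, ?_⟩
  · by_cases h : γ ∈ multiIndices d κ
    · rw [hg ⟨γ, h⟩]
      refine ⟨(memCbInf_smear _ hφ).smul _, (supNorm_smul_le _ _).trans ?_⟩
      have h1 : ‖(-1 : ℝ) ^ ∑ i, γ i‖ₑ = 1 := by simp [enorm_pow]
      rw [h1, one_mul]
      refine (supNorm_smear_le _ hφ).trans ?_
      rw [hφ1, mul_one, ← ENNReal.ofReal_coe_nnreal]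
      exact ENNReal.ofReal_le_ofReal (hΨc _)
    · have : g γ = 0 := by simp [g, h]
      rw [this, supNorm_zero]
      exact ⟨hzero, zero_le⟩
  · funext x
    have hx := hφ.comp_const_sub x
    have h1 : Ψ (jet _ hx) = ∫ y, F y * φ (x - y) := by
      rw [← hjet _ hx]
      exact hΨ ⟨jet _ hx, _, hx, rfl⟩
    rw [← h1, hΨsum, Finset.sum_apply,
      ← Finset.sum_coe_sort (multiIndices d κ) fun γ => mderiv γ (g γ) x]
    refine Finset.sum_congr rfl fun γ _ => ?_
    rw [hg γ, mderiv_smul le_rfl _ (contDiff_smear _ hφ _), mderiv_smear _ hφ, Pi.smul_apply,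
      smul_eq_mul, smear, ← pairing_smul _ _ ((hφ.mderiv γ.1).comp_const_sub x).integrable,
      ← mderiv_comp_const_sub hφ x, pairing_eq _ (hx.mderiv γ.1).integrable]

/-! ### Extension of estimates from smooth functions to bounded measurable functions -/

/-- A compactly supported continuous function approximates `f` in `L¹(μ)`. Truncating it at level
`‖f‖_∞` does not increase the error, because truncation is 1-Lipschitz and fixes `f`. The result is
uniformly continuous, and mollification approximates it uniformly without raising the supremum. -/
theorem exists_memCbInf_integral_le {f : St d → ℝ} (hf : MemMb f) (μ : Measure (St d))
    [IsFiniteMeasure μ] {ε : ℝ} (hε : 0 < ε) :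
    ∃ g, MemCbInf g ∧ supNorm g ≤ supNorm f ∧ ∫ x, ‖f x - g x‖ ∂μ ≤ ε := by
  obtain ⟨g₀, hc₀, hg₀, hcont, hi₀⟩ :=
    (hf.integrable μ).exists_hasCompactSupport_integral_sub_le (half_pos hε)
  set c : ℝ := (supNorm f).toReal
  have hc : 0 ≤ c := ENNReal.toReal_nonneg
  have hfc : ∀ x, |f x| ≤ c := fun x => by
    have := ENNReal.toReal_mono (memMb_iff.1 hf).2.ne (enorm_le_supNorm f x)
    simpa using this
  let g₁ : St d → ℝ := fun x => max (-c) (min c (g₀ x))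
  have hg₁c : Continuous g₁ := continuous_const.max (continuous_const.min hcont)
  have hg₁s : HasCompactSupport g₁ :=
    hc₀.comp_left (g := fun t => max (-c) (min c t)) (by simp [hc])
  have hg₁b : ∀ x, |g₁ x| ≤ c := fun x => abs_le.2
    ⟨le_max_left _ _, max_le (by linarith) (min_le_left _ _)⟩
  have hg₁m : MemMb g₁ := ⟨hg₁c.measurable, c, hg₁b⟩
  have hg₁f : ∀ x, ‖f x - g₁ x‖ ≤ ‖f x - g₀ x‖ := fun x => by
    have h1 := abs_le.1 (hfc x)
    have h2 : max (-c) (min c (f x)) = f x := by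
      rw [min_eq_right h1.2, max_eq_right h1.1]
    have h3 : f x - g₁ x = max (-c) (min c (f x)) - max (-c) (min c (g₀ x)) := by rw [h2]
    rw [h3, Real.norm_eq_abs, Real.norm_eq_abs]
    refine (abs_max_sub_max_le_max _ _ _ _).trans ?_
    rw [sub_self, abs_zero, max_eq_right (abs_nonneg _)]
    refine (abs_min_sub_min_le_max _ _ _ _).trans ?_
    rw [sub_self, abs_zero, max_eq_right (abs_nonneg _)]
  have hpos : 0 < ε / (2 * (μ.real Set.univ + 1)) := by positivity
  obtain ⟨g, h1, h2, h3⟩ := exists_memCbInf_of_uniformContinuous hg₁m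
    (hg₁s.uniformContinuous_of_continuous hg₁c)
    (ε := (ε / (2 * (μ.real Set.univ + 1))).toNNReal) (Real.toNNReal_pos.2 hpos)
  refine ⟨g, h1, h3.trans (supNorm_le fun x => ?_), ?_⟩
  · have : ENNReal.ofReal c = supNorm f := ENNReal.ofReal_toReal (memMb_iff.1 hf).2.ne
    rw [← this, ← ofReal_norm]
    exact ENNReal.ofReal_le_ofReal (hg₁b x)
  · have h4 : ∀ x, ‖g₁ x - g x‖ ≤ ε / (2 * (μ.real Set.univ + 1)) := fun x => by
      have := ENNReal.toReal_mono ENNReal.coe_ne_top ((enorm_le_supNorm _ x).trans h2)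
      rw [ENNReal.coe_toReal, Real.coe_toNNReal _ hpos.le] at this
      simpa using this
    have hi₁ : Integrable (fun x => ‖f x - g₀ x‖) μ := ((hf.integrable μ).sub hi₀).norm
    calc ∫ x, ‖f x - g x‖ ∂μ
        ≤ ∫ x, (‖f x - g₀ x‖ + ε / (2 * (μ.real Set.univ + 1))) ∂μ := by
          refine integral_mono_of_nonneg (Filter.Eventually.of_forall fun _ => norm_nonneg _)
            (hi₁.add (integrable_const _)) (Filter.Eventually.of_forall fun x => ?_)
          calc ‖f x - g x‖ = ‖(f x - g₁ x) + (g₁ x - g x)‖ := by congr 1; ring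
            _ ≤ ‖f x - g₁ x‖ + ‖g₁ x - g x‖ := norm_add_le _ _
            _ ≤ _ := add_le_add (hg₁f x) (h4 x)
      _ = ∫ x, ‖f x - g₀ x‖ ∂μ + μ.real Set.univ * (ε / (2 * (μ.real Set.univ + 1))) := by
          rw [integral_add hi₁ (integrable_const _), integral_const, smul_eq_mul]
      _ ≤ ε / 2 + ε / 2 := by
          refine add_le_add hg₀ ?_
          rw [mul_div_assoc', div_le_div_iff₀ (by positivity) two_pos]
          have : 0 ≤ μ.real Set.univ := measureReal_nonneg
          nlinarith
      _ = ε := add_halves ε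

/-- Smooth functions are not dense in the supremum norm, but for fixed `x` the value `A f x` depends
on `f` only through the two finite measures `κ x` and `κ' x`. Approximation in `L¹(κ x + κ' x)` by
smooth `g` with `‖g‖_∞ ≤ ‖f‖_∞` suffices. -/
theorem IsKer.supNorm_le_of_memCbInf {A : Op d} (hA : IsKer A) {c : ℝ≥0}
    (h : ∀ g, MemCbInf g → supNorm (A g) ≤ c * supNorm g) {f : St d → ℝ} (hf : MemMb f) :
    supNorm (A f) ≤ c * supNorm f := by
  have hA' := hA
  obtain ⟨κ, κ', _, _, hκ⟩ := hA
  refine supNorm_le fun x => ENNReal.le_of_forall_pos_le_add fun ε hε _ => ?_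
  obtain ⟨g, h1, h2, h3⟩ := exists_memCbInf_integral_le hf (κ x + κ' x) (ε := ε) hε
  have hfg := hf.sub h1.memMb
  have e : A f x = A g x + A (f - g) x := by
    rw [hA'.isFunctionalOperator.map_sub hf h1.memMb]
    simp
  have h4 : ‖A (f - g) x‖ ≤ ε := by
    rw [hκ _ hfg]
    have hi := (hfg.integrable (κ x)).norm
    have hi' := (hfg.integrable (κ' x)).norm
    calc ‖kop κ (f - g) x - kop κ' (f - g) x‖
        ≤ ‖kop κ (f - g) x‖ + ‖kop κ' (f - g) x‖ := norm_sub_le _ _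
      _ ≤ ∫ y, ‖(f - g) y‖ ∂(κ x) + ∫ y, ‖(f - g) y‖ ∂(κ' x) :=
          add_le_add (norm_integral_le_integral_norm _) (norm_integral_le_integral_norm _)
      _ = ∫ y, ‖(f - g) y‖ ∂(κ x + κ' x) := (integral_add_measure hi hi').symm
      _ ≤ ε := h3
  rw [e]
  refine (enorm_add_le _ _).trans (add_le_add ?_ ?_)
  · exact (enorm_le_supNorm _ x).trans ((h g h1).trans (by gcongr))
  · rw [← ofReal_norm, ← ENNReal.ofReal_coe_nnreal]
    exact ENNReal.ofReal_le_ofReal h4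

/-! ### Regularizing operators -/

theorem le_of_forall_pos_le_add_mul {x a : ℝ≥0∞} (c : ℝ≥0)
    (h : ∀ ε : ℝ≥0, 0 < ε → x ≤ a + c * ε) : x ≤ a := by
  refine ENNReal.le_of_forall_pos_le_add fun ε hε _ => (h (ε / (c + 1)) (by positivity)).trans ?_
  gcongr
  rw [← ENNReal.coe_mul, ENNReal.coe_le_coe, mul_div_assoc', div_le_iff₀ (by positivity), mul_comm]
  gcongr
  simp

theorem SmoothLim.of_approx {F : St d → ℝ} (c : ℝ≥0)
    (h : ∀ ε : ℝ≥0, 0 < ε → ∃ H, SmoothLim H ∧ supNorm (F - H) ≤ c * ε) : SmoothLim F := by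
  intro ε hε
  obtain ⟨H, h1, h2⟩ := h (ε / (2 * (c + 1))) (by positivity)
  obtain ⟨g, h3, h4⟩ := h1 (ε / 2) (half_pos hε)
  refine ⟨g, h3, ?_⟩
  have e : F - g = (F - H) + (H - g) := by abel
  rw [e]
  refine (supNorm_add_le _ _).trans ((add_le_add h2 h4).trans ?_)
  have h5 : c * (ε / (2 * (c + 1))) ≤ ε / 2 := by
    rw [mul_div_assoc', div_le_div_iff₀ (by positivity) two_pos]
    calc c * ε * 2 = ε * (2 * c) := by ring
      _ ≤ ε * (2 * (c + 1)) := by gcongr; simp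
  calc (c : ℝ≥0∞) * ↑(ε / (2 * (c + 1))) + ↑(ε / 2) ≤ ↑(ε / 2) + ↑(ε / 2) := by
        gcongr
        exact_mod_cast h5
    _ = ε := by rw [← ENNReal.coe_add, add_halves]

/-- With one derivative to spare, `A` maps smooth functions into `C_b^1`, whose elements are uniform
limits of smooth functions; boundedness of `A` does the rest. -/
theorem Est.smoothLim {R κ : ℕ} {G s : ℝ≥0} {A : Op d} (hA : Est R κ G s A) (hκ : κ + 1 ≤ R)
    {F : St d → ℝ} (hF : MemMb F) (hl : SmoothLim F) : SmoothLim (A F) := by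
  refine SmoothLim.of_approx s fun ε hε => ?_
  obtain ⟨g, h1, h2⟩ := hl ε hε
  refine ⟨A g, (hA.cb 1 g hκ (h1 _)).1.smoothLim, ?_⟩
  rw [← hA.ker.isFunctionalOperator.map_sub hF h1.memMb]
  exact (hA.sup _ (hF.sub h1.memMb)).trans (by gcongr)

/-- `S` regularizes: it may be inserted between two operators that lose at most `q` derivatives
altogether. -/
structure Reg (R q : ℕ) (C : ℝ≥0) (S : Op d) : Prop where
  op : IsFunctionalOperator S
  bdd : ∃ s : ℝ≥0, ∀ f, MemMb f → supNorm (S f) ≤ s * supNorm f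
  lim : ∀ F, MemMb F → SmoothLim F → SmoothLim (S F)
  est : ∀ (κA κB : ℕ) (GA GB sA sB : ℝ≥0) (A B : Op d), Est R κA GA sA A → Est R κB GB sB B →
    κA + κB ≤ q → ∀ f, MemCbInf f → supNorm (A (S (B f))) ≤ C * GA * GB * supNorm f

namespace Reg

variable {R q : ℕ} {C C₁ C₂ : ℝ≥0} {S : Op d}

theorem zero : Reg R q 0 (0 : Op d) where
  op := IsKer.zero.isFunctionalOperator
  bdd := ⟨0, fun f _ => by simp [supNorm_zero]⟩
  lim F _ _ := by
    have h : MemCb 1 (0 : St d → ℝ) := by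
      have := ((Est.zero (d := d) (R := 1) (κ := 0)).cb 1 0 (by simp)
        ⟨contDiff_const, cbNorm_lt_top fun γ => ?_⟩).1
      · simpa using this
      · have := mderiv_smul (γ := γ) (f := (0 : St d → ℝ)) le_rfl 0 contDiff_const
        rw [smul_zero, zero_smul] at this
        rw [this, supNorm_zero]
        simp
    exact h.smoothLim
  est κA κB GA GB sA sB A B hA hB _ f _ := by
    have : A 0 = 0 := hA.ker.isFunctionalOperator.map_zero
    simp [this, supNorm_zero]

/-- In `concat` the operator `S` acts on `S₁ (B f)`, which is a uniform limit of smooth functions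
but need not be smooth. The supremum bounds of `A` and `S` enter only the error that tends to zero,
not the final constant. -/
theorem est_smoothLim (hS : Reg R q C S) {κ : ℕ} {G s : ℝ≥0} {A : Op d} (hA : Est R κ G s A)
    (hκ : κ ≤ q) {F : St d → ℝ} (hF : MemMb F) (hl : SmoothLim F) :
    supNorm (A (S F)) ≤ C * G * supNorm F := by
  obtain ⟨t, ht⟩ := hS.bdd
  refine le_of_forall_pos_le_add_mul (C * G + s * t) fun ε hε => ?_
  obtain ⟨g, h1, h2⟩ := hl ε hε
  have hg := h1.memMb
  have e : A (S F) = A (S g) + A (S (F - g)) := by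
    rw [hS.op.map_sub hF hg,
      hA.ker.isFunctionalOperator.map_sub (hS.op.maps _ hF) (hS.op.maps _ hg)]
    abel
  have h3 := hS.est κ 0 G 1 s 1 A _ hA Est.id (by omega) g h1
  have h4 : supNorm g ≤ supNorm F + ε := by
    have : g = F - (F - g) := by abel
    rw [this]
    exact (supNorm_sub_le _ _).trans (by gcongr)
  have h5 : supNorm (A (S (F - g))) ≤ s * (t * ε) :=
    (hA.sup _ (hS.op.maps _ (hF.sub hg))).trans
      (by gcongr; exact (ht _ (hF.sub hg)).trans (by gcongr))
  rw [e]
  refine (supNorm_add_le _ _).trans ((add_le_add h3 h5).trans ?_)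
  calc (C : ℝ≥0∞) * G * (1 : ℝ≥0) * supNorm g + s * (t * ε)
      ≤ C * G * (1 : ℝ≥0) * (supNorm F + ε) + s * (t * ε) := by gcongr
    _ = C * G * supNorm F + (C * G + s * t : ℝ≥0) * ε := by push_cast; ring

/-- The dual estimate of `B` controls `B f` in a negative Sobolev norm, so up to a uniformly small
error `B f` is a sum of `∂^γ g_γ` with `|γ| ≤ κB`. The operator `S` absorbs these derivatives and
supplies the `κA` that `A` needs. The cardinality in the constant counts the terms of the sum. -/
theorem of_regularizes {L : ℝ≥0} (hop : IsFunctionalOperator S)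
    (hbdd : ∃ s : ℝ≥0, ∀ f, MemMb f → supNorm (S f) ≤ s * supNorm f) (hq : 1 ≤ q)
    (hqR : q + 1 ≤ R)
    (h : ∀ (r : ℕ) (γ : Fin d → ℕ), ∑ i, γ i + r ≤ q → ∀ f : St d → ℝ, MemCbInf f →
      MemCb r (S (mderiv γ f)) ∧ cbNorm r (S (mderiv γ f)) ≤ L * supNorm f) :
    Reg R q ((multiIndices d q).card * L) S where
  op := hop
  bdd := hbdd
  lim F hF hl := by
    obtain ⟨s, hs⟩ := hbdd
    refine SmoothLim.of_approx s fun ε hε => ?_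
    obtain ⟨g, h1, h2⟩ := hl ε hε
    have h3 := (h 1 0 (by simpa using hq) g h1).1
    rw [mderiv_zero] at h3
    refine ⟨S g, h3.smoothLim, ?_⟩
    rw [← hop.map_sub hF h1.memMb]
    exact (hs _ (hF.sub h1.memMb)).trans (by gcongr)
  est κA κB GA GB sA sB A B hA hB hκ f hf := by
    obtain ⟨s, hs⟩ := hbdd
    have hAop := hA.ker.isFunctionalOperator
    have hBf : MemCb 1 (B f) := (hB.cb 1 f (by omega) (hf _)).1
    have hBm := hBf.memMb
    have hfin := (memMb_iff.1 hf.memMb).2.ne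
    refine le_of_forall_pos_le_add_mul (sA * s) fun ε hε => ?_
    obtain ⟨M, hM⟩ := hBf.lipschitz
    -- The size of `φ` does not enter the bound on the `g γ`; mollification costs only the uniform
    -- error `ε`, multiplied by the supremum bounds of `A` and `S`.
    obtain ⟨φ, hφ, hφ1, hφε⟩ := UniformContinuous.exists_mollifier hM.uniformContinuous hε
    obtain ⟨g, hg, hsum⟩ := exists_decomposition hBm (κ := κB) (G := GB * (supNorm f).toNNReal)
      (fun u hu => by
        have := hB.enorm_integral_le (by omega) hf.memMb hu
        push_cast
        rwa [ENNReal.coe_toNNReal hfin]) hφ hφ1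
    rw [hsum] at hφε
    set F := ∑ γ ∈ multiIndices d κB, mderiv γ (g γ)
    have hFm : MemMb F := MemMb.sum fun γ _ => (hg γ).1.mderiv γ
    have hSg : ∀ γ ∈ multiIndices d κB, MemMb (S (mderiv γ (g γ))) := fun γ _ =>
      hop.maps _ ((hg γ).1.mderiv γ)
    have e : A (S (B f)) = A (S (B f - F)) + ∑ γ ∈ multiIndices d κB, A (S (mderiv γ (g γ))) := by
      rw [← hAop.map_sum hSg, ← hop.map_sum fun γ _ => (hg γ).1.mderiv γ, hop.map_sub hBm hFm,
        hAop.map_sub (hop.maps _ hBm) (hop.maps _ hFm)]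
      abel
    have h1 : supNorm (A (S (B f - F))) ≤ sA * (s * ε) :=
      (hA.sup _ (hop.maps _ (hBm.sub hFm))).trans
        (by gcongr; exact (hs _ (hBm.sub hFm)).trans (by gcongr))
    have h2 : ∀ γ ∈ multiIndices d κB,
        supNorm (A (S (mderiv γ (g γ)))) ≤ GA * (L * (GB * supNorm f)) := fun γ hγ => by
      obtain ⟨h3, h4⟩ := h κA γ (by have := mem_multiIndices.1 hγ; omega) (g γ) (hg γ).1
      refine (hA.supNorm_le (by omega) h3).trans ?_
      gcongr
      refine h4.trans ?_
      gcongr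
      refine (hg γ).2.trans_eq ?_
      push_cast
      rw [ENNReal.coe_toNNReal hfin]
    have hcard : (multiIndices d κB).card ≤ (multiIndices d q).card :=
      Finset.card_le_card fun γ hγ => mem_multiIndices.2 (by
        have := mem_multiIndices.1 hγ; omega)
    rw [e]
    refine (supNorm_add_le _ _).trans ((add_le_add h1 ((supNorm_sum_le _ _).trans
      (Finset.sum_le_card_nsmul _ _ _ h2))).trans ?_)
    rw [nsmul_eq_mul, add_comm]
    have hc : ((multiIndices d κB).card : ℝ≥0∞) ≤ (multiIndices d q).card := by
      exact_mod_cast hcard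
    calc ((multiIndices d κB).card : ℝ≥0∞) * (GA * (L * (GB * supNorm f))) + sA * (s * ε)
        ≤ (multiIndices d q).card * (GA * (L * (GB * supNorm f))) + sA * (s * ε) := by gcongr
      _ = ↑(((multiIndices d q).card : ℝ≥0) * L) * GA * GB * supNorm f + ↑(sA * s) * ε := by
        push_cast; ring

/-- Concatenation of regularizing operators. -/
theorem concat {S₁ X Y : Op d} {Kh : ℝ≥0} (hR : 1 ≤ R) (h₁ : Reg R q C₁ S₁) (h : Reg R q C S)
    (hX : Est R 0 Kh 1 X) (hY : Est R 0 Kh 1 Y) (hqR : q + 1 ≤ R) :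
    Reg R q (C₁ * Kh + C * Kh + C * C₁) (fun f => X (S₁ f) + S (Y f) - S (S₁ f)) where
  op := by
    have := ((hX.ker.isFunctionalOperator.comp h₁.op).add_op
      (h.op.comp hY.ker.isFunctionalOperator)).add_op (h.op.comp h₁.op).neg_op
    refine ⟨fun f hf => ?_, fun f g hf hg => ?_, fun c f hf => ?_⟩
    · simpa [sub_eq_add_neg] using this.maps f hf
    · simpa [sub_eq_add_neg] using this.add f g hf hg
    · simpa [sub_eq_add_neg] using this.smul c f hf
  bdd := by
    obtain ⟨s₁, hs₁⟩ := h₁.bdd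
    obtain ⟨s, hs⟩ := h.bdd
    refine ⟨s₁ + s + s * s₁, fun f hf => ?_⟩
    have a1 : supNorm (X (S₁ f)) ≤ s₁ * supNorm f := by
      refine (hX.sup _ (h₁.op.maps _ hf)).trans ?_
      simpa using hs₁ f hf
    have a2 : supNorm (S (Y f)) ≤ s * supNorm f := by
      refine (hs _ (hY.ker.maps hf)).trans ?_
      gcongr
      simpa using hY.sup f hf
    have a3 : supNorm (S (S₁ f)) ≤ s * (s₁ * supNorm f) :=
      (hs _ (h₁.op.maps _ hf)).trans (by gcongr; exact hs₁ f hf)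
    refine (supNorm_sub_le _ _).trans ((add_le_add ((supNorm_add_le _ _).trans
      (add_le_add a1 a2)) a3).trans_eq ?_)
    push_cast
    ring
  lim F hF hl := by
    rw [sub_eq_add_neg]
    exact ((hX.smoothLim (by omega) (h₁.op.maps _ hF) (h₁.lim F hF hl)).add
      (h.lim _ (hY.ker.maps hF) (hY.smoothLim (by omega) hF hl))).add
      (h.lim _ (h₁.op.maps _ hF) (h₁.lim F hF hl)).neg
  est κA κB GA GB sA sB A B hA hB hκ f hf := by
    have hBf : MemCb 1 (B f) := (hB.cb 1 f (by omega) (hf _)).1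
    have hBm := hBf.memMb
    have hAop := hA.ker.isFunctionalOperator
    have m1 := h₁.op.maps _ hBm
    have mX := hX.ker.maps m1
    have mS := h.op.maps _ (hY.ker.maps hBm)
    -- In `A X S₁ B` the transport `X` joins `A`, in `A S Y B` the transport `Y` joins `B`. In `A S
    -- S₁ B` the operator `S₁` absorbs the loss of `B` (`a4`) and then `S` that of `A` (`a3`).
    have a1 := h₁.est _ κB _ GB _ sB _ B (hA.comp hX) hB (by omega) f hf
    have a2 := h.est κA _ GA _ sA _ A _ hA (hY.comp hB) (by omega) f hf
    have a3 := h.est_smoothLim hA (by omega) m1 (h₁.lim _ hBm hBf.smoothLim)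
    have a4 := h₁.est 0 κB 1 GB 1 sB _ B Est.id hB (by omega) f hf
    simp only [hAop.map_sub (mX.add mS) (h.op.maps _ m1), hAop.add _ _ mX mS]
    refine (supNorm_sub_le _ _).trans ((add_le_add ((supNorm_add_le _ _).trans
      (add_le_add a1 a2)) (a3.trans (mul_le_mul_right a4 _))).trans_eq ?_)
    push_cast
    ring

end Reg

/-- The constant of the regularization by `M` consecutive blocks. -/
def blockConst (C Kh : ℝ≥0) : ℕ → ℝ≥0
  | 0 => 0
  | M + 1 => C * Kh + blockConst C Kh M * Kh + blockConst C Kh M * C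

/-! ### Consecutive blocks and the gain of powers of the error -/

section Blocks

variable {R q : ℕ} {C Kh e : ℝ≥0} {N w : ℕ} {Qf : ℕ → ℕ → Op d}

theorem exists_reg_blocks (hqR : q + 1 ≤ R)
    (hQ : ∀ a b, a ≤ b → b ≤ N → Est R 0 Kh 1 (Qf a b))
    (hcomp : ∀ a b c, a ≤ b → b ≤ c → c ≤ N → ∀ f, MemMb f → Qf a c f = Qf a b (Qf b c f))
    (hreg : ∀ a, a + w ≤ N → ∃ S, Reg R q C S ∧
      ∀ f, MemMb f → supNorm (Qf a (a + w) f - S f) ≤ e * supNorm f)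
    (M a : ℕ) (ha : a + M * w ≤ N) :
    ∃ S, Reg R q (blockConst C Kh M) S ∧
      ∀ f, MemMb f → supNorm (Qf a (a + M * w) f - S f) ≤ (e ^ M : ℝ≥0) * supNorm f := by
  induction M with
  | zero =>
    -- Without any block the regularizing operator is `0`, and the error `e ^ 0 = 1` is the Markov
    -- bound.
    refine ⟨0, Reg.zero, fun f hf => ?_⟩
    have := (hQ a a le_rfl (by omega)).sup f hf
    simpa using this
  | succ M ih =>
    have e1 : a + (M + 1) * w = a + M * w + w := by ring
    rw [e1] at ha ⊢
    obtain ⟨S, hS, hSe⟩ := ih (by omega)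
    obtain ⟨S₁, hS₁, hS₁e⟩ := hreg (a + M * w) ha
    have hX := hQ a (a + M * w) (by omega) (by omega)
    have hY := hQ (a + M * w) (a + M * w + w) (by omega) ha
    refine ⟨_, hS₁.concat (by omega) hS hX hY hqR, fun f hf => ?_⟩
    have mY := hY.ker.maps hf
    have m1 := hS₁.op.maps _ hf
    -- The difference factorizes as `(X - S)(Y - S₁)`, so the errors of the two parts multiply.
    have e2 : Qf a (a + M * w + w) f - (Qf a (a + M * w) (S₁ f) +
        S (Qf (a + M * w) (a + M * w + w) f) - S (S₁ f)) =
        Qf a (a + M * w) (Qf (a + M * w) (a + M * w + w) f - S₁ f) -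
          S (Qf (a + M * w) (a + M * w + w) f - S₁ f) := by
      rw [hcomp a (a + M * w) _ (by omega) (by omega) ha f hf,
        hX.ker.isFunctionalOperator.map_sub mY m1, hS.op.map_sub mY m1]
      abel
    rw [e2]
    refine (hSe _ (mY.sub m1)).trans ?_
    rw [pow_succ, ENNReal.coe_mul, mul_assoc]
    gcongr
    exact hS₁e f hf

/-- The estimate of a composition in which a long interval occurs. -/
theorem supNorm_long_interval_le (hqR : q + 1 ≤ R)
    (hQ : ∀ a b, a ≤ b → b ≤ N → Est R 0 Kh 1 (Qf a b))
    (hcomp : ∀ a b c, a ≤ b → b ≤ c → c ≤ N → ∀ f, MemMb f → Qf a c f = Qf a b (Qf b c f))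
    (hreg : ∀ a, a + w ≤ N → ∃ S, Reg R q C S ∧
      ∀ f, MemMb f → supNorm (Qf a (a + w) f - S f) ≤ e * supNorm f)
    {M a b : ℕ} (hab : a + M * w ≤ b) (hb : b ≤ N) {κA κB : ℕ} {GA GB sA sB : ℝ≥0} {A B : Op d}
    (hA : Est R κA GA sA A) (hB : Est R κB GB sB B) (hκ : κA + κB ≤ q) {f : St d → ℝ}
    (hf : MemCbInf f) :
    supNorm (A (Qf a b (B f))) ≤
      ((blockConst C Kh M * Kh + 1) * (GA * GB + e ^ M * (sA * sB)) : ℝ≥0) * supNorm f := by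
  obtain ⟨S, hS, hSe⟩ := exists_reg_blocks hqR hQ hcomp hreg M a (by omega)
  have hX := hQ a (a + M * w) (by omega) (by omega)
  have hY := hQ (a + M * w) b hab hb
  have hYB := hY.comp hB
  have mB := hB.ker.maps hf.memMb
  have mY := hY.ker.maps mB
  have mS := hS.op.maps _ mY
  have mX := hX.ker.maps mY
  have e1 : A (Qf a b (B f)) = A (S (Qf (a + M * w) b (B f))) +
      A (Qf a (a + M * w) (Qf (a + M * w) b (B f)) - S (Qf (a + M * w) b (B f))) := by
    rw [hcomp a (a + M * w) b (by omega) hab hb _ mB,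
      hA.ker.isFunctionalOperator.map_sub mX mS]
    abel
  have h1 := hS.est κA _ GA _ sA _ A _ hA hYB (by omega) f hf
  have h2 : supNorm (A (Qf a (a + M * w) (Qf (a + M * w) b (B f)) -
      S (Qf (a + M * w) b (B f)))) ≤ sA * ((e ^ M : ℝ≥0) * (sB * supNorm f)) := by
    refine (hA.sup _ (mX.sub mS)).trans ?_
    gcongr
    refine (hSe _ mY).trans ?_
    gcongr
    simpa using hYB.sup f hf.memMb
  rw [e1]
  refine (supNorm_add_le _ _).trans ((add_le_add h1 h2).trans ?_)
  calc (blockConst C Kh M : ℝ≥0∞) * GA * ↑(Kh * GB) * supNorm f +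
        sA * ((e ^ M : ℝ≥0) * (sB * supNorm f))
      = (blockConst C Kh M * Kh * (GA * GB) + e ^ M * (sA * sB) : ℝ≥0) * supNorm f := by
        push_cast; ring
    _ ≤ _ := by
        gcongr
        calc blockConst C Kh M * Kh * (GA * GB) + e ^ M * (sA * sB)
            ≤ (blockConst C Kh M * Kh + 1) * (GA * GB) +
              (blockConst C Kh M * Kh + 1) * (e ^ M * (sA * sB)) := by
              refine add_le_add ?_ (le_mul_of_one_le_left zero_le (by simp))
              gcongr
              simp
          _ = _ := by ring

end Blocks

/-! ### Sums over increasing sequences of times -/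

/-- One level of the sum over increasing sequences of times. -/
def nest (Qf : ℕ → ℕ → Op d) (Λ : ℕ → Op d) (e : ℕ) (Y : ℕ → Op d) : ℕ → Op d :=
  fun a f => ∑ b ∈ Finset.Ioc a e, Qf a (b - 1) (Λ (b - 1) (Y b f))

theorem nestedSum_eq_iterate (Qf : ℕ → ℕ → Op d) (Λ : ℕ → Op d) (e i : ℕ) :
    nestedSum Qf Λ e i = (nest Qf Λ e)^[i] fun a => Qf a e := by
  induction i with
  | zero => rfl
  | succ i ih =>
    rw [Function.iterate_succ_apply', ← ih]
    rfl

/-- The operators `Qf a b` between the times `a ≤ b` of the grid `{a₀, …, e}` transport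
regularity, and there is an estimate for compositions in which an interval of at least `W` steps
occurs. -/
structure Grid (R q a₀ e W : ℕ) (Kh Cst ε : ℝ≥0) (Qf : ℕ → ℕ → Op d) : Prop where
  one_le : 1 ≤ Kh
  est : ∀ a b, a₀ ≤ a → a ≤ b → b ≤ e → Est R 0 Kh 1 (Qf a b)
  long : ∀ a b, a₀ ≤ a → a + W ≤ b → b ≤ e →
    ∀ (κA κB : ℕ) (GA GB sA sB : ℝ≥0) (A B : Op d), Est R κA GA sA A → Est R κB GB sB B →
      κA + κB ≤ q → ∀ f, MemCbInf f →
        supNorm (A (Qf a b (B f))) ≤ (Cst * (GA * GB + ε * (sA * sB)) : ℝ≥0) * supNorm f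

/-- The operators `Y a`, `a₀ ≤ a ≤ e`, lose `κ` derivatives, and they regularize if there are at
least `ℓ` steps from `a` to `e`. -/
structure Fam (R q a₀ e : ℕ) (Cst ε : ℝ≥0) (ℓ κ : ℕ) (G s : ℝ≥0) (Y : ℕ → Op d) : Prop where
  est : ∀ a, a₀ ≤ a → a ≤ e → Est R κ G s (Y a)
  reg : ∀ a, a₀ ≤ a → a + ℓ ≤ e → ∀ (κA : ℕ) (GA sA : ℝ≥0) (A : Op d), Est R κA GA sA A →
    κA + κ ≤ q → ∀ f, MemCbInf f →
      supNorm (A (Y a f)) ≤ (Cst * (GA * G + ε * (sA * s)) : ℝ≥0) * supNorm f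

namespace Fam

variable {R q a₀ e : ℕ} {Cst ε : ℝ≥0} {ℓ ℓ' κ κ' : ℕ} {G G' s s' : ℝ≥0} {Y Y' : ℕ → Op d}

theorem mono (h : Fam R q a₀ e Cst ε ℓ κ G s Y) (hℓ : ℓ ≤ ℓ') (hκ : κ ≤ κ') (hG : G ≤ G')
    (hs : s ≤ s') : Fam R q a₀ e Cst ε ℓ' κ' G' s' Y where
  est a h1 h2 := (h.est a h1 h2).mono hκ hG hs
  reg a h1 h2 κA GA sA A hA hκA f hf :=
    (h.reg a h1 (by omega) κA GA sA A hA (by omega) f hf).trans (by gcongr)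

theorem congr (h : Fam R q a₀ e Cst ε ℓ κ G s Y)
    (hY : ∀ a, a₀ ≤ a → a ≤ e → ∀ f, MemMb f → Y a f = Y' a f) :
    Fam R q a₀ e Cst ε ℓ κ G s Y' where
  est a h1 h2 := (h.est a h1 h2).congr (hY a h1 h2)
  reg a h1 h2 κA GA sA A hA hκA f hf :=
    hY a h1 (by omega) f hf.memMb ▸ h.reg a h1 h2 κA GA sA A hA hκA f hf

theorem zero : Fam R q a₀ e Cst ε ℓ κ 0 0 (fun _ => (0 : Op d)) where
  est _ _ _ := Est.zero
  reg a h1 h2 κA GA sA A hA hκA f hf := by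
    have : A 0 = 0 := hA.ker.isFunctionalOperator.map_zero
    simp [this, supNorm_zero]

theorem add (h : Fam R q a₀ e Cst ε ℓ κ G s Y) (h' : Fam R q a₀ e Cst ε ℓ κ G' s' Y') :
    Fam R q a₀ e Cst ε ℓ κ (G + G') (s + s') (fun a => Y a + Y' a) where
  est a h1 h2 := (h.est a h1 h2).add (h'.est a h1 h2)
  reg a h1 h2 κA GA sA A hA hκA f hf := by
    have m := (h.est a h1 (by omega)).ker.maps hf.memMb
    have m' := (h'.est a h1 (by omega)).ker.maps hf.memMb
    rw [Pi.add_apply, hA.ker.map_add m m']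
    refine (supNorm_add_le _ _).trans ((add_le_add (h.reg a h1 h2 κA GA sA A hA hκA f hf)
      (h'.reg a h1 h2 κA GA sA A hA hκA f hf)).trans_eq ?_)
    push_cast
    ring

theorem sum {ι : Type*} {t : Finset ι} {G s : ι → ℝ≥0} {Y : ι → ℕ → Op d}
    (h : ∀ i ∈ t, Fam R q a₀ e Cst ε ℓ κ (G i) (s i) (Y i)) :
    Fam R q a₀ e Cst ε ℓ κ (∑ i ∈ t, G i) (∑ i ∈ t, s i) (fun a => ∑ i ∈ t, Y i a) := by
  classical
  induction t using Finset.induction_on with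
  | empty => simpa using Fam.zero
  | insert a t ha ih =>
    simp only [Finset.sum_insert ha]
    exact (h a (by simp)).add (ih fun i hi => h i (by simp [hi]))

end Fam

namespace Grid

variable {R q a₀ e W N : ℕ} {Kh Cst ε : ℝ≥0} {Qf : ℕ → ℕ → Op d} {ℓ κ κ₁ : ℕ}
  {G s g g₁ s₁ : ℝ≥0} {Y Z : ℕ → Op d} {Λ Δ : ℕ → Op d}

theorem fam_end (H : Grid R q a₀ e W Kh Cst ε Qf) :
    Fam R q a₀ e Cst ε W 0 Kh 1 (fun a => Qf a e) where
  est a h1 h2 := H.est a e h1 h2 le_rfl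
  reg a h1 h2 κA GA sA A hA hκA f hf := by
    have hK := H.one_le
    refine (H.long a e h1 h2 le_rfl κA 0 GA 1 sA 1 A _ hA Est.id hκA f hf).trans ?_
    gcongr

/-- Pigeonhole on each term: either the first interval `[a, b - 1]` has at least `W` steps and
regularizes, with `Λ Y` on its right, or at least `ℓ` steps remain after `b` and `Y b` regularizes,
with `A Q Λ` on its left. -/
theorem fam_nest (H : Grid R q a₀ e W Kh Cst ε Qf) (hN : e ≤ a₀ + N)
    (hΛ : ∀ b, a₀ ≤ b → b < e → Est R κ₁ g s₁ (Λ b)) (hY : Fam R q a₀ e Cst ε ℓ κ G s Y) :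
    Fam R q a₀ e Cst ε (ℓ + W + 1) (κ₁ + κ) (N * (Kh * (g * G))) (N * (s₁ * s))
      (nest Qf Λ e Y) := by
  have hcard : ∀ a, a₀ ≤ a → (Finset.Ioc a e).card ≤ N := fun a ha => by
    rw [Nat.card_Ioc]; omega
  refine ⟨fun a h1 h2 => ?_, fun a h1 h2 κA GA sA A hA hκA f hf => ?_⟩
  · have h3 : ∀ b ∈ Finset.Ioc a e, Est R (κ₁ + κ) (Kh * (g * G)) (s₁ * s)
        (fun f => Qf a (b - 1) (Λ (b - 1) (Y b f))) := fun b hb => by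
      rw [Finset.mem_Ioc] at hb
      have := (H.est a (b - 1) h1 (by omega) (by omega)).comp
        ((hΛ (b - 1) (by omega) (by omega)).comp (hY.est b (by omega) hb.2))
      exact this.mono (by omega) le_rfl (by simp)
    have h4 := (Est.sum h3).congr (B := nest Qf Λ e Y a) fun f _ => by
      rw [Finset.sum_apply]; rfl
    refine h4.mono le_rfl ?_ ?_ <;>
    · rw [Finset.sum_const, nsmul_eq_mul]
      gcongr
      exact hcard a h1
  · have h3 : ∀ b ∈ Finset.Ioc a e, MemMb (Qf a (b - 1) (Λ (b - 1) (Y b f))) := fun b hb => by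
      rw [Finset.mem_Ioc] at hb
      exact (H.est a (b - 1) h1 (by omega) (by omega)).ker.maps
        ((hΛ (b - 1) (by omega) (by omega)).ker.maps ((hY.est b (by omega) hb.2).ker.maps hf.memMb))
    have h4 : ∀ b ∈ Finset.Ioc a e, supNorm (A (Qf a (b - 1) (Λ (b - 1) (Y b f)))) ≤
        (Cst * (GA * (Kh * (g * G)) + ε * (sA * (s₁ * s))) : ℝ≥0) * supNorm f := fun b hb => by
      rw [Finset.mem_Ioc] at hb
      have hΛb := hΛ (b - 1) (by omega) (by omega)
      by_cases hc : a + W ≤ b - 1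
      · refine (H.long a (b - 1) h1 hc (by omega) κA (κ₁ + κ) GA (g * G) sA (s₁ * s) A _ hA
          (hΛb.comp (hY.est b (by omega) hb.2)) hκA f hf).trans ?_
        generalize g * G = X
        gcongr
        exact le_mul_of_one_le_left zero_le H.one_le
      · have hA' := hA.comp ((H.est a (b - 1) h1 (by omega) (by omega)).comp hΛb)
        refine (hY.reg b (by omega) (by omega) _ _ _ _ hA' (by omega) f hf).trans_eq ?_
        congr 2
        ring
    have h5 : A (nest Qf Λ e Y a f) =
        ∑ b ∈ Finset.Ioc a e, A (Qf a (b - 1) (Λ (b - 1) (Y b f))) :=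
      hA.ker.isFunctionalOperator.map_sum h3
    rw [h5]
    refine (supNorm_sum_le _ _).trans ((Finset.sum_le_card_nsmul _ _ _ h4).trans ?_)
    rw [nsmul_eq_mul]
    have h6 : ((Finset.Ioc a e).card : ℝ≥0∞) ≤ (N : ℝ≥0) := by
      rw [ENNReal.coe_natCast]; exact_mod_cast hcard a h1
    calc ((Finset.Ioc a e).card : ℝ≥0∞) *
          ((Cst * (GA * (Kh * (g * G)) + ε * (sA * (s₁ * s))) : ℝ≥0) * supNorm f)
        ≤ (N : ℝ≥0) * ((Cst * (GA * (Kh * (g * G)) + ε * (sA * (s₁ * s))) : ℝ≥0) *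
          supNorm f) := by gcongr
      _ = _ := by push_cast; ring

theorem fam_iterate (H : Grid R q a₀ e W Kh Cst ε Qf) (hN : e ≤ a₀ + N)
    (hΛ : ∀ b, a₀ ≤ b → b < e → Est R κ₁ g s₁ (Λ b)) (hZ : Fam R q a₀ e Cst ε W 0 Kh 1 Z)
    (i : ℕ) : Fam R q a₀ e Cst ε (W + i * (W + 1)) (i * κ₁) ((N * Kh * g) ^ i * Kh)
      ((N * s₁) ^ i) ((nest Qf Λ e)^[i] Z) := by
  induction i with
  | zero => exact hZ.mono (by omega) (by omega) (by simp) (by simp)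
  | succ i ih =>
    rw [Function.iterate_succ_apply']
    refine (H.fam_nest hN hΛ ih).mono (le_of_eq (by ring)) (le_of_eq (by ring)) (le_of_eq ?_)
      (le_of_eq ?_) <;> ring

/-- Termwise, `Δ Y - Λ Z = (Δ - Λ) Y + Λ (Y - Z)`. -/
theorem nest_sub_nest (H : Grid R q a₀ e W Kh Cst ε Qf)
    (hΛ : ∀ b, a₀ ≤ b → b < e → IsKer (Λ b)) (hΔ : ∀ b, a₀ ≤ b → b < e → IsKer (Δ b))
    (hY : ∀ b, a₀ ≤ b → b ≤ e → IsKer (Y b)) (hZ : ∀ b, a₀ ≤ b → b ≤ e → IsKer (Z b))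
    {a : ℕ} (ha : a₀ ≤ a) {f : St d → ℝ} (hf : MemMb f) :
    nest Qf Δ e Y a f - nest Qf Λ e Z a f =
      nest Qf (fun b => Δ b - Λ b) e Y a f + nest Qf Λ e (fun b => Y b - Z b) a f := by
  simp only [nest]
  rw [← Finset.sum_sub_distrib, ← Finset.sum_add_distrib]
  refine Finset.sum_congr rfl fun b hb => ?_
  rw [Finset.mem_Ioc] at hb
  have hQ := (H.est a (b - 1) ha (by omega) (by omega)).ker.isFunctionalOperator
  have kΛ := hΛ (b - 1) (by omega) (by omega)
  have kΔ := hΔ (b - 1) (by omega) (by omega)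
  have u := (hY b (by omega) hb.2).maps hf
  have v := (hZ b (by omega) hb.2).maps hf
  have e1 : (Δ (b - 1) - Λ (b - 1)) (Y b f) = Δ (b - 1) (Y b f) - Λ (b - 1) (Y b f) := rfl
  have e2 : (Y b - Z b) f = Y b f - Z b f := rfl
  rw [e1, e2, kΛ.isFunctionalOperator.map_sub u v, hQ.map_sub (kΔ.maps u) (kΛ.maps u),
    hQ.map_sub (kΛ.maps u) (kΛ.maps v)]
  abel

/-- Telescoping gives `i + 1` terms, each with exactly one factor `Δ - Λ`, which brings the small
constant `g₁`; the other `i` factors bring `g`. The supremum bounds gain nothing from the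
difference. -/
theorem fam_iterate_sub (H : Grid R q a₀ e W Kh Cst ε Qf) (hN : e ≤ a₀ + N)
    (hΛ : ∀ b, a₀ ≤ b → b < e → Est R κ₁ g s₁ (Λ b))
    (hΔ : ∀ b, a₀ ≤ b → b < e → Est R κ₁ g s₁ (Δ b))
    (hΔΛ : ∀ b, a₀ ≤ b → b < e → Est R κ₁ g₁ s₁ (Δ b - Λ b))
    (hZ : Fam R q a₀ e Cst ε W 0 Kh 1 Z) (i : ℕ) :
    Fam R q a₀ e Cst ε (W + (i + 1) * (W + 1)) ((i + 1) * κ₁)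
      ((i + 1 : ℕ) * ((N * Kh) ^ (i + 1) * g ^ i * g₁ * Kh)) ((i + 1 : ℕ) * (N * s₁) ^ (i + 1))
      (fun a => (nest Qf Δ e)^[i + 1] Z a - (nest Qf Λ e)^[i + 1] Z a) := by
  induction i with
  | zero =>
    have h := H.fam_nest hN hΔΛ hZ
    refine (h.congr (Y' := fun a => (nest Qf Δ e)^[0 + 1] Z a - (nest Qf Λ e)^[0 + 1] Z a)
      fun a h1 h2 f hf => ?_).mono (le_of_eq (by ring)) (le_of_eq (by ring)) (le_of_eq ?_)
      (le_of_eq ?_)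
    · have h3 := H.nest_sub_nest (fun b h h' => (hΛ b h h').ker) (fun b h h' => (hΔ b h h').ker)
        (fun b h h' => (hZ.est b h h').ker) (fun b h h' => (hZ.est b h h').ker) h1 hf
      have h4 : nest Qf Λ e (fun b => Z b - Z b) a f = 0 := by
        refine Finset.sum_eq_zero fun b hb => ?_
        rw [Finset.mem_Ioc] at hb
        have e1 : (Z b - Z b) f = 0 := by simp
        beta_reduce
        rw [e1, (hΛ (b - 1) (by omega) (by omega)).ker.isFunctionalOperator.map_zero,
          (H.est a (b - 1) h1 (by omega) (by omega)).ker.isFunctionalOperator.map_zero]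
      rw [h4, add_zero] at h3
      exact h3.symm
    · simp; ring
    · simp
  | succ i ih =>
    have f1 := H.fam_iterate hN hΔ hZ (i + 1)
    have f2 := H.fam_iterate hN hΛ hZ (i + 1)
    have h1 := (H.fam_nest hN hΔΛ f1).mono
      (ℓ' := W + (i + 1 + 1) * (W + 1)) (κ' := (i + 1 + 1) * κ₁) (le_of_eq (by ring))
      (le_of_eq (by ring)) le_rfl le_rfl
    have h2 := (H.fam_nest hN hΛ ih).mono
      (ℓ' := W + (i + 1 + 1) * (W + 1)) (κ' := (i + 1 + 1) * κ₁) (le_of_eq (by ring))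
      (le_of_eq (by ring)) le_rfl le_rfl
    refine ((h1.add h2).congr fun a ha h2 f hf => ?_).mono le_rfl le_rfl (le_of_eq ?_)
      (le_of_eq ?_)
    · rw [Function.iterate_succ_apply' (nest Qf Δ e) (i + 1) Z,
        Function.iterate_succ_apply' (nest Qf Λ e) (i + 1) Z]
      exact (H.nest_sub_nest (fun b h h' => (hΛ b h h').ker) (fun b h h' => (hΔ b h h').ker)
        (fun b h h' => (f1.est b h h').ker) (fun b h h' => (f2.est b h h').ker) ha hf).symm
    · push_cast; ring
    · push_cast; ring

/-- The expansion of a solution of the perturbation equation. -/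
theorem expansion (H : Grid R q a₀ e W Kh Cst ε Qf) (hN : e ≤ a₀ + N)
    (hΔ : ∀ b, a₀ ≤ b → b < e → Est R κ₁ g s₁ (Δ b)) (hZ : Fam R q a₀ e Cst ε W 0 Kh 1 Z)
    (heq : ∀ a, a₀ ≤ a → a ≤ e → ∀ f, MemMb f → Z a f = Qf a e f + nest Qf Δ e Z a f) (m a : ℕ)
    (h1 : a₀ ≤ a) (h2 : a ≤ e) (f : St d → ℝ) (hf : MemMb f) :
    Z a f = ∑ i ∈ Finset.range m, (nest Qf Δ e)^[i] (fun a => Qf a e) a f +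
      (nest Qf Δ e)^[m] Z a f := by
  induction m generalizing a with
  | zero => simp
  | succ m ih =>
    rw [heq a h1 h2 f hf, Finset.sum_range_succ']
    have key : nest Qf Δ e Z a f =
        ∑ i ∈ Finset.range m, (nest Qf Δ e)^[i + 1] (fun a => Qf a e) a f +
          (nest Qf Δ e)^[m + 1] Z a f := by
      simp only [Function.iterate_succ_apply']
      simp only [nest]
      rw [Finset.sum_comm, ← Finset.sum_add_distrib]
      refine Finset.sum_congr rfl fun b hb => ?_
      rw [Finset.mem_Ioc] at hb
      have hQ := (H.est a (b - 1) h1 (by omega) (by omega)).ker.isFunctionalOperator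
      have kΔ := (hΔ (b - 1) (by omega) (by omega)).ker.isFunctionalOperator
      have m1 : ∀ i ∈ Finset.range m, MemMb ((nest Qf Δ e)^[i] (fun a => Qf a e) b f) :=
        fun i _ => ((H.fam_iterate hN hΔ H.fam_end i).est b (by omega) hb.2).ker.maps hf
      have m2 : MemMb ((nest Qf Δ e)^[m] Z b f) :=
        ((H.fam_iterate hN hΔ hZ m).est b (by omega) hb.2).ker.maps hf
      have e1 := ih b (by omega) hb.2
      have e2 : Qf a (b - 1) (Δ (b - 1) (Z b f)) = _ :=
        congrArg (fun u => Qf a (b - 1) (Δ (b - 1) u)) e1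
      rw [e2, kΔ.add _ _ (MemMb.sum m1) m2, kΔ.map_sum m1,
        hQ.add _ _ (MemMb.sum fun i hi => kΔ.maps _ (m1 i hi)) (kΔ.maps _ m2),
        hQ.map_sum fun i hi => kΔ.maps _ (m1 i hi)]
    rw [key]
    simp only [Function.iterate_zero, id_eq]
    abel

/-- The estimate of the difference between `Z` and its approximation in terms of approximations
`Λ i` of `Δ`. -/
theorem fam_approximation (H : Grid R q a₀ e W Kh Cst ε Qf) (hN : e ≤ a₀ + N)
    {β : ℕ} (hΔ : ∀ b, a₀ ≤ b → b < e → Est R β g s₁ (Δ b))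
    (hZ : Fam R q a₀ e Cst ε W 0 Kh 1 Z)
    (heq : ∀ a, a₀ ≤ a → a ≤ e → ∀ f, MemMb f → Z a f = Qf a e f + nest Qf Δ e Z a f)
    {M : ℕ} {κs : Fin M → ℕ} {gs ss : Fin M → ℝ≥0} {Λ : Fin M → ℕ → Op d}
    (hΔΛ : ∀ i b, a₀ ≤ b → b < e → Est R (κs i) (gs i) (ss i) (Δ b - Λ i b))
    (hβ : ∀ i, β ≤ κs i) (hκ : (M + 1) * β ≤ κ) (hκ' : ∀ i : Fin M, ((i : ℕ) + 1) * κs i ≤ κ) :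
    Fam R q a₀ e Cst ε (W + (M + 1) * (W + 1)) κ
      ((N * Kh * g) ^ (M + 1) * Kh + ∑ i : Fin M,
        ((i + 1 : ℕ) * ((N * Kh) ^ ((i : ℕ) + 1) * (g + gs i) ^ (i : ℕ) * gs i * Kh)))
      ((N * s₁) ^ (M + 1) + ∑ i : Fin M, ((i + 1 : ℕ) * (N * (s₁ + ss i)) ^ ((i : ℕ) + 1)))
      (fun a f => Z a f - (Qf a e f + ∑ i : Fin M, nestedSum Qf (Λ i) e ((i : ℕ) + 1) a f)) := by
  have hD : ∀ i ∈ (Finset.univ : Finset (Fin M)), Fam R q a₀ e Cst ε (W + (M + 1) * (W + 1)) κ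
      ((i + 1 : ℕ) * ((N * Kh) ^ ((i : ℕ) + 1) * (g + gs i) ^ (i : ℕ) * gs i * Kh))
      ((i + 1 : ℕ) * (N * (s₁ + ss i)) ^ ((i : ℕ) + 1))
      (fun a => (nest Qf Δ e)^[(i : ℕ) + 1] (fun a => Qf a e) a -
        (nest Qf (Λ i) e)^[(i : ℕ) + 1] (fun a => Qf a e) a) := by
    intro i _
    -- `Λ = Δ - (Δ - Λ)`, so `Λ` inherits the sum of the two constants, which is then used for `Δ`
    -- as well.
    have e1 : ∀ b, a₀ ≤ b → b < e → Est R (κs i) (g + gs i) (s₁ + ss i) (Λ i b) :=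
      fun b h1 h2 => (((hΔ b h1 h2).mono (hβ i) le_rfl le_rfl).sub (hΔΛ i b h1 h2)).congr
        fun f _ => by simp
    have e2 : ∀ b, a₀ ≤ b → b < e → Est R (κs i) (g + gs i) (s₁ + ss i) (Δ b) :=
      fun b h1 h2 => (hΔ b h1 h2).mono (hβ i) (by simp) (by simp)
    have e3 : ∀ b, a₀ ≤ b → b < e → Est R (κs i) (gs i) (s₁ + ss i) (Δ b - Λ i b) :=
      fun b h1 h2 => (hΔΛ i b h1 h2).mono le_rfl le_rfl (by simp)
    refine (H.fam_iterate_sub hN e1 e2 e3 H.fam_end i).mono ?_ (hκ' i) le_rfl le_rfl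
    have := i.2
    gcongr
  -- The remainder of the expansion: `M + 1` factors `Δ`, ending in `Z`.
  have h1 := (H.fam_iterate hN hΔ hZ (M + 1)).mono (le_refl (W + (M + 1) * (W + 1))) hκ le_rfl
    le_rfl
  refine (h1.add (Fam.sum hD)).congr fun a ha ha' f hf => ?_
  rw [H.expansion hN hΔ hZ heq (M + 1) a ha ha' f hf, Finset.sum_range_succ', Pi.add_apply,
    Finset.sum_apply, Finset.sum_range]
  simp only [Pi.sub_apply, Finset.sum_sub_distrib, nestedSum_eq_iterate, Function.iterate_zero,
    id_eq]
  abel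

end Grid

/-- The perturbation equation for two semigroups. -/
theorem perturbation_equation {Pg Qf : ℕ → ℕ → Op d} {a₀ e : ℕ}
    (hP : ∀ a b, a₀ ≤ a → a ≤ b → b ≤ e → IsKer (Pg a b))
    (hQ : ∀ a b, a₀ ≤ a → a ≤ b → b ≤ e → IsKer (Qf a b))
    (hPc : ∀ a b c, a₀ ≤ a → a ≤ b → b ≤ c → c ≤ e → ∀ f, MemMb f →
      Pg a c f = Pg a b (Pg b c f))
    (hQc : ∀ a b c, a₀ ≤ a → a ≤ b → b ≤ c → c ≤ e → ∀ f, MemMb f →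
      Qf a c f = Qf a b (Qf b c f))
    (hQi : ∀ a, a₀ ≤ a → a ≤ e → ∀ f, MemMb f → Qf a a f = f)
    (hPi : ∀ f, MemMb f → Pg e e f = f)
    {a : ℕ} (ha : a₀ ≤ a) (hae : a ≤ e) {f : St d → ℝ} (hf : MemMb f) :
    Pg a e f = Qf a e f +
      nest Qf (fun b => Pg b (b + 1) - Qf b (b + 1)) e (fun a => Pg a e) a f := by
  -- One step of `P` at a time is exchanged for `Q`, from the left: `Q_{a,c} P_{c,e} - Q_{a,c+1}
  -- P_{c+1,e} = Q_{a,c} (P - Q)_{c,c+1} P_{c+1,e}`.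
  have key : ∀ c, a ≤ c → c ≤ e → Pg a e f = Qf a c (Pg c e f) + ∑ b ∈ Finset.Ioc a c,
      Qf a (b - 1) ((Pg (b - 1) (b - 1 + 1) - Qf (b - 1) (b - 1 + 1)) (Pg b e f)) := by
    intro c hac
    induction c, hac using Nat.le_induction with
    | base =>
      intro _
      rw [hQi a ha hae _ ((hP a e ha hae le_rfl).maps hf)]
      simp
    | succ c hac ih =>
      intro hc
      have hQk := (hQ a c ha hac (by omega)).isFunctionalOperator
      have mP := (hP (c + 1) e (by omega) hc le_rfl).maps hf
      rw [Finset.sum_Ioc_succ_top hac, ih (by omega)]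
      have e1 : (Pg (c + 1 - 1) (c + 1 - 1 + 1) - Qf (c + 1 - 1) (c + 1 - 1 + 1))
          (Pg (c + 1) e f) = Pg c e f - Qf c (c + 1) (Pg (c + 1) e f) := by
        rw [hPc c (c + 1) e (by omega) (by omega) hc le_rfl f hf]
        rfl
      rw [e1, Nat.add_sub_cancel, hQk.map_sub ((hP c e (by omega) (by omega) le_rfl).maps hf)
        ((hQ c (c + 1) (by omega) (by omega) hc).maps mP),
        ← hQc a c (c + 1) ha hac (by omega) hc _ mP]
      abel
  have h := key e hae le_rfl
  rw [hPi f hf] at h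
  exact h

/-! ### Orders -/

theorem one_le_mOrd {α : ℝ} (hα : 0 < α) (l : ℕ) {ν : ℝ} (hν : 0 < ν) : 1 ≤ mOrd α l ν :=
  Nat.one_le_ceil_iff.2 (by positivity)

theorem le_mOrd_mul {α : ℝ} (hα : 0 < α) (l : ℕ) (ν : ℝ) :
    ν ≤ mOrd α l ν * ((1 + α) * l + α) := by
  have hden : 0 < (1 + α) * (l : ℝ) + α := by positivity
  rw [← div_le_iff₀ hden]
  exact Nat.le_ceil _

theorem le_qOrd (α : ℝ) (i l : ℕ) (ν : ℝ) :
    ν + (i + 1) - (1 + α) * (l + 1) * i ≤ qOrd α (i + 1) l ν := by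
  have := Int.le_ceil (((i + 1 : ℕ) : ℝ) - (1 + α) * (l + 1) * (((i + 1 : ℕ) : ℝ) - 1))
  unfold qOrd
  push_cast at this ⊢
  linarith

/-- From `i + 1 < m(l, ν)` one gets `ν > (i + 1)((1 + α) l + α)`, and `(1 + α) l + α + 1 = (1 + α)(l
+ 1)`. This makes `Q̂ - Q` at least as small as `P - Q` in powers of `n`, and keeps the orders of
the recursion positive. -/
theorem lt_qOrd {α : ℝ} (hα : 0 < α) {l : ℕ} {ν : ℝ} (i : Fin (mOrd α l ν - 1)) :
    (1 + α) * (l + 1) < qOrd α (i + 1) l ν := by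
  have hden : 0 < (1 + α) * (l : ℝ) + α := by positivity
  have h1 : (i : ℕ) + 1 < mOrd α l ν := by have := i.2; omega
  have h2 := Nat.lt_ceil.1 h1
  rw [lt_div_iff₀ hden] at h2
  have h3 := le_qOrd α i l ν
  push_cast at h2
  nlinarith

theorem le_kap {α : ℝ} (hα : 0 < α) (β l : ℕ) {ν : ℝ} (hν : 0 < ν) :
    β ≤ kap α hα β l ν := by
  rw [kap]
  refine le_trans ?_ (le_max_left _ _)
  exact Nat.le_mul_of_pos_right β (one_le_mOrd hα l hν)

theorem mul_mOrd_le_kap {α : ℝ} (hα : 0 < α) (β l : ℕ) (ν : ℝ) :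
    mOrd α l ν * β ≤ kap α hα β l ν := by
  rw [kap, mul_comm]
  exact le_max_left _ _

theorem mul_kap_le_kap {α : ℝ} (hα : 0 < α) (β l : ℕ) (ν : ℝ) (i : Fin (mOrd α l ν - 1)) :
    ((i : ℕ) + 1) * kap α hα β (l + 1) (qOrd α (i + 1) l ν) ≤ kap α hα β l ν := by
  conv_rhs => rw [kap]
  refine le_trans ?_ (le_max_right _ _)
  exact Finset.le_sup (f := fun i : Fin (mOrd α l ν - 1) =>
      ((i : ℕ) + 1) * kap α hα β (l + 1) (qOrd α (i + 1) l ν)) (Finset.mem_univ i)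

/-! ### The semigroups -/

/-- The operators of the semigroup `P` between the points of index `a` and `b` of the grid of
level `l`. -/
def gridOp (T : ℝ) (n : ℕ) (P : ℝ → ℝ → Kernel (St d) (St d)) (l a b : ℕ) : Op d :=
  kop (P (a * step T n l) (b * step T n l))

/-- The assumptions on the semigroups, without the regularization property. -/
structure Model (d : ℕ) (K : ℕ → ℝ≥0) (α : ℝ) (β : ℕ) (T : ℝ) (n : ℕ)
    (P : ℝ → ℝ → Kernel (St d) (St d)) (Q : ℕ → ℕ → ℕ → Kernel (St d) (St d)) : Prop where
  hT : 0 < T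
  hn : 1 ≤ n
  hP : IsMarkovSemigroup T P
  hQ : ∀ k, 1 ≤ k → IsDiscreteMarkovSemigroup (n ^ k) (Q k)
  hPt : ∀ s t, 0 ≤ s → s ≤ t → t ≤ T → Transports K (kop (P s t)) ∧ TransportsDual K (kop (P s t))
  hQt : ∀ k, 1 ≤ k → ∀ i j : ℕ, i ≤ j → j ≤ n ^ k →
    Transports K (kop (Q k i j)) ∧ TransportsDual K (kop (Q k i j))
  hS : ∀ k, 1 ≤ k → ShortTime K α β T n k P Q ∧ ShortTimeDual K α β T n k P Q

/-- A bound larger than `1` for the constants `K r`, `r ≤ R`. -/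
def maxConst (K : ℕ → ℝ≥0) (R : ℕ) : ℝ≥0 := 1 + ∑ r ∈ Finset.range (R + 1), K r

theorem one_le_maxConst (K : ℕ → ℝ≥0) (R : ℕ) : 1 ≤ maxConst K R := by simp [maxConst]

theorem le_maxConst (K : ℕ → ℝ≥0) {R r : ℕ} (h : r ≤ R) : K r ≤ maxConst K R := by
  refine le_trans ?_ (le_add_of_nonneg_left zero_le)
  exact Finset.single_le_sum (f := K) (fun _ _ => zero_le) (Finset.mem_range.2 (by omega))

namespace Model

variable {K : ℕ → ℝ≥0} {α : ℝ} {β : ℕ} {T : ℝ} {n : ℕ} {P : ℝ → ℝ → Kernel (St d) (St d)}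
  {Q : ℕ → ℕ → ℕ → Kernel (St d) (St d)}

theorem n_pos (H : Model d K α β T n P Q) : (0 : ℝ) < n := by exact_mod_cast H.hn

theorem step_pos (H : Model d K α β T n P Q) (l : ℕ) : 0 < step T n l :=
  div_pos H.hT (pow_pos H.n_pos l)

theorem mul_step_le (H : Model d K α β T n P Q) {l a : ℕ} (h : a ≤ n ^ l) :
    a * step T n l ≤ T := by
  have h1 : (a : ℝ) ≤ (n : ℝ) ^ l := by exact_mod_cast h
  have h2 := pow_pos H.n_pos l
  calc a * step T n l ≤ (n : ℝ) ^ l * step T n l := by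
        gcongr
        exact (H.step_pos l).le
    _ = T := by rw [step, mul_div_cancel₀ _ h2.ne']

theorem mul_step_le_mul_step (H : Model d K α β T n P Q) (l : ℕ) {a b : ℕ} (h : a ≤ b) :
    a * step T n l ≤ b * step T n l := by
  have := (H.step_pos l).le
  gcongr

theorem mul_step_nonneg (H : Model d K α β T n P Q) (l a : ℕ) : 0 ≤ a * step T n l := by
  have := (H.step_pos l).le
  positivity

theorem isMarkovKernel_P (H : Model d K α β T n P Q) {l a b : ℕ} (hab : a ≤ b)
    (hb : b ≤ n ^ l) : IsMarkovKernel (P (a * step T n l) (b * step T n l)) :=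
  H.hP.markov _ _ (H.mul_step_nonneg l a) (H.mul_step_le_mul_step l hab) (H.mul_step_le hb)

theorem est_gridOp (H : Model d K α β T n P Q) (R : ℕ) {l a b : ℕ} (hab : a ≤ b)
    (hb : b ≤ n ^ l) : Est R 0 (maxConst K R) 1 (gridOp T n P l a b) := by
  have := H.isMarkovKernel_P hab hb
  have h := H.hPt _ _ (H.mul_step_nonneg l a) (H.mul_step_le_mul_step l hab) (H.mul_step_le hb)
  exact Est.of_transports h.1 h.2 fun r => le_maxConst K

theorem est_Q (H : Model d K α β T n P Q) (R : ℕ) {l a b : ℕ} (hl : 1 ≤ l) (hab : a ≤ b)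
    (hb : b ≤ n ^ l) : Est R 0 (maxConst K R) 1 (kop (Q l a b)) := by
  have := (H.hQ l hl).markov a b hab hb
  have h := H.hQt l hl a b hab hb
  exact Est.of_transports h.1 h.2 fun r => le_maxConst K

/-- The gain comes from the short time hypotheses and requires `β` derivatives. In the supremum norm
alone only the bound `2` for a difference of two Markov kernels is available. -/
theorem est_sub (H : Model d K α β T n P Q) (R : ℕ) {l b : ℕ} (hl : 1 ≤ l) (hb : b + 1 ≤ n ^ l) :
    Est R β (maxConst K R * (step T n l ^ (α + 1)).toNNReal) 2
      (gridOp T n P l b (b + 1) - kop (Q l b (b + 1))) := by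
  have hP := H.est_gridOp R (Nat.le_succ b) hb
  have hQ := H.est_Q R hl (Nat.le_succ b) hb
  have hPQ := hP.sub hQ
  refine ⟨hPQ.ker, fun f hf => ?_, fun r f hr hf => ?_, fun r f hr hf => ?_⟩
  · convert hPQ.sup f hf using 3
    norm_num
  · have h1 := hPQ.cb r f (by omega) (hf.of_le (by omega))
    refine ⟨h1.1, ((H.hS l hl).1 r f hf b hb).trans ?_⟩
    have hK := le_maxConst K (show r ≤ R by omega)
    calc (K r : ℝ≥0∞) * cbNorm (β + r) f * ENNReal.ofReal (step T n l ^ (α + 1))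
        ≤ maxConst K R * cbNorm (β + r) f * ENNReal.ofReal (step T n l ^ (α + 1)) := by gcongr
      _ = _ := by
        rw [ENNReal.coe_mul, ENNReal.ofReal]
        ring
  · obtain ⟨h₁, h₂, d1, m1, d2, m2, h3⟩ := (H.hS l hl).2 r f hf b hb
    refine ⟨h₁ - h₂, fun g hg => ?_, m1.sub m2, h3.trans ?_⟩
    · simp only [Pi.sub_apply, sub_mul, mul_sub]
      rw [integral_sub ((hP.ker.maps hg).mul_integrable hf.integrable)
        ((hQ.ker.maps hg).mul_integrable hf.integrable), integral_sub
        (hg.mul_integrable m1.integrable) (hg.mul_integrable m2.integrable), ← d1 g hg, ← d2 g hg]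
      rfl
    · have hK := le_maxConst K (show r ≤ R by omega)
      calc (K r : ℝ≥0∞) * c1Norm (β + r) f * ENNReal.ofReal (step T n l ^ (α + 1))
          ≤ maxConst K R * c1Norm (β + r) f * ENNReal.ofReal (step T n l ^ (α + 1)) := by gcongr
        _ = _ := by
          rw [ENNReal.coe_mul, ENNReal.ofReal]
          ring

theorem gridOp_comp (H : Model d K α β T n P Q) {l a b c : ℕ} (hab : a ≤ b) (hbc : b ≤ c)
    (hc : c ≤ n ^ l) {f : St d → ℝ} (hf : MemMb f) :
    gridOp T n P l a c f = gridOp T n P l a b (gridOp T n P l b c f) := by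
  have := H.isMarkovKernel_P hab (hbc.trans hc)
  have := H.isMarkovKernel_P hbc hc
  rw [gridOp, gridOp, gridOp, ← kop_comp hf,
    H.hP.comp _ _ _ (H.mul_step_nonneg l a) (H.mul_step_le_mul_step l hab)
      (H.mul_step_le_mul_step l hbc) (H.mul_step_le hc)]

theorem gridOp_refl (H : Model d K α β T n P Q) {l a : ℕ} (ha : a ≤ n ^ l) {f : St d → ℝ}
    (hf : MemMb f) : gridOp T n P l a a f = f := by
  rw [gridOp, H.hP.refl _ (H.mul_step_nonneg l a) (H.mul_step_le ha), kop_id f hf]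

theorem Q_comp (H : Model d K α β T n P Q) {l a b c : ℕ} (hl : 1 ≤ l) (hab : a ≤ b) (hbc : b ≤ c)
    (hc : c ≤ n ^ l) {f : St d → ℝ} (hf : MemMb f) :
    kop (Q l a c) f = kop (Q l a b) (kop (Q l b c) f) := by
  have := (H.hQ l hl).markov a b hab (hbc.trans hc)
  have := (H.hQ l hl).markov b c hbc hc
  rw [← kop_comp hf, (H.hQ l hl).comp a b c hab hbc hc]

theorem Q_refl (H : Model d K α β T n P Q) {l a : ℕ} (hl : 1 ≤ l) (ha : a ≤ n ^ l)
    {f : St d → ℝ} (hf : MemMb f) : kop (Q l a a) f = f := by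
  rw [(H.hQ l hl).refl a ha, kop_id f hf]

theorem perturbation (H : Model d K α β T n P Q) {l : ℕ} (hl : 1 ≤ l) {a e : ℕ} (hae : a ≤ e)
    (he : e ≤ n ^ l) {f : St d → ℝ} (hf : MemMb f) :
    gridOp T n P l a e f = kop (Q l a e) f + nest (fun a b => kop (Q l a b))
      (fun b => gridOp T n P l b (b + 1) - kop (Q l b (b + 1))) e
        (fun a => gridOp T n P l a e) a f :=
  perturbation_equation (Pg := gridOp T n P l) (Qf := fun a b => kop (Q l a b)) (a₀ := 0)
    (fun _ _ _ h1 h2 => (H.est_gridOp 0 h1 (h2.trans he)).ker)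
    (fun _ _ _ h1 h2 => (H.est_Q 0 hl h1 (h2.trans he)).ker)
    (fun _ _ _ _ h1 h2 h3 _ => H.gridOp_comp h1 h2 (h3.trans he))
    (fun _ _ _ _ h1 h2 h3 _ => H.Q_comp hl h1 h2 (h3.trans he))
    (fun _ _ h1 _ => H.Q_refl hl (h1.trans he)) (fun _ => H.gridOp_refl he) (Nat.zero_le a) hae hf

theorem gridOp_succ_level (H : Model d K α β T n P Q) (l a b : ℕ) :
    gridOp T n P (l + 1) (a * n) (b * n) = gridOp T n P l a b := by
  have h : ∀ a : ℕ, ((a * n : ℕ) : ℝ) * step T n (l + 1) = a * step T n l := fun a => by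
    have := H.n_pos
    rw [step, step, pow_succ]
    push_cast
    field_simp
  rw [gridOp, h, h, gridOp]

end Model

/-- The larger of `1` and `T`. -/
def maxOne (T : ℝ) : ℝ≥0 := max 1 T.toNNReal

theorem one_le_maxOne (T : ℝ) : 1 ≤ maxOne T := le_max_left _ _

/-- The exponent of `T` is rounded up to an integer, as `maxOne T ≥ 1` allows, so that later powers
combine in `ℕ`. -/
theorem toNNReal_step_rpow_le {T α : ℝ} {n : ℕ} (hT : 0 < T) (hα : 0 < α) (l : ℕ) :
    (step T n l ^ (α + 1)).toNNReal ≤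
      maxOne T ^ ⌈α + 1⌉₊ * (n : ℝ≥0) ^ (-((l : ℝ) * (1 + α))) := by
  have hs : 0 ≤ step T n l := by unfold step; positivity
  have h1 : (step T n l).toNNReal = T.toNNReal * ((n : ℝ≥0) ^ l)⁻¹ := by
    rw [step, div_eq_mul_inv, Real.toNNReal_mul hT.le, Real.toNNReal_inv, Real.toNNReal_pow (by simp)]
    simp
  rw [Real.toNNReal_rpow_of_nonneg hs, h1, NNReal.mul_rpow]
  have h2 : (((n : ℝ≥0) ^ l)⁻¹) ^ (α + 1) = (n : ℝ≥0) ^ (-((l : ℝ) * (1 + α))) := by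
    rw [NNReal.inv_rpow, ← NNReal.rpow_natCast, ← NNReal.rpow_mul, NNReal.rpow_neg, add_comm α 1]
  rw [h2]
  gcongr
  calc T.toNNReal ^ (α + 1) ≤ maxOne T ^ (α + 1) :=
        NNReal.rpow_le_rpow (le_max_right _ _) (by positivity)
    _ ≤ maxOne T ^ ((⌈α + 1⌉₊ : ℕ) : ℝ) :=
        NNReal.rpow_le_rpow_of_exponent_le (one_le_maxOne T) (Nat.le_ceil _)
    _ = _ := NNReal.rpow_natCast _ _

/-! ### Powers of the step -/

/-- Each of the `m` factors contributes `x · x^{-θ}`, one power of `x` for its summation. With `x =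
n` and `θ = (1 + α)(l + 1)`, the condition on `ν` is the defining property of `m(l, ν)`. -/
theorem remainder_term_le {x τ Kh g : ℝ≥0} {θ ν : ℝ} {p m : ℕ} (hx : 1 ≤ x)
    (hg : g ≤ Kh * (τ ^ p * x ^ (-θ))) (hν : ν ≤ m * (θ - 1)) :
    (x * Kh * g) ^ m * Kh ≤ (Kh * Kh) ^ m * Kh * τ ^ (p * m) * x ^ (-ν) := by
  have hx0 : x ≠ 0 := (zero_lt_one.trans_le hx).ne'
  have h1 : (x * x ^ (-θ)) ^ m ≤ x ^ (-ν) := by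
    have e : x * x ^ (-θ) = x ^ (1 - θ) := by
      rw [sub_eq_add_neg, NNReal.rpow_add hx0, NNReal.rpow_one]
    rw [e, ← NNReal.rpow_natCast, ← NNReal.rpow_mul]
    exact NNReal.rpow_le_rpow_of_exponent_le hx (by nlinarith)
  calc (x * Kh * g) ^ m * Kh ≤ (x * Kh * (Kh * (τ ^ p * x ^ (-θ)))) ^ m * Kh := by gcongr
    _ = (Kh * Kh) ^ m * Kh * τ ^ (p * m) * (x * x ^ (-θ)) ^ m := by
        rw [pow_mul]; simp only [mul_pow]; ring
    _ ≤ _ := by gcongr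

/-- Power count: `i + 1` summations, `i` factors of size `x^{-θ}` and one of size `x^{-q}`. The
condition `hν` is the definition of `q_{i+1}(l, ν)`, and `hq` ensures that `g + gs` is still of size
`x^{-θ}`. -/
theorem difference_term_le {x τ Kh g gs C : ℝ≥0} {θ ν q : ℝ} {p p' i : ℕ} (hx : 1 ≤ x)
    (hτ : 1 ≤ τ) (hg : g ≤ Kh * (τ ^ p * x ^ (-θ))) (hgs : gs ≤ C * τ ^ p' * x ^ (-q))
    (hq : θ ≤ q) (hν : ν + (i + 1) - θ * i ≤ q) :
    (i + 1 : ℕ) * ((x * Kh) ^ (i + 1) * (g + gs) ^ i * gs * Kh) ≤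
      ((i + 1 : ℕ) * (Kh ^ (i + 1) * (Kh + C) ^ i * C * Kh)) * τ ^ ((p + p') * i + p') *
        x ^ (-ν) := by
  have hx0 : x ≠ 0 := (zero_lt_one.trans_le hx).ne'
  have h1 : g + gs ≤ (Kh + C) * (τ ^ (p + p') * x ^ (-θ)) := by
    rw [add_mul]
    refine add_le_add (hg.trans ?_) (hgs.trans ?_)
    · gcongr
      omega
    · rw [mul_assoc]
      gcongr
      omega
  have h2 : x ^ (i + 1) * (x ^ (-θ)) ^ i * x ^ (-q) ≤ x ^ (-ν) := by
    rw [← NNReal.rpow_natCast, ← NNReal.rpow_natCast, ← NNReal.rpow_mul, ← NNReal.rpow_add hx0,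
      ← NNReal.rpow_add hx0]
    refine NNReal.rpow_le_rpow_of_exponent_le hx ?_
    push_cast
    linarith
  calc (i + 1 : ℕ) * ((x * Kh) ^ (i + 1) * (g + gs) ^ i * gs * Kh)
      ≤ (i + 1 : ℕ) * ((x * Kh) ^ (i + 1) * ((Kh + C) * (τ ^ (p + p') * x ^ (-θ))) ^ i *
        (C * τ ^ p' * x ^ (-q)) * Kh) := by gcongr
    _ = ((i + 1 : ℕ) * (Kh ^ (i + 1) * (Kh + C) ^ i * C * Kh)) * τ ^ ((p + p') * i + p') *
        (x ^ (i + 1) * (x ^ (-θ)) ^ i * x ^ (-q)) := by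
        rw [pow_add τ ((p + p') * i) p', pow_mul]; simp only [mul_pow]; ring
    _ ≤ _ := by gcongr

theorem crude_term_le {x C : ℝ≥0} {c i : ℕ} (hx : 1 ≤ x) :
    (x * (2 + C * x ^ c)) ^ i ≤ (2 + C) ^ i * x ^ ((1 + c) * i) := by
  rw [pow_mul, ← mul_pow]
  refine pow_le_pow_left₀ zero_le ?_ i
  calc x * (2 + C * x ^ c) ≤ x * (2 * x ^ c + C * x ^ c) := by
        gcongr
        exact le_mul_of_one_le_right zero_le (one_le_pow₀ hx)
    _ = (2 + C) * x ^ (1 + c) := by ring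

/-! ### The approximation of one step of level `l` -/

/-- The estimate of the error of the approximation of order `ν` on one step of level `l`. -/
def LevelEstimate (α : ℝ) (hα : 0 < α) (l : ℕ) (ν : ℝ) : Prop :=
  ∃ p c : ℕ, ∀ (d β R : ℕ) (K : ℕ → ℝ≥0), ∃ C : ℝ≥0,
    ∀ (T : ℝ) (n : ℕ) (P : ℝ → ℝ → Kernel (St d) (St d)) (Q : ℕ → ℕ → ℕ → Kernel (St d) (St d)),
      Model d K α β T n P Q → ∀ j, j + 1 ≤ n ^ l →
        Est R (kap α hα β l ν) (C * maxOne T ^ p * (n : ℝ≥0) ^ (-ν)) (C * (n : ℝ≥0) ^ c)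
          (gridOp T n P l j (j + 1) - qHat α hα n Q l ν j)

/-- The estimate on one step of level `l` in terms of the estimates on the steps of level `l + 1`,
for a regularizing grid. -/
theorem exists_fam_level {α : ℝ} (hα : 0 < α) (l : ℕ) {ν : ℝ} (hν : 0 < ν)
    (ih : ∀ i : Fin (mOrd α l ν - 1), LevelEstimate α hα (l + 1) (qOrd α (i + 1) l ν)) :
    ∃ p c : ℕ, ∀ (d β R : ℕ) (K : ℕ → ℝ≥0), ∃ C : ℝ≥0,
      ∀ (T : ℝ) (n : ℕ) (P : ℝ → ℝ → Kernel (St d) (St d))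
        (Q : ℕ → ℕ → ℕ → Kernel (St d) (St d)),
        Model d K α β T n P Q → ∀ j, j + 1 ≤ n ^ l → ∀ (q W κ : ℕ) (Cst ε : ℝ≥0),
          Grid R q (j * n) ((j + 1) * n) W (maxConst K R) Cst ε
            (fun a b => kop (Q (l + 1) a b)) →
          Fam R q (j * n) ((j + 1) * n) Cst ε W 0 (maxConst K R) 1
            (fun a => gridOp T n P (l + 1) a ((j + 1) * n)) →
          mOrd α l ν * β ≤ κ →
          (∀ i : Fin (mOrd α l ν - 1),
            ((i : ℕ) + 1) * kap α hα β (l + 1) (qOrd α (i + 1) l ν) ≤ κ) →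
          ∃ Y : ℕ → Op d,
            (∀ f, MemMb f → Y (j * n) f = (gridOp T n P l j (j + 1) - qHat α hα n Q l ν j) f) ∧
            Fam R q (j * n) ((j + 1) * n) Cst ε (W + mOrd α l ν * (W + 1)) κ
              (C * maxOne T ^ p * (n : ℝ≥0) ^ (-ν)) (C * (n : ℝ≥0) ^ c) Y := by
  have hm := one_le_mOrd hα l hν
  set M := mOrd α l ν - 1 with hM
  choose ps cs hps using ih
  have hM1 : mOrd α l ν = M + 1 := by omega
  let p₀ := ⌈α + 1⌉₊
  let p := p₀ * (M + 1) + ∑ i : Fin M, ((p₀ + ps i) * (i : ℕ) + ps i)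
  let c := (1 + 0) * (M + 1) + ∑ i : Fin M, (1 + cs i) * ((i : ℕ) + 1)
  refine ⟨p, c, fun d β R K => ?_⟩
  choose Cs hCs using fun i => hps i d β R K
  let Kh := maxConst K R
  let C₁ : ℝ≥0 := (Kh * Kh) ^ (M + 1) * Kh + ∑ i : Fin M,
    (((i : ℕ) + 1 : ℕ) * (Kh ^ ((i : ℕ) + 1) * (Kh + Cs i) ^ (i : ℕ) * Cs i * Kh))
  let C₂ : ℝ≥0 := (2 + 0) ^ (M + 1) + ∑ i : Fin M, ((i : ℕ) + 1 : ℕ) * (2 + Cs i) ^ ((i : ℕ) + 1)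
  refine ⟨C₁ + C₂, fun T n P Q H j hj q W κ Cst ε hG hF hκ hκ' => ?_⟩
  have hjn : (j + 1) * n ≤ n ^ (l + 1) := by
    rw [pow_succ]; exact Nat.mul_le_mul_right n hj
  have hx : (1 : ℝ≥0) ≤ n := by exact_mod_cast H.hn
  have hτ := one_le_maxOne T
  set τ := maxOne T
  set x := (n : ℝ≥0)
  set g : ℝ≥0 := Kh * (step T n (l + 1) ^ (α + 1)).toNNReal
  have hg : g ≤ Kh * (τ ^ p₀ * x ^ (-((1 + α) * ((l : ℝ) + 1)))) := by
    refine mul_le_mul_right ((toNNReal_step_rpow_le H.hT hα (l + 1)).trans_eq ?_) Kh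
    push_cast
    rw [mul_comm ((l : ℝ) + 1)]
  have hΔ : ∀ b, j * n ≤ b → b < (j + 1) * n →
      Est R β g 2 (gridOp T n P (l + 1) b (b + 1) - kop (Q (l + 1) b (b + 1))) :=
    fun b _ hb => H.est_sub R (by omega) (by omega)
  have hΔΛ : ∀ (i : Fin M) b, j * n ≤ b → b < (j + 1) * n →
      Est R (kap α hα β (l + 1) (qOrd α (i + 1) l ν))
        (Cs i * τ ^ ps i * x ^ (-(qOrd α (i + 1) l ν))) (Cs i * x ^ cs i)
        ((gridOp T n P (l + 1) b (b + 1) - kop (Q (l + 1) b (b + 1))) - fun g =>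
          qHat α hα n Q (l + 1) (qOrd α (i + 1) l ν) b g - kop (Q (l + 1) b (b + 1)) g) :=
    fun i b _ hb => (hCs i T n P Q H b (by omega)).congr fun f _ => by
      simp
  have hβ : ∀ i : Fin M, β ≤ kap α hα β (l + 1) (qOrd α (i + 1) l ν) := fun i =>
    le_kap hα β (l + 1) ((by positivity : (0 : ℝ) < (1 + α) * (l + 1)).trans (lt_qOrd hα i))
  have heq : ∀ a, j * n ≤ a → a ≤ (j + 1) * n → ∀ f, MemMb f →
      gridOp T n P (l + 1) a ((j + 1) * n) f = kop (Q (l + 1) a ((j + 1) * n)) f +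
        nest (fun a b => kop (Q (l + 1) a b))
          (fun b => gridOp T n P (l + 1) b (b + 1) - kop (Q (l + 1) b (b + 1))) ((j + 1) * n)
          (fun a => gridOp T n P (l + 1) a ((j + 1) * n)) a f :=
    fun a _ ha f hf => H.perturbation (by omega) ha hjn hf
  -- One step of level `l` consists of `n` steps of level `l + 1`.
  have key := hG.fam_approximation (N := n) (le_of_eq (by ring)) hΔ hF heq hΔΛ hβ
    (hM1 ▸ hκ) hκ'
  refine ⟨_, fun f hf => ?_, key.mono (by rw [hM1]) le_rfl ?_ ?_⟩
  · rw [H.gridOp_succ_level]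
    conv_rhs => rw [Pi.sub_apply, qHat]
  · have hp : ∀ {k : ℕ}, k ≤ p → τ ^ k ≤ τ ^ p := fun hk => pow_le_pow_right₀ hτ hk
    calc _ ≤ (Kh * Kh) ^ (M + 1) * Kh * τ ^ (p₀ * (M + 1)) * x ^ (-ν) + ∑ i : Fin M,
          (((i : ℕ) + 1 : ℕ) * (Kh ^ ((i : ℕ) + 1) * (Kh + Cs i) ^ (i : ℕ) * Cs i * Kh)) *
            τ ^ ((p₀ + ps i) * (i : ℕ) + ps i) * x ^ (-ν) := by
          refine add_le_add (remainder_term_le hx hg ?_) (Finset.sum_le_sum fun i _ =>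
            difference_term_le hx hτ hg le_rfl (lt_qOrd hα i).le ?_)
          · have := le_mOrd_mul hα l ν
            rw [hM1] at this
            refine this.trans_eq ?_
            push_cast
            ring
          · exact le_qOrd α i l ν
      _ ≤ (Kh * Kh) ^ (M + 1) * Kh * τ ^ p * x ^ (-ν) + ∑ i : Fin M,
          (((i : ℕ) + 1 : ℕ) * (Kh ^ ((i : ℕ) + 1) * (Kh + Cs i) ^ (i : ℕ) * Cs i * Kh)) *
            τ ^ p * x ^ (-ν) := by
          refine add_le_add ?_ (Finset.sum_le_sum fun i _ => ?_)
          · gcongr _ * ?_ * _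
            exact hp (Nat.le_add_right _ _)
          · gcongr _ * ?_ * _
            refine hp (le_trans ?_ (Nat.le_add_left _ _))
            exact Finset.single_le_sum (f := fun i : Fin M => (p₀ + ps i) * (i : ℕ) + ps i)
              (fun _ _ => Nat.zero_le _) (Finset.mem_univ i)
      _ = C₁ * τ ^ p * x ^ (-ν) := by
          simp only [C₁, add_mul, Finset.sum_mul]
      _ ≤ (C₁ + C₂) * τ ^ p * x ^ (-ν) := by
          gcongr
          simp
  · have hp : ∀ {k : ℕ}, k ≤ c → x ^ k ≤ x ^ c := fun hk => pow_le_pow_right₀ hx hk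
    calc _ ≤ (2 + 0) ^ (M + 1) * x ^ ((1 + 0) * (M + 1)) + ∑ i : Fin M,
          ((i : ℕ) + 1 : ℕ) * ((2 + Cs i) ^ ((i : ℕ) + 1) * x ^ ((1 + cs i) * ((i : ℕ) + 1))) := by
          refine add_le_add ?_ (Finset.sum_le_sum fun i _ => ?_)
          · have := crude_term_le (C := 0) (c := 0) (i := M + 1) hx
            simpa using this
          · gcongr
            exact crude_term_le hx
      _ ≤ (2 + 0) ^ (M + 1) * x ^ c + ∑ i : Fin M,
          ((i : ℕ) + 1 : ℕ) * ((2 + Cs i) ^ ((i : ℕ) + 1) * x ^ c) := by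
          refine add_le_add ?_ (Finset.sum_le_sum fun i _ => ?_)
          · gcongr _ * ?_
            exact hp (Nat.le_add_right _ _)
          · gcongr _ * (_ * ?_)
            refine hp (le_trans ?_ (Nat.le_add_left _ _))
            exact Finset.single_le_sum (f := fun i : Fin M => (1 + cs i) * ((i : ℕ) + 1))
              (fun _ _ => Nat.zero_le _) (Finset.mem_univ i)
      _ = C₂ * x ^ c := by
          simp only [C₂, add_mul, Finset.sum_mul, mul_assoc]
      _ ≤ (C₁ + C₂) * x ^ c := by
          gcongr
          simp

theorem levelEstimate {α : ℝ} (hα : 0 < α) (l : ℕ) {ν : ℝ} (hν : 0 < ν) :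
    LevelEstimate α hα l ν := by
  induction h : fuel α l ν using Nat.strong_induction_on generalizing l ν with
  | _ k ih =>
    have ih' : ∀ i : Fin (mOrd α l ν - 1), LevelEstimate α hα (l + 1) (qOrd α (i + 1) l ν) :=
      fun i => ih _ (h ▸ fuel_lt hα i) (l + 1)
        ((by positivity : (0 : ℝ) < (1 + α) * (l + 1)).trans (lt_qOrd hα i)) rfl
    obtain ⟨p, c, hpc⟩ := exists_fam_level hα l hν ih'
    refine ⟨p, c, fun d β R K => ?_⟩
    obtain ⟨C, hC⟩ := hpc d β R K
    refine ⟨C, fun T n P Q H j hj => ?_⟩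
    have hjn : (j + 1) * n ≤ n ^ (l + 1) := by
      rw [pow_succ]; exact Nat.mul_le_mul_right n hj
    -- No regularization is used at this stage: `W` exceeds every index of the grid, so the
    -- conditions on long intervals are vacuous, and only the loss of `κ(l, ν)` derivatives is
    -- retained.
    obtain ⟨Y, hY, hYF⟩ := hC T n P Q H j hj 0 ((j + 1) * n + 1) (kap α hα β l ν) 0 0
      ⟨one_le_maxConst K R, fun a b _ h1 h2 => H.est_Q R (by omega) h1 (h2.trans hjn),
        fun a b _ h1 h2 => by omega⟩
      ⟨fun a _ h1 => H.est_gridOp R h1 hjn, fun a _ h1 => by omega⟩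
      (mul_mOrd_le_kap hα β l ν) (mul_kap_le_kap hα β l ν)
    exact (hYF.est (j * n) le_rfl (Nat.mul_le_mul_right n (Nat.le_succ j))).congr hY

/-! ### Consequences of the regularization property -/

/-- If one step loses no derivative, neither does the whole construction, and the level estimate is
already a supremum bound. -/
theorem kap_zero {α : ℝ} (hα : 0 < α) (l : ℕ) (ν : ℝ) : kap α hα 0 l ν = 0 := by
  induction h : fuel α l ν using Nat.strong_induction_on generalizing l ν with
  | _ k ih =>
    rw [kap, zero_mul, Nat.zero_max, ← Nat.le_zero]
    refine Finset.sup_le fun i _ => ?_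
    rw [ih _ (h ▸ fuel_lt hα i) (l + 1) _ rfl, mul_zero]

theorem le_qReg {α : ℝ} (hα : 0 < α) (β : ℕ) {ν : ℝ} {i : ℕ} (h1 : 1 ≤ i)
    (h2 : i ≤ mOrd α 0 ν) :
    i * max β (kap α hα β 1 (qOrd α i 0 ν)) ≤ qReg α hα β ν :=
  Finset.le_sup (f := fun i => i * max β (kap α hα β 1 (qOrd α i 0 ν)))
    (Finset.mem_Icc.2 ⟨h1, h2⟩)

theorem memCbInf_const (c : ℝ) : MemCbInf (fun _ : St d => c) := fun r => by
  refine ⟨contDiff_const, cbNorm_lt_top fun γ => ?_⟩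
  have h : ∀ w : List (Fin d), ∃ c' : ℝ, w.foldr pderiv (fun _ : St d => c) = fun _ => c' := by
    intro w
    induction w with
    | nil => exact ⟨c, rfl⟩
    | cons i w ih =>
      obtain ⟨c', hc'⟩ := ih
      refine ⟨0, ?_⟩
      rw [List.foldr_cons, hc']
      funext x
      simp [pderiv]
  obtain ⟨c', hc'⟩ := h (word γ)
  rw [mderiv, hc']
  exact (supNorm_le (c := ‖c'‖ₑ) fun _ => le_rfl).trans_lt (by simp)

/-- As `Q 1` preserves constants, the regularization property bounds `T^η`. -/
theorem rpow_le_of_regularModifications {K : ℕ → ℝ≥0} {L : ℝ≥0} {α : ℝ} {hα : 0 < α} {β : ℕ}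
    {ν η T : ℝ} {n : ℕ} {Q : ℕ → ℕ → ℕ → Kernel (St d) (St d)} (hν : 0 < ν) (hT : 0 < T)
    (hn : 1 ≤ n) (hQ : IsMarkovKernel (Q 1 0 n)) (h : RegularModifications K L α hα β ν η T n Q) :
    T ^ η ≤ 2 * L := by
  obtain ⟨-, A, -, hreg, hclose⟩ := h 1 le_rfl
  have hn0 : (0 : ℝ) < n := by exact_mod_cast hn
  have hone := memCbInf_const (d := d) 1
  have hstep : (n : ℝ) * step T n 1 = T := by rw [step, pow_one, mul_div_cancel₀ _ hn0.ne']
  have h1 := (hreg 0 0 (by simp) _ hone 0 n (by omega) (by simp)).2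
  have h2 := hclose 0 n (by omega) le_rfl _ hone.memMb
  rw [mderiv_zero, cbNorm_zero_eq] at h1
  simp only [Nat.cast_zero, zero_mul, sub_zero, hstep, Nat.sub_self, pow_zero,
    mul_one] at h1 h2
  have hs1 : supNorm (fun _ : St d => (1 : ℝ)) = 1 := by simp [supNorm]
  rw [hs1, mul_one] at h1 h2
  have hk : kop (Q 1 0 n) (fun _ => (1 : ℝ)) = fun _ => 1 := by
    funext x
    simp [kop]
  rw [hk] at h2
  have h3 : (1 : ℝ≥0∞) ≤ ENNReal.ofReal ((n : ℝ) ^ (ν + mOrd α 0 ν)) := by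
    rw [← ENNReal.ofReal_one]
    exact ENNReal.ofReal_le_ofReal (Real.one_le_rpow (by exact_mod_cast hn) (by positivity))
  have h4 : (1 : ℝ≥0∞) ≤
      L * ENNReal.ofReal (T ^ (-η)) + L * ENNReal.ofReal (T ^ (-η)) := by
    -- The constant `1` is fixed by the Markov kernel; its distance to `A 1` and the size of `A 1`
    -- are each at most `L T^{-η}`.
    calc (1 : ℝ≥0∞) = supNorm (((fun _ : St d => (1 : ℝ)) - A 0 n fun _ => 1) +
          A 0 n fun _ => 1) := by rw [sub_add_cancel, hs1]
      _ ≤ _ := (supNorm_add_le _ _).trans (add_le_add (h2.trans ?_) h1)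
    exact ENNReal.div_le_of_le_mul (le_mul_of_one_le_right zero_le h3)
  have hTη : 0 < T ^ η := Real.rpow_pos_of_pos hT η
  have h5 : (1 : ℝ) ≤ 2 * L * T ^ (-η) := by
    have e : (L : ℝ≥0∞) * ENNReal.ofReal (T ^ (-η)) + L * ENNReal.ofReal (T ^ (-η)) =
        ENNReal.ofReal (2 * L * T ^ (-η)) := by
      rw [← ENNReal.ofReal_coe_nnreal, ← ENNReal.ofReal_mul (by positivity),
        ← ENNReal.ofReal_add (by positivity) (by positivity)]
      congr 1
      ring
    rw [e] at h4
    exact ENNReal.one_le_ofReal.1 h4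
  rw [Real.rpow_neg hT.le, ← div_eq_mul_inv, one_le_div hTη] at h5
  exact h5

theorem tNu_nonneg (α ν : ℝ) {T : ℝ} (hT : 0 < T) (n : ℕ) : 0 ≤ tNu α ν T n := by
  refine Real.sInf_nonneg ?_
  rintro _ ⟨⟨j, rfl⟩, -⟩
  unfold step
  positivity

theorem tNu_le (α ν : ℝ) {T : ℝ} (hT : 0 < T) {n : ℕ} (hn : 1 ≤ n) : tNu α ν T n ≤ T := by
  have hn0 : (0 : ℝ) < n := by exact_mod_cast hn
  refine csInf_le ⟨0, ?_⟩ ⟨⟨n, ?_⟩, ?_⟩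
  · rintro _ ⟨⟨j, rfl⟩, -⟩
    unfold step
    positivity
  · rw [step, pow_one, mul_div_cancel₀ _ hn0.ne']
  · rw [div_le_iff₀ (by positivity)]
    have : (0 : ℝ) ≤ mOrd α 0 ν := Nat.cast_nonneg _
    refine mul_le_mul_of_nonneg_left ?_ hT.le
    nlinarith

/-- The regularization of an interval of `w` steps of length `T / n`. -/
theorem exists_reg_interval {K : ℕ → ℝ≥0} {L : ℝ≥0} {α : ℝ} {hα : 0 < α} {β : ℕ} {ν η T : ℝ}
    {n : ℕ} {P : ℝ → ℝ → Kernel (St d) (St d)} {Q : ℕ → ℕ → ℕ → Kernel (St d) (St d)}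
    (H : Model d K α β T n P Q) (h : RegularModifications K L α hα β ν η T n Q) (hν : 0 < ν)
    (hη : 0 ≤ η) {R : ℕ} (hq : 1 ≤ qReg α hα β ν) (hqR : qReg α hα β ν + 1 ≤ R) {w : ℕ}
    {t : ℝ} (ht : 0 < t) (hw : t ≤ w * step T n 1) {k : ℕ} (hk : 1 ≤ k) {a : ℕ}
    (ha : a + w ≤ n) :
    ∃ S, Reg R (qReg α hα β ν)
        ((multiIndices d (qReg α hα β ν)).card * (L * (t ^ (-η)).toNNReal)) S ∧
      ∀ f, MemMb f → supNorm (kop (Q k (a * n ^ (k - 1)) ((a + w) * n ^ (k - 1))) f - S f) ≤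
        (L * (t ^ (-η)).toNNReal * (n : ℝ≥0)⁻¹ : ℝ≥0) * supNorm f := by
  obtain ⟨-, A, hop, hreg, hclose⟩ := h k hk
  have hn0 := H.n_pos
  have hnk : n ^ k = n * n ^ (k - 1) := by
    rw [← pow_succ', Nat.sub_add_cancel hk]
  have hpos : 0 < n ^ (k - 1) := Nat.pow_pos H.hn
  have hw0 : 0 < w := by
    rcases Nat.eq_zero_or_pos w with rfl | h0
    · simp at hw; linarith
    · exact h0
  have hlt : a * n ^ (k - 1) < (a + w) * n ^ (k - 1) := by gcongr; omega
  have hle : (a + w) * n ^ (k - 1) ≤ n ^ k := hnk ▸ Nat.mul_le_mul_right _ ha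
  have hlen : ((a + w : ℕ) : ℝ) * step T n 1 - a * step T n 1 = w * step T n 1 := by
    push_cast; ring
  have hstep : ∀ b : ℕ, ((b * n ^ (k - 1) : ℕ) : ℝ) * step T n k = b * step T n 1 := fun b => by
    have e : (n : ℝ) ^ k = n * (n : ℝ) ^ (k - 1) := by exact_mod_cast hnk
    rw [step, step, e]
    push_cast
    field_simp
  have hη' : (w * step T n 1) ^ (-η) ≤ t ^ (-η) :=
    Real.rpow_le_rpow_of_nonpos ht hw (by linarith)
  have hof : ENNReal.ofReal ((w * step T n 1) ^ (-η)) ≤ ((t ^ (-η)).toNNReal : ℝ≥0∞) :=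
    ENNReal.ofReal_le_ofReal hη'
  -- Only the factor `1/n` of the closeness is kept, which `ν + m ≥ 1` permits; the higher powers
  -- come from concatenating blocks.
  have hn1 : ((n : ℝ≥0) : ℝ≥0∞) ≤ ENNReal.ofReal ((n : ℝ) ^ (ν + mOrd α 0 ν)) := by
    rw [← ENNReal.ofReal_coe_nnreal]
    refine ENNReal.ofReal_le_ofReal ?_
    have h1 : (1 : ℝ) ≤ mOrd α 0 ν := by exact_mod_cast one_le_mOrd hα 0 hν
    rw [NNReal.coe_natCast]
    exact Real.self_le_rpow_of_one_le (by exact_mod_cast H.hn) (by linarith)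
  have hcl : ∀ f, MemMb f →
      supNorm (kop (Q k (a * n ^ (k - 1)) ((a + w) * n ^ (k - 1))) f -
        A (a * n ^ (k - 1)) ((a + w) * n ^ (k - 1)) f) ≤
        (L * (t ^ (-η)).toNNReal * (n : ℝ≥0)⁻¹ : ℝ≥0) * supNorm f := by
    intro f hf
    refine (hclose a (a + w) (by omega) ha f hf).trans ?_
    rw [hlen, ENNReal.coe_mul, ENNReal.coe_mul, ENNReal.coe_inv (by exact_mod_cast hn0.ne'),
      div_eq_mul_inv, mul_right_comm _ (supNorm f)]
    gcongr
  refine ⟨A (a * n ^ (k - 1)) ((a + w) * n ^ (k - 1)), ?_, hcl⟩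
  refine Reg.of_regularizes (hop _ _ hlt hle)
    ⟨1 + L * (t ^ (-η)).toNNReal * (n : ℝ≥0)⁻¹, fun f hf => ?_⟩ hq hqR fun r γ hγ f hf => ?_
  -- The modification is bounded because it is close to a Markov operator.
  · have e : A (a * n ^ (k - 1)) ((a + w) * n ^ (k - 1)) f =
        kop (Q k (a * n ^ (k - 1)) ((a + w) * n ^ (k - 1))) f -
          (kop (Q k (a * n ^ (k - 1)) ((a + w) * n ^ (k - 1))) f -
            A (a * n ^ (k - 1)) ((a + w) * n ^ (k - 1)) f) := by abel
    rw [e]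
    refine (supNorm_sub_le _ _).trans ?_
    rw [ENNReal.coe_add, add_mul _ _ (supNorm f)]
    exact add_le_add ((H.est_Q 0 hk hlt.le hle).sup f hf) (hcl f hf)
  · obtain ⟨h1, h2⟩ := hreg r γ hγ f hf _ _ hlt hle
    refine ⟨h1, h2.trans ?_⟩
    rw [hstep, hstep, hlen, ENNReal.coe_mul]
    gcongr

/-! ### The semigroup `P` as a limit -/

namespace Model

variable {K : ℕ → ℝ≥0} {α : ℝ} {β : ℕ} {T : ℝ} {n : ℕ} {P : ℝ → ℝ → Kernel (St d) (St d)}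
  {Q : ℕ → ℕ → ℕ → Kernel (St d) (St d)}

theorem gridOp_one_eq (H : Model d K α β T n P Q) {k : ℕ} (hk : 1 ≤ k) (a b : ℕ) :
    gridOp T n P k (a * n ^ (k - 1)) (b * n ^ (k - 1)) = gridOp T n P 1 a b := by
  induction k, hk using Nat.le_induction with
  | base => simp
  | succ k hk ih =>
    have e : ∀ a : ℕ, a * n ^ (k + 1 - 1) = a * n ^ (k - 1) * n := fun a => by
      rw [mul_assoc, ← pow_succ, Nat.sub_add_cancel hk, Nat.add_sub_cancel]
    rw [e, e, H.gridOp_succ_level, ih]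

/-- The error of the discrete semigroup of level `k`. -/
theorem est_gridOp_sub (H : Model d K α β T n P Q) (hα : 0 < α) (R : ℕ) {k : ℕ} (hk : 1 ≤ k)
    {a e : ℕ} (hae : a ≤ e) (he : e ≤ n ^ k) :
    ∃ s : ℝ≥0, Est R β (maxConst K R ^ 3 * maxOne T ^ ⌈α + 1⌉₊ * ((n : ℝ≥0) ^ (-α)) ^ k) s
      (gridOp T n P k a e - kop (Q k a e)) := by
  set Kh := maxConst K R
  -- The threshold `e + 1` again empties the conditions on long intervals. One application of the
  -- perturbation equation sums at most `n ^ k` errors of size `n^{-k(1+α)}`, which leaves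
  -- `n^{-αk}`.
  have hG : Grid R 0 0 e (e + 1) Kh 0 0 (fun a b => kop (Q k a b)) :=
    ⟨one_le_maxConst K R, fun a b _ h1 h2 => H.est_Q R hk h1 (h2.trans he),
      fun a b _ h1 h2 => by omega⟩
  have hF : Fam R 0 0 e 0 0 (e + 1) 0 Kh 1 (fun a => gridOp T n P k a e) :=
    ⟨fun a _ h1 => H.est_gridOp R h1 he, fun a _ h1 => by omega⟩
  have h1 := (hG.fam_nest (N := n ^ k)
    (Λ := fun b => gridOp T n P k b (b + 1) - kop (Q k b (b + 1))) (by omega)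
    (fun b _ hb => H.est_sub R hk (by omega)) hF).est a (Nat.zero_le a) hae
  refine ⟨_, (h1.congr (B := gridOp T n P k a e - kop (Q k a e)) fun f hf => ?_).mono
    (by omega) ?_ le_rfl⟩
  · rw [Pi.sub_apply, H.perturbation hk hae he hf, add_sub_cancel_left]
  · have hx : (1 : ℝ≥0) ≤ n := by exact_mod_cast H.hn
    have hx0 : (n : ℝ≥0) ≠ 0 := (zero_lt_one.trans_le hx).ne'
    have h2 : ((n ^ k : ℕ) : ℝ≥0) * (n : ℝ≥0) ^ (-((k : ℝ) * (1 + α))) =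
        ((n : ℝ≥0) ^ (-α)) ^ k := by
      push_cast
      rw [← NNReal.rpow_natCast, ← NNReal.rpow_natCast, ← NNReal.rpow_mul,
        ← NNReal.rpow_add hx0]
      congr 1
      ring
    calc ((n ^ k : ℕ) : ℝ≥0) * (Kh * (Kh * (step T n k ^ (α + 1)).toNNReal * Kh))
        ≤ ((n ^ k : ℕ) : ℝ≥0) * (Kh * (Kh * (maxOne T ^ ⌈α + 1⌉₊ *
          (n : ℝ≥0) ^ (-((k : ℝ) * (1 + α)))) * Kh)) := by
          gcongr
          exact toNNReal_step_rpow_le H.hT hα k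
      _ = Kh ^ 3 * maxOne T ^ ⌈α + 1⌉₊ *
          (((n ^ k : ℕ) : ℝ≥0) * (n : ℝ≥0) ^ (-((k : ℝ) * (1 + α)))) := by ring
      _ = _ := by rw [h2]

/-- Estimates that hold for the discrete semigroups of all levels pass to the limit. -/
theorem supNorm_gridOp_le_of_forall (H : Model d K α β T n P Q) (hα : 0 < α) (hn : 2 ≤ n) {R : ℕ}
    {κ : ℕ} {G s : ℝ≥0} {A : Op d} (hA : Est R κ G s A) (hκ : κ + β ≤ R) {a : ℕ} (ha : a ≤ n)
    {f : St d → ℝ} (hf : MemCbInf f) {c : ℝ≥0∞}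
    (h : ∀ k, 1 ≤ k → supNorm (A (kop (Q k (a * n ^ (k - 1)) (n * n ^ (k - 1))) f)) ≤ c) :
    supNorm (A (gridOp T n P 1 a n f)) ≤ c := by
  set B := (cbNorm (κ + β) f).toNNReal
  have hB : cbNorm (κ + β) f = B := (ENNReal.coe_toNNReal (hf _).2.ne).symm
  refine le_of_forall_pos_le_add_mul
    (G * (maxConst K R ^ 3 * maxOne T ^ ⌈α + 1⌉₊) * B) fun ε hε => ?_
  -- The error of level `k` is geometric in `k` with this ratio; `n ≥ 2` makes it decay.
  have hy : (n : ℝ≥0) ^ (-α) < 1 :=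
    NNReal.rpow_lt_one_of_one_lt_of_neg (by exact_mod_cast hn) (by linarith)
  obtain ⟨k, hk⟩ := NNReal.exists_pow_lt_of_lt_one hε hy
  have hk' : ((n : ℝ≥0) ^ (-α)) ^ (k + 1) ≤ ε :=
    (pow_le_pow_of_le_one zero_le hy.le (Nat.le_succ k)).trans hk.le
  have hnk : n * n ^ (k + 1 - 1) ≤ n ^ (k + 1) := by
    rw [← pow_succ', Nat.sub_add_cancel (by omega)]
  have hle : a * n ^ (k + 1 - 1) ≤ n * n ^ (k + 1 - 1) := Nat.mul_le_mul_right _ ha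
  obtain ⟨s', hs'⟩ := H.est_gridOp_sub hα R (k := k + 1) (by omega) hle hnk
  have mP := (H.est_gridOp R hle hnk).ker.maps hf.memMb
  have mQ := (H.est_Q R (by omega) hle hnk).ker.maps hf.memMb
  have e : A (gridOp T n P 1 a n f) =
      A (kop (Q (k + 1) (a * n ^ (k + 1 - 1)) (n * n ^ (k + 1 - 1))) f) +
      A ((gridOp T n P (k + 1) (a * n ^ (k + 1 - 1)) (n * n ^ (k + 1 - 1)) -
        kop (Q (k + 1) (a * n ^ (k + 1 - 1)) (n * n ^ (k + 1 - 1)))) f) := by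
    rw [Pi.sub_apply, hA.ker.isFunctionalOperator.map_sub mP mQ,
      H.gridOp_one_eq (by omega)]
    abel
  rw [e]
  refine (supNorm_add_le _ _).trans (add_le_add (h (k + 1) (by omega)) ?_)
  refine ((hA.comp hs').supNorm_le hκ (hf _)).trans ?_
  rw [hB, ← ENNReal.coe_mul, ← ENNReal.coe_mul, ENNReal.coe_le_coe]
  calc G * (maxConst K R ^ 3 * maxOne T ^ ⌈α + 1⌉₊ * ((n : ℝ≥0) ^ (-α)) ^ (k + 1)) * B
      ≤ G * (maxConst K R ^ 3 * maxOne T ^ ⌈α + 1⌉₊ * ε) * B := by gcongr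
    _ = _ := by ring

end Model

/-! ### The approximation of the whole interval -/

/-- The error estimate for many steps. -/
theorem exists_estimate_of_large {α : ℝ} (hα : 0 < α) {ν : ℝ} (hν : 0 < ν) :
    ∃ p D : ℕ, 0 < D ∧ ∀ (d β : ℕ) (η T₀ : ℝ) (K : ℕ → ℝ≥0) (L : ℝ≥0), 1 ≤ β → 0 ≤ η → 0 < T₀ →
      ∃ C : ℝ≥0, ∀ (T : ℝ) (n : ℕ) (P : ℝ → ℝ → Kernel (St d) (St d))
        (Q : ℕ → ℕ → ℕ → Kernel (St d) (St d)), T₀ ≤ T → D ≤ n → Model d K α β T n P Q →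
        RegularModifications K L α hα β ν η T n Q → ∀ f, MemCbInf f →
          supNorm ((gridOp T n P 0 0 (0 + 1) - qHat α hα n Q 0 ν 0) f) ≤
            (C * maxOne T ^ p * (n : ℝ≥0) ^ (-ν) : ℝ≥0) * supNorm f := by
  obtain ⟨p, c, hpc⟩ := exists_fam_level hα 0 hν fun i => levelEstimate hα 1
    ((by positivity : (0 : ℝ) < (1 + α) * ((0 : ℕ) + 1)).trans (lt_qOrd hα i))
  set m := mOrd α 0 ν with hm
  have hm1 : 1 ≤ m := one_le_mOrd hα 0 hν
  -- `M` blocks beat the crude growth: `n^{c - M} ≤ n^{-ν}`. With `w = n / D` steps per block, `D`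
  -- leaves room for `m + 1` stretches of `M` blocks and the `m` single steps between them (`hlen`).
  let M := c + ⌈ν⌉₊ + 1
  let D := 2 * ((m + 1) * M)
  have hD : 0 < D := by positivity
  refine ⟨p, D, hD, fun d β η T₀ K L hβ hη hT₀ => ?_⟩
  set q := qReg α hα β ν with hq
  have hq0 : m * β ≤ q :=
    (Nat.mul_le_mul_left m (le_max_left _ _)).trans (le_qReg hα β hm1 le_rfl)
  have hq1 : 1 ≤ q := (Nat.mul_pos hm1 hβ).trans_le hq0
  -- `β` derivatives pay for the passage from the discrete semigroups to `P`, and one more makes `B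
  -- f` Lipschitz.
  let R := q + β + 1
  obtain ⟨C, hC⟩ := hpc d β R K
  let Kh := maxConst K R
  -- A lower bound, uniform in `n` and `T ≥ T₀`, for the duration `w T / n` of a block, since `n ≤ 2
  -- D w`.
  let t : ℝ := T₀ / (2 * D)
  have ht : 0 < t := by positivity
  let Lb : ℝ≥0 := L * (t ^ (-η)).toNNReal
  let Cst : ℝ≥0 := blockConst ((multiIndices d q).card * Lb) Kh M * Kh + 1
  refine ⟨Cst * (C + Lb ^ M * C), fun T n P Q hT hn H hreg f hf => ?_⟩
  have hx : (1 : ℝ≥0) ≤ n := by exact_mod_cast H.hn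
  have hx0 : (n : ℝ≥0) ≠ 0 := (zero_lt_one.trans_le hx).ne'
  let w := n / D
  have hw1 : 1 ≤ w := (Nat.one_le_div_iff hD).2 hn
  have hwD : D * w ≤ n := Nat.mul_div_le n D
  have hwD' : n < D * w + D := by
    have := Nat.lt_mul_div_succ n hD
    rw [mul_add, mul_one] at this
    exact this
  have hDw : D ≤ D * w := Nat.le_mul_of_pos_right D hw1
  have htw : t ≤ w * step T n 1 := by
    have h1 : (n : ℝ) ≤ 2 * D * w := by
      have : n ≤ 2 * D * w := by rw [mul_assoc]; omega
      exact_mod_cast this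
    rw [step, pow_one, mul_div_assoc', div_le_div_iff₀ (by positivity) H.n_pos]
    calc T₀ * n ≤ T * (2 * D * w) := by gcongr; exact H.hT.le
      _ = w * T * (2 * D) := by ring
  let e : ℝ≥0 := Lb * (n : ℝ≥0)⁻¹
  have hDe : D * w = 2 * ((m + 1) * (M * w)) := by simp only [D]; ring
  have hDm : 2 * (m + 1) ≤ D := by
    simp only [D]
    exact Nat.mul_le_mul_left 2 (Nat.le_mul_of_pos_right (m + 1) (by omega))
  have hlen : M * w + m * (M * w + 1) ≤ n := by
    have e1 : M * w + m * (M * w + 1) = (m + 1) * (M * w) + m := by ring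
    rw [e1]
    omega
  have hlong : ∀ k, 1 ≤ k → ∀ a b, a + M * w ≤ b → b ≤ n →
      ∀ (κA κB : ℕ) (GA GB sA sB : ℝ≥0) (A B : Op d), Est R κA GA sA A → Est R κB GB sB B →
        κA + κB ≤ q → ∀ f, MemCbInf f →
          supNorm (A (kop (Q k (a * n ^ (k - 1)) (b * n ^ (k - 1))) (B f))) ≤
            (Cst * (GA * GB + e ^ M * (sA * sB)) : ℝ≥0) * supNorm f := by
    intro k hk a b hab hb κA κB GA GB sA sB A B hA hB hκ f hf
    have hle : ∀ b, b ≤ n → b * n ^ (k - 1) ≤ n ^ k := fun b hb => by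
      calc b * n ^ (k - 1) ≤ n * n ^ (k - 1) := Nat.mul_le_mul_right _ hb
        _ = n ^ k := by rw [← pow_succ', Nat.sub_add_cancel hk]
    exact supNorm_long_interval_le (N := n) (w := w)
      (Qf := fun a b => kop (Q k (a * n ^ (k - 1)) (b * n ^ (k - 1)))) (by omega)
      (fun a b h1 h2 => H.est_Q R hk (Nat.mul_le_mul_right _ h1) (hle b h2))
      (fun a b c h1 h2 h3 f hf => H.Q_comp hk (Nat.mul_le_mul_right _ h1)
        (Nat.mul_le_mul_right _ h2) (hle c h3) hf)
      (fun a ha => exists_reg_interval H hreg hν hη hq1 (by omega) ht htw hk ha) hab hb hA hB hκ hf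
  have hG : Grid R q (0 * n) ((0 + 1) * n) (M * w) Kh Cst (e ^ M)
      (fun a b => kop (Q (0 + 1) a b)) := by
    simp only [zero_mul, zero_add, one_mul]
    refine ⟨one_le_maxConst K R, fun a b _ h1 h2 => H.est_Q R le_rfl h1 (by simpa using h2),
      fun a b _ h1 h2 => ?_⟩
    simpa using hlong 1 le_rfl a b h1 h2
  have hF : Fam R q (0 * n) ((0 + 1) * n) Cst (e ^ M) (M * w) 0 Kh 1
      (fun a => gridOp T n P (0 + 1) a ((0 + 1) * n)) := by
    simp only [zero_mul, zero_add, one_mul]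
    refine ⟨fun a _ h1 => H.est_gridOp R h1 (by simp), fun a _ h1 κA GA sA A hA hκA f hf => ?_⟩
    refine H.supNorm_gridOp_le_of_forall hα (by omega) hA (by omega) (by omega) hf fun k hk => ?_
    refine (hlong k hk a n h1 le_rfl κA 0 GA 1 sA 1 A _ hA Est.id hκA f hf).trans ?_
    have := one_le_maxConst K R
    gcongr
  obtain ⟨Y, hY, hYF⟩ := hC T n P Q H 0 (by simp) q (M * w) q Cst (e ^ M) hG hF hq0 fun i => by
    refine le_trans ?_ (le_qReg hα β (i := (i : ℕ) + 1) (by omega) (by have := i.2; omega))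
    exact Nat.mul_le_mul_left _ (le_max_right _ _)
  -- With the identity on the left, the regularized bound becomes the supremum estimate of the
  -- error.
  have h1 := hYF.reg (0 * n) le_rfl (by simpa using hlen) 0 1 1 _ Est.id (by simp) f hf
  rw [hY f hf.memMb] at h1
  refine h1.trans (mul_le_mul_left (ENNReal.coe_le_coe.2 ?_) _)
  have h2 : e ^ M * (n : ℝ≥0) ^ c ≤ Lb ^ M * (n : ℝ≥0) ^ (-ν) := by
    rw [mul_pow, mul_assoc]
    gcongr
    rw [← NNReal.rpow_neg_one, ← NNReal.rpow_natCast, ← NNReal.rpow_natCast, ← NNReal.rpow_mul,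
      ← NNReal.rpow_add hx0]
    refine NNReal.rpow_le_rpow_of_exponent_le hx ?_
    have := Nat.le_ceil ν
    simp only [M]
    push_cast
    linarith
  have h3 : 1 ≤ maxOne T ^ p := one_le_pow₀ (one_le_maxOne T)
  calc Cst * (1 * (C * maxOne T ^ p * (n : ℝ≥0) ^ (-ν)) + e ^ M * (1 * (C * (n : ℝ≥0) ^ c)))
      = Cst * (C * maxOne T ^ p * (n : ℝ≥0) ^ (-ν) + e ^ M * (n : ℝ≥0) ^ c * C) := by ring
    _ ≤ Cst * (C * maxOne T ^ p * (n : ℝ≥0) ^ (-ν) +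
        Lb ^ M * (n : ℝ≥0) ^ (-ν) * C * maxOne T ^ p) := by
        exact mul_le_mul_right (add_le_add le_rfl
          ((mul_le_mul_left h2 C).trans (le_mul_of_one_le_right zero_le h3))) Cst
    _ = _ := by ring

/-- The error estimate, without the dependence on the regularization time. -/
theorem exists_estimate {α : ℝ} (hα : 0 < α) {ν : ℝ} (hν : 0 < ν) :
    ∃ p : ℕ, ∀ (d β : ℕ) (η T₀ : ℝ) (K : ℕ → ℝ≥0) (L : ℝ≥0), 0 ≤ η → 0 < T₀ →
      ∃ C : ℝ≥0, ∀ (T : ℝ) (n : ℕ) (P : ℝ → ℝ → Kernel (St d) (St d))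
        (Q : ℕ → ℕ → ℕ → Kernel (St d) (St d)), T₀ ≤ T → Model d K α β T n P Q →
        RegularModifications K L α hα β ν η T n Q → ∀ f, MemMb f →
          supNorm ((gridOp T n P 0 0 (0 + 1) - qHat α hα n Q 0 ν 0) f) ≤
            (C * maxOne T ^ p * (n : ℝ≥0) ^ (-ν) : ℝ≥0) * supNorm f := by
  obtain ⟨p₁, D, hD, h₁⟩ := exists_estimate_of_large hα hν
  obtain ⟨p₂, c, h₂⟩ := levelEstimate hα 0 hν
  refine ⟨p₁ + p₂, fun d β η T₀ K L hη hT₀ => ?_⟩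
  obtain ⟨C₂, hC₂⟩ := h₂ d β 0 K
  have hpow : ∀ {T : ℝ} {p : ℕ}, p ≤ p₁ + p₂ → maxOne T ^ p ≤ maxOne T ^ (p₁ + p₂) :=
    fun hp => pow_le_pow_right₀ (one_le_maxOne _) hp
  rcases Nat.eq_zero_or_pos β with rfl | hβ
  · refine ⟨C₂, fun T n P Q _ H _ f hf => ?_⟩
    have hE := hC₂ T n P Q H 0 (by simp)
    rw [kap_zero] at hE
    refine hE.ker.supNorm_le_of_memCbInf (fun g hg => ?_) hf
    refine (hE.supNorm_le le_rfl (hg 0)).trans ?_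
    rw [cbNorm_zero_eq]
    refine mul_le_mul_left (ENNReal.coe_le_coe.2 ?_) _
    gcongr _ * ?_ * _
    exact hpow (by omega)
  · obtain ⟨C₁, hC₁⟩ := h₁ d β η T₀ K L hβ hη hT₀
    refine ⟨C₁ + C₂ * (D : ℝ≥0) ^ ((c : ℝ) + ν), fun T n P Q hT H hreg f hf => ?_⟩
    have hE := hC₂ T n P Q H 0 (by simp)
    refine hE.ker.supNorm_le_of_memCbInf (fun g hg => ?_) hf
    have hx : (1 : ℝ≥0) ≤ n := by exact_mod_cast H.hn
    have hx0 : (n : ℝ≥0) ≠ 0 := (zero_lt_one.trans_le hx).ne'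
    rcases le_or_gt D n with hn | hn
    · refine (hC₁ T n P Q hT hn H hreg g hg).trans (mul_le_mul_left (ENNReal.coe_le_coe.2 ?_) _)
      gcongr ?_ * ?_ * _
      · simp
      · exact hpow (by omega)
    · refine (hE.sup g hg.memMb).trans (mul_le_mul_left (ENNReal.coe_le_coe.2 ?_) _)
      have h3 : (n : ℝ≥0) ^ c ≤ (D : ℝ≥0) ^ ((c : ℝ) + ν) * (n : ℝ≥0) ^ (-ν) := by
        have e : (n : ℝ≥0) ^ c = (n : ℝ≥0) ^ ((c : ℝ) + ν) * (n : ℝ≥0) ^ (-ν) := by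
          rw [← NNReal.rpow_add hx0, add_neg_cancel_right, NNReal.rpow_natCast]
        rw [e]
        gcongr
      have h4 : (1 : ℝ≥0) ≤ maxOne T ^ (p₁ + p₂) := one_le_pow₀ (one_le_maxOne T)
      calc C₂ * (n : ℝ≥0) ^ c ≤ C₂ * ((D : ℝ≥0) ^ ((c : ℝ) + ν) * (n : ℝ≥0) ^ (-ν)) := by gcongr
        _ = C₂ * (D : ℝ≥0) ^ ((c : ℝ) + ν) * 1 * (n : ℝ≥0) ^ (-ν) := by ring
        _ ≤ (C₁ + C₂ * (D : ℝ≥0) ^ ((c : ℝ) + ν)) * maxOne T ^ (p₁ + p₂) *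
            (n : ℝ≥0) ^ (-ν) := by
          gcongr ?_ * ?_ * _
          exact le_add_of_nonneg_left zero_le

end TVApprox

end

/-! ### The error estimate with the regularization time -/

theorem theorem2p2 (α ν : ℝ) (hα : 0 < α) (hν : 0 < ν) :
    ∃ p : ℝ, 0 ≤ p ∧
      ∀ (d β : ℕ) (η T₀ : ℝ) (K : ℕ → ℝ≥0) (L : ℝ≥0), 0 < d → 0 ≤ η → 0 < T₀ →
        ∃ C : ℝ, 0 < C ∧
          ∀ (T : ℝ) (n : ℕ)
            (P : ℝ → ℝ → Kernel (TVApprox.St d) (TVApprox.St d))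
            (Q : ℕ → ℕ → ℕ → Kernel (TVApprox.St d) (TVApprox.St d)),
            T₀ ≤ T → 1 ≤ n →
            TVApprox.IsMarkovSemigroup T P →
            (∀ k, 1 ≤ k → TVApprox.IsDiscreteMarkovSemigroup (n ^ k) (Q k)) →
            (∀ s t, 0 ≤ s → s ≤ t → t ≤ T →
              TVApprox.Transports K (TVApprox.kop (P s t)) ∧
              TVApprox.TransportsDual K (TVApprox.kop (P s t))) →
            TVApprox.RegularModifications K L α hα β ν η T n Q →
            (∀ k, 1 ≤ k →
              TVApprox.ShortTime K α β T n k P Q ∧ TVApprox.ShortTimeDual K α β T n k P Q) →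
            ∀ f : TVApprox.St d → ℝ, TVApprox.MemMb f →
              TVApprox.supNorm
                  (TVApprox.kop (P 0 T) f - TVApprox.qHat α hα n Q 0 ν 0 f) ≤
                ENNReal.ofReal (1 / (n : ℝ) ^ ν) * TVApprox.supNorm f *
                  ENNReal.ofReal (C * (1 + T ^ p)) /
                  ENNReal.ofReal (TVApprox.tNu α ν T n ^ η) := by
  obtain ⟨p, hp⟩ := TVApprox.exists_estimate hα hν
  refine ⟨p, p.cast_nonneg, fun d β η T₀ K L _ hη hT₀ => ?_⟩
  obtain ⟨C, hC⟩ := hp d β η T₀ K L hη hT₀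
  -- `2 * L + 1` is a positive upper bound for `T(ν)^η` and pays for the division by it; `C + 1`
  -- ensures positivity.
  refine ⟨(C + 1) * (2 * L + 1), by positivity, fun T n P Q hT hn hP hQ hPt hreg hS f hf => ?_⟩
  have hT0 : 0 < T := hT₀.trans_le hT
  have hE := hC T n P Q hT ⟨hT0, hn, hP, hQ, hPt, fun k hk => (hreg k hk).1, hS⟩ hreg f hf
  have hG : TVApprox.gridOp T n P 0 0 (0 + 1) = TVApprox.kop (P 0 T) := by
    simp [TVApprox.gridOp, TVApprox.step]
  rw [hG] at hE
  have hB : TVApprox.tNu α ν T n ^ η ≤ 2 * L + 1 := by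
    have h1 := TVApprox.rpow_le_of_regularModifications hν hT0 hn
      ((hQ 1 le_rfl).markov 0 n n.zero_le (by simp)) hreg
    have h2 := Real.rpow_le_rpow (TVApprox.tNu_nonneg α ν hT0 n) (TVApprox.tNu_le α ν hT0 hn) hη
    linarith
  have hmax : ((TVApprox.maxOne T ^ p : ℝ≥0) : ℝ) ≤ 1 + T ^ (p : ℝ) := by
    have hTp : 0 ≤ T ^ p := by positivity
    rw [Real.rpow_natCast]
    simp only [TVApprox.maxOne, NNReal.coe_pow, NNReal.coe_max, NNReal.coe_one,
      Real.coe_toNNReal _ hT0.le]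
    rcases max_cases 1 T with ⟨h, -⟩ | ⟨h, -⟩ <;> rw [h]
    · simpa using hTp
    · linarith
  have hx : ENNReal.ofReal (1 / (n : ℝ) ^ ν) = (((n : ℝ≥0) ^ (-ν) : ℝ≥0) : ℝ≥0∞) := by
    rw [ENNReal.ofReal, ENNReal.coe_inj]
    ext
    rw [Real.coe_toNNReal _ (by positivity), NNReal.coe_rpow, Real.rpow_neg (by simp), one_div]
    simp
  have hprod : ((C * TVApprox.maxOne T ^ p : ℝ≥0) : ℝ≥0∞) * ENNReal.ofReal (2 * L + 1) ≤
      ENNReal.ofReal ((C + 1) * (2 * L + 1) * (1 + T ^ (p : ℝ))) := by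
    rw [← ENNReal.ofReal_coe_nnreal, ← ENNReal.ofReal_mul (by positivity)]
    refine ENNReal.ofReal_le_ofReal ?_
    rw [NNReal.coe_mul]
    calc (C : ℝ) * ((TVApprox.maxOne T ^ p : ℝ≥0) : ℝ) * (2 * L + 1)
        ≤ (C + 1) * (1 + T ^ (p : ℝ)) * (2 * L + 1) := by gcongr; linarith
      _ = _ := by ring
  have hB0 : ENNReal.ofReal (2 * L + 1) ≠ 0 :=
    (ENNReal.ofReal_pos.2 (by positivity)).ne'
  set X : ℝ≥0∞ := ((C * TVApprox.maxOne T ^ p * (n : ℝ≥0) ^ (-ν) : ℝ≥0) : ℝ≥0∞) *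
    TVApprox.supNorm f with hX
  calc _ ≤ X := hE
    _ = X * ENNReal.ofReal (2 * L + 1) / ENNReal.ofReal (2 * L + 1) :=
      (ENNReal.mul_div_cancel_right hB0 ENNReal.ofReal_ne_top).symm
    _ ≤ X * ENNReal.ofReal (2 * L + 1) / ENNReal.ofReal (TVApprox.tNu α ν T n ^ η) :=
      ENNReal.div_le_div_left (ENNReal.ofReal_le_ofReal hB) _
    _ ≤ _ := by
      refine ENNReal.div_le_div_right ?_ _
      rw [hx, hX, ENNReal.coe_mul _ ((n : ℝ≥0) ^ (-ν))]
      calc _ = (((n : ℝ≥0) ^ (-ν) : ℝ≥0) : ℝ≥0∞) * TVApprox.supNorm f *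
            (((C * TVApprox.maxOne T ^ p : ℝ≥0) : ℝ≥0∞) * ENNReal.ofReal (2 * L + 1)) := by ring
        _ ≤ _ := by gcongr
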